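/- Let $\mathfrak S_n$ be the symmetric group and $\mathfrak B_n$ the group of signed permutations $w=w_1\cdots w_n$ of $[n]$ (barred letters are ordered as negative integers, products are compositions). Let $\mathbb Q\mathfrak S=\bigoplus_{n\ge 0}\mathbb Q\mathfrak S_n$ and $\mathbb Q\mathfrak B=\bigoplus_{n\ge 0}\mathbb Q\mathfrak B_n$. For $u,v$ (signed) permutations of $[p]$, $[q]$ let $u\times v$ be the (signed) permutation of $[p+q]$ acting as $u$ on the first $p$ letters and as the shift of $v$ on the last $q$ letters, and let $\mathrm{Sh}(p,q)=\{\xi\in\mathfrak S_{p+q}\mid \xi_1<\cdots<\xi_p,\ \xi_{p+1}<\cdots<\xi_{p+q}\}$. On both spaces define the product and coproduct $$u*v=\sum_{\xi\in \mathrm{Sh}(p,q)}\xi\cdot(u\times v),\qquad \Delta(w)=\sum_{p=0}^n w_{(p)}\otimes w'_{(p)},$$ where, for $w$ of degree $n$, $w=(w_{(p)}\times w'_{(p)})\cdot\xi^{-1}$ is the unique factorization with $\xi\in\mathrm{Sh}(p,n-p)$ and $w_{(p)},w'_{(p)}$ (signed) permutations of $[p]$, $[n-p]$. The unit is the element of degree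 $0$ and the counit is the projection onto degree $0$. Define the following subspaces. * $\Sigma(A)=\bigoplus_{n\ge0}\Sigma(A_{n-1})\subseteq\mathbb Q\mathfrak S$ (noncommutative symmetric functions), where $\Sigma(A_{n-1})$ is spanned by the elements $Y_J=\sum_{\mathrm{Des}(w)=J}w$, $J\subseteq[n-1]$, with $\mathrm{Des}(w)=\{i\in[n-1]\mid w_i>w_{i+1}\}$ (and is $\mathbb Q$ for $n=0$). * $\overset{\circ}{\mathfrak P}=\mathbb Q\oplus\bigoplus_{n\ge1}\overset{\circ}{\mathfrak P}_n\subseteq\mathbb Q\mathfrak S$, where the peak ideal $\overset{\circ}{\mathfrak P}_n$ is spanned by the sums of all $w\in\mathfrak S_n$ with interior peak set $\{i\in\{2,\dots,n-1\}\mid w_{i-1}<w_i>w_{i+1}\}=F$, as $F$ runs over the subsets of $\{2,\dots,n-1\}$ without two consecutive elements. * $\Omega(B)=\mathbb Q\oplus\bigoplus_{n\ge1}\Omega(B_n)\subseteq\mathbb Q\mathfrak B$, where $\Omega(B_n)$ (the Mantaci–Reutenauer algebra) is spanned by the elements $T_\alpha$, $\alpha=(a_1,\dots,a_k)$ a signed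 composition of $n$ (nonzero integers with $\sum|a_i|=n$): $T_\alpha$ is the sum of all $w\in\mathfrak B_n$ such that on each of the successive intervals of $[n]$ of lengths $|a_1|,\dots,|a_k|$ the numbers $|w_j|$ increase and the $w_j$ have constant sign, equal to that of the corresponding $a_i$, these intervals being maximal with those two properties. * $I^0=\mathbb Q\oplus\bigoplus_{n\ge1}I^0_n\subseteq\mathbb Q\mathfrak B$, where $I^0_n=\ker(\beta:\Sigma(B_n)\to\Sigma(B_{n-1}))$. Here $\Sigma(B_n)$ is the descent algebra of $\mathfrak B_n$, with basis $X_J=\sum_{\mathrm{Des}(w)\subseteq J}w$, $J\subseteq\{0,\dots,n-1\}$, where $\mathrm{Des}(w)=\{i\in\{0,\dots,n-1\}\mid w_i>w_{i+1}\}$ with $w_0=0$; and $\beta(X_J)=X_{J-1}$ if $0\notin J$, where $J-1=\{j-1\mid j\in J\}$, while $\beta(X_J)=0$ if $0\in J$. Then $\mathbb Q\mathfrak B$ and $\mathbb Q\mathfrak S$ are graded Hopf algebras, $\Omega(B)\subseteq\mathbb Q\mathfrak B$ and $\Sigma(A)\subseteq\mathbb Q\mathfrak S$ are graded Hopf subalgebras,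 and moreover: 1. $I^0\subseteq\Omega(B)$, and $I^0$ is a graded Hopf subalgebra of $\Omega(B)$; 2. $\overset{\circ}{\mathfrak P}\subseteq\Sigma(A)$, and $\overset{\circ}{\mathfrak P}$ is a graded Hopf subalgebra of $\Sigma(A)$. -/

import Mathlib

open scoped TensorProduct

noncomputable section

/-! ### Graded Hopf algebras and graded Hopf subalgebras over `ℚ` -/

/-- The structure maps of a graded bialgebra on the vector space `V`. The axioms are in
`IsGradedHopfAlgebra`. -/
structure GradedHopfOps (V : Type) [AddCommGroup V] [Module ℚ V] where
  /-- the homogeneous component of degree `n` -/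
  grade : ℕ → Submodule ℚ V
  /-- the product -/
  mul : V →ₗ[ℚ] V →ₗ[ℚ] V
  /-- the unit element -/
  one : V
  /-- the coproduct -/
  comul : V →ₗ[ℚ] V ⊗[ℚ] V
  /-- the counit -/
  counit : V →ₗ[ℚ] ℚ

/-- The subspace `K ⊗ L` of `V ⊗ V`. -/
def tensorSub {V : Type} [AddCommGroup V] [Module ℚ V] (K L : Submodule ℚ V) :
    Submodule ℚ (V ⊗[ℚ] V) :=
  LinearMap.range (TensorProduct.map K.subtype L.subtype)

/-- `V`, with the structure maps `H`, is a graded Hopf algebra with antipode `S`. -/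
structure IsGradedHopfAlgebra {V : Type} [AddCommGroup V] [Module ℚ V]
    (H : GradedHopfOps V) (S : V →ₗ[ℚ] V) : Prop where
  /-- `V` is the direct sum of its homogeneous components. -/
  isInternal : DirectSum.IsInternal H.grade
  /-- associativity and unit laws -/
  mul_assoc : ∀ x y z, H.mul (H.mul x y) z = H.mul x (H.mul y z)
  one_mul : ∀ x, H.mul H.one x = x
  mul_one : ∀ x, H.mul x H.one = x
  /-- coassociativity and counit laws -/
  coassoc : (TensorProduct.assoc ℚ V V V).toLinearMap ∘ₗ H.comul.rTensor V ∘ₗ H.comul =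
    H.comul.lTensor V ∘ₗ H.comul
  rTensor_counit : H.counit.rTensor V ∘ₗ H.comul = TensorProduct.mk ℚ ℚ V 1
  lTensor_counit : H.counit.lTensor V ∘ₗ H.comul = (TensorProduct.mk ℚ V ℚ).flip 1
  /-- the coproduct and the counit are morphisms of unital algebras; `TensorProduct.map₂`
  gives the product `(a ⊗ b)(a' ⊗ b') = aa' ⊗ bb'` of `V ⊗ V` -/
  comul_one : H.comul H.one = H.one ⊗ₜ[ℚ] H.one
  comul_mul : ∀ x y,
    H.comul (H.mul x y) = TensorProduct.map₂ H.mul H.mul (H.comul x) (H.comul y)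
  counit_one : H.counit H.one = 1
  counit_mul : ∀ x y, H.counit (H.mul x y) = H.counit x * H.counit y
  /-- the antipode axioms -/
  antipode_left : ∀ x,
    TensorProduct.lift H.mul (S.rTensor V (H.comul x)) = H.counit x • H.one
  antipode_right : ∀ x,
    TensorProduct.lift H.mul (S.lTensor V (H.comul x)) = H.counit x • H.one
  /-- all structure maps are homogeneous of degree `0` -/
  one_mem : H.one ∈ H.grade 0
  mul_mem : ∀ p q, ∀ x ∈ H.grade p, ∀ y ∈ H.grade q, H.mul x y ∈ H.grade (p + q)
  comul_mem : ∀ n, ∀ x ∈ H.grade n,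
    H.comul x ∈ ⨆ pq ∈ Finset.HasAntidiagonal.antidiagonal n, tensorSub (H.grade pq.1) (H.grade pq.2)
  counit_eq_zero : ∀ n, n ≠ 0 → ∀ x ∈ H.grade n, H.counit x = 0
  antipode_mem : ∀ n, ∀ x ∈ H.grade n, S x ∈ H.grade n

/-- `K` is a graded Hopf subalgebra of the graded Hopf algebra `V`: a graded subspace containing
the unit and closed under product, coproduct and antipode. -/
structure IsGradedHopfSubalgebra {V : Type} [AddCommGroup V] [Module ℚ V]
    (H : GradedHopfOps V) (S : V →ₗ[ℚ] V) (K : Submodule ℚ V) : Prop where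
  graded : K = ⨆ n, K ⊓ H.grade n
  one_mem : H.one ∈ K
  mul_mem : ∀ x ∈ K, ∀ y ∈ K, H.mul x y ∈ K
  comul_mem : ∀ x ∈ K, H.comul x ∈ tensorSub K K
  antipode_mem : ∀ x ∈ K, S x ∈ K

/-! ### Permutations, signed permutations, shuffles -/

/-- The set `Sh(p,q)` of `(p,q)`-shuffles. -/
def shuffles (p q : ℕ) : Finset (Equiv.Perm (Fin (p + q))) :=
  Finset.univ.filter fun ξ =>
    (∀ i j : Fin p, i < j → ξ (Fin.castAdd q i) < ξ (Fin.castAdd q j)) ∧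
    (∀ i j : Fin q, i < j → ξ (Fin.natAdd p i) < ξ (Fin.natAdd p j))

/-- The embedding `S_p × S_q → S_{p+q}`. -/
def permTimes {p q : ℕ} (u : Equiv.Perm (Fin p)) (v : Equiv.Perm (Fin q)) :
    Equiv.Perm (Fin (p + q)) :=
  finSumFinEquiv.permCongr (Equiv.sumCongr u v)

/-- The one-line notation `w_1 ⋯ w_n` of a permutation, as a function on `ℕ` with `w_0 = 0`
(and the irrelevant value `0` at `i > n`). -/
def permEntry {n : ℕ} (w : Equiv.Perm (Fin n)) : ℕ → ℕ
  | 0 => 0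
  | i + 1 => if h : i < n then (w ⟨i, h⟩ : ℕ) + 1 else 0

/-- A signed permutation of `[n]`: the word `w_1 ⋯ w_n` whose underlying permutation is `perm`,
the `i`-th letter being barred if and only if `sign i = -1`. -/
@[ext] structure SignedPerm (n : ℕ) where
  /-- the underlying permutation -/
  perm : Equiv.Perm (Fin n)
  /-- the sign of the entry in each position -/
  sign : Fin n → ℤˣ

namespace SignedPerm

variable {n : ℕ}

/-- Signed permutations as pairs. -/
def equivProd (n : ℕ) : SignedPerm n ≃ Equiv.Perm (Fin n) × (Fin n → ℤˣ) where
  toFun w := (w.perm, w.sign)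
  invFun x := ⟨x.1, x.2⟩
  left_inv _ := rfl
  right_inv _ := rfl

instance : DecidableEq (SignedPerm n) := (equivProd n).decidableEq

instance : Fintype (SignedPerm n) := Fintype.ofEquiv _ (equivProd n).symm

/-- The product is the composition of signed permutations, a signed permutation `w` being seen as
the bijection of the set of (barred and unbarred) letters with `w(i) = w_i` and
`w(-i) = - w_i`. -/
instance : Group (SignedPerm n) where
  mul w w' := ⟨w.perm * w'.perm, fun i => w.sign (w'.perm i) * w'.sign i⟩
  one := ⟨1, fun _ => 1⟩
  inv w := ⟨w.perm⁻¹, fun i => (w.sign (w.perm⁻¹ i))⁻¹⟩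
  mul_assoc a b c := SignedPerm.ext rfl (funext fun _ => mul_assoc _ _ _)
  one_mul a := SignedPerm.ext rfl (funext fun _ => one_mul _)
  mul_one a := SignedPerm.ext rfl (funext fun _ => mul_one _)
  inv_mul_cancel a := SignedPerm.ext (inv_mul_cancel a.perm) (funext fun i => by
    change (a.sign (a.perm⁻¹ (a.perm i)))⁻¹ * a.sign i = 1
    simp)

/-- A permutation, seen as a signed permutation without signs. -/
def ofPerm (ξ : Equiv.Perm (Fin n)) : SignedPerm n := ⟨ξ, fun _ => 1⟩

/-- The embedding `B_p × B_q → B_{p+q}`. -/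
def times {p q : ℕ} (u : SignedPerm p) (v : SignedPerm q) : SignedPerm (p + q) :=
  ⟨permTimes u.perm v.perm, Fin.append u.sign v.sign⟩

/-- The one-line notation `w_1 ⋯ w_n` of a signed permutation, barred letters being negative
integers, as a function on `ℕ` with `w_0 = 0` (and the irrelevant value `0` at `i > n`). -/
def entry (w : SignedPerm n) : ℕ → ℤ
  | 0 => 0
  | i + 1 => if h : i < n then ((w.sign ⟨i, h⟩ : ℤˣ) : ℤ) * ((w.perm ⟨i, h⟩ : ℕ) + 1) else 0

/-- The descent set of a signed permutation, a subset of `{0, 1, …, n-1} = Fin n`. -/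
def Des (w : SignedPerm n) : Finset (Fin n) :=
  Finset.univ.filter fun i => w.entry (i + 1) < w.entry i

end SignedPerm

/-! ### The Hopf algebra of permutations -/

/-- The direct sum of the group algebras `ℚ S_n`, `n ≥ 0`: the vector space with basis the disjoint
union of all `S_n`. -/
abbrev QS : Type := (Σ n : ℕ, Equiv.Perm (Fin n)) →₀ ℚ

/-- The basis element of `QS` given by a permutation. -/
def QS.of {n : ℕ} (w : Equiv.Perm (Fin n)) : QS := Finsupp.single ⟨n, w⟩ 1

/-- External product `u ∗ v = ∑ ξ · (u × v)`, sum over `ξ ∈ Sh(p,q)`; coproduct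
`Δ(w) = ∑ u ⊗ v`, the sum over all `p + q = n`, `u ∈ S_p`, `v ∈ S_q`, `ξ ∈ Sh(p,q)` with
`w = (u × v) · ξ⁻¹`. -/
def QS.ops : GradedHopfOps QS where
  grade n := Submodule.span ℚ (Set.range fun w : Equiv.Perm (Fin n) => QS.of w)
  mul := Finsupp.linearCombination ℚ fun u => Finsupp.linearCombination ℚ fun v =>
    ∑ ξ ∈ shuffles u.1 v.1, QS.of (ξ * permTimes u.2 v.2)
  one := QS.of (1 : Equiv.Perm (Fin 0))
  comul := Finsupp.linearCombination ℚ fun w =>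
    ∑ pq ∈ Finset.HasAntidiagonal.antidiagonal w.1,
      ∑ u : Equiv.Perm (Fin pq.1), ∑ v : Equiv.Perm (Fin pq.2), ∑ ξ ∈ shuffles pq.1 pq.2,
        if w = ⟨pq.1 + pq.2, permTimes u v * ξ⁻¹⟩ then QS.of u ⊗ₜ[ℚ] QS.of v else 0
  counit := Finsupp.linearCombination ℚ fun w => if w.1 = 0 then 1 else 0

/-! ### The Hopf algebra of signed permutations -/

/-- The direct sum of the group algebras `ℚ B_n`, `n ≥ 0`: the vector space with basis the disjoint
union of all `B_n`. -/
abbrev QB : Type := (Σ n : ℕ, SignedPerm n) →₀ ℚ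

/-- The basis element of `QB` given by a signed permutation. -/
def QB.of {n : ℕ} (w : SignedPerm n) : QB := Finsupp.single ⟨n, w⟩ 1

open SignedPerm in
/-- The external product and the coproduct are given by the same formulas as for permutations;
the shuffles `ξ` are ordinary permutations. -/
def QB.ops : GradedHopfOps QB where
  grade n := Submodule.span ℚ (Set.range fun w : SignedPerm n => QB.of w)
  mul := Finsupp.linearCombination ℚ fun u => Finsupp.linearCombination ℚ fun v =>
    ∑ ξ ∈ shuffles u.1 v.1, QB.of (ofPerm ξ * times u.2 v.2)
  one := QB.of (1 : SignedPerm 0)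
  comul := Finsupp.linearCombination ℚ fun w =>
    ∑ pq ∈ Finset.HasAntidiagonal.antidiagonal w.1,
      ∑ u : SignedPerm pq.1, ∑ v : SignedPerm pq.2, ∑ ξ ∈ shuffles pq.1 pq.2,
        if w = ⟨pq.1 + pq.2, times u v * (ofPerm ξ)⁻¹⟩ then QB.of u ⊗ₜ[ℚ] QB.of v else 0
  counit := Finsupp.linearCombination ℚ fun w => if w.1 = 0 then 1 else 0

/-! ### Noncommutative symmetric functions and interior peaks -/

/-- The descent set of a permutation, a subset of `[n-1]`, which is the set of positive elements
of `Fin n = {0, 1, …, n-1}`. -/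
def desA {n : ℕ} (w : Equiv.Perm (Fin n)) : Finset (Fin n) :=
  Finset.univ.filter fun i => 1 ≤ (i : ℕ) ∧ permEntry w (i + 1) < permEntry w i

/-- `Y_J`, the sum of the permutations with descent set `J`. -/
def YA {n : ℕ} (J : Finset (Fin n)) : QS :=
  ∑ w ∈ Finset.univ.filter (fun w : Equiv.Perm (Fin n) => desA w = J), QS.of w

/-- Solomon's descent algebra of `S_n`, the span of the `Y_J`, `J ⊆ [n-1]`. -/
def solA (n : ℕ) : Submodule ℚ QS :=
  Submodule.span ℚ {x | ∃ J : Finset (Fin n), (∀ i ∈ J, 1 ≤ (i : ℕ)) ∧ x = YA J}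

/-- `Σ(A)`, noncommutative symmetric functions: the direct sum of all descent algebras of
type A. -/
def SigmaA : Submodule ℚ QS := ⨆ n, solA n

/-- The set of interior peaks `{i ∈ {2, …, n-1} | w_{i-1} < w_i > w_{i+1}}`. -/
def intPeak {n : ℕ} (w : Equiv.Perm (Fin n)) : Finset (Fin n) :=
  Finset.univ.filter fun i => 2 ≤ (i : ℕ) ∧
    permEntry w (i - 1) < permEntry w i ∧ permEntry w (i + 1) < permEntry w i

/-- `F ⊆ {2, …, n-1}` and `F` contains no two consecutive integers. -/
def IsIntPeakSet {n : ℕ} (F : Finset (Fin n)) : Prop :=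
  (∀ i ∈ F, 2 ≤ (i : ℕ)) ∧ ∀ i ∈ F, ∀ j ∈ F, (j : ℕ) ≠ i + 1

/-- The sum of the permutations with interior peak set `F`. -/
def intPeakSum {n : ℕ} (F : Finset (Fin n)) : QS :=
  ∑ w ∈ Finset.univ.filter (fun w : Equiv.Perm (Fin n) => intPeak w = F), QS.of w

/-- The peak ideal of degree `n`. In degree `0` it is the span of the unit element. -/
def peakIdeal (n : ℕ) : Submodule ℚ QS :=
  Submodule.span ℚ {x | ∃ F : Finset (Fin n), IsIntPeakSet F ∧ x = intPeakSum F}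

/-- The direct sum of all peak ideals. -/
def PeakInt : Submodule ℚ QS := ⨆ n, peakIdeal n

/-! ### The algebra of Mantaci and Reutenauer -/

/-- The condition defining the sum `T_α`, for the signed composition `α` of `n` given by the
composition `c` of `n` into positive parts and the signs `ε` of the parts: on each of the
successive intervals of lengths `c_1, c_2, …` the numbers `|w_j|` increase and the sign of `w_j`
is constant, equal to the sign of the part; and these intervals are maximal: two
consecutive positions in distinct intervals break one of the two properties. -/
def InTClass {n : ℕ} (c : Composition n) (ε : Fin c.length → ℤˣ) (w : SignedPerm n) : Prop :=
  (∀ j, w.sign j = ε (c.index j)) ∧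
  (∀ j k, c.index j = c.index k → j < k → w.perm j < w.perm k) ∧
  (∀ j k : Fin n, (k : ℕ) = j + 1 → c.index j ≠ c.index k →
    ¬ (w.sign j = w.sign k ∧ w.perm j < w.perm k))

open Classical in
/-- `T_α`. -/
def TB {n : ℕ} (c : Composition n) (ε : Fin c.length → ℤˣ) : QB :=
  ∑ w ∈ Finset.univ.filter (fun w : SignedPerm n => InTClass c ε w), QB.of w

/-- The algebra of Mantaci and Reutenauer of degree `n`, the span of the `T_α`. In degree `0` it is
the span of the unit element. -/
def omegaB (n : ℕ) : Submodule ℚ QB :=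
  Submodule.span ℚ {x | ∃ (c : Composition n) (ε : Fin c.length → ℤˣ), x = TB c ε}

/-- `Ω(B)`. -/
def OmegaB : Submodule ℚ QB := ⨆ n, omegaB n

/-! ### The descent algebra of type B and its canonical ideal -/

/-- `Y_J`, the sum of the signed permutations with descent set `J ⊆ {0, …, n-1}`. -/
def YB {n : ℕ} (J : Finset (Fin n)) : QB :=
  ∑ w ∈ Finset.univ.filter (fun w : SignedPerm n => w.Des = J), QB.of w

/-- `X_J`, the sum of the signed permutations with descent set contained in `J`. -/
def XB {n : ℕ} (J : Finset (Fin n)) : QB :=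
  ∑ I ∈ J.powerset, YB I

/-- Solomon's descent algebra of `B_n`, the span of the `Y_J`. -/
def solB (n : ℕ) : Submodule ℚ QB := Submodule.span ℚ (Set.range (YB (n := n)))

theorem XB_mem_solB {n : ℕ} (J : Finset (Fin n)) : XB J ∈ solB n :=
  Submodule.sum_mem _ fun I _ => Submodule.subset_span ⟨I, rfl⟩

/-- A signed permutation with descent set `J`: bar the letters `i + 1`, `i ∈ J`, in `1 2 ⋯ n`. -/
def barAt {n : ℕ} (J : Finset (Fin n)) : SignedPerm n :=
  ⟨1, fun i => if i ∈ J then -1 else 1⟩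

theorem Des_barAt {n : ℕ} (J : Finset (Fin n)) : (barAt J).Des = J := by
  ext ⟨i, hi⟩
  simp only [SignedPerm.Des, Finset.mem_filter, Finset.mem_univ, true_and]
  cases i with
  | zero =>
    by_cases h : (⟨0, hi⟩ : Fin n) ∈ J <;> simp [SignedPerm.entry, barAt, hi, h]
  | succ k =>
    have hk : k < n := by omega
    by_cases h : (⟨k + 1, hi⟩ : Fin n) ∈ J <;> by_cases h' : (⟨k, hk⟩ : Fin n) ∈ J <;>
      simp [SignedPerm.entry, barAt, hi, hk, h, h'] <;> omega

theorem XB_apply {n : ℕ} (J : Finset (Fin n)) (w : SignedPerm n) :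
    XB J ⟨n, w⟩ = if w.Des ⊆ J then 1 else 0 := by
  have hY : ∀ I : Finset (Fin n), YB I ⟨n, w⟩ = if I = w.Des then (1 : ℚ) else 0 := by
    intro I
    simp [YB, QB.of, Finsupp.finsetSum_apply, Finsupp.single_apply, eq_comm]
  simp [XB, Finsupp.finsetSum_apply, hY]

theorem linearIndependent_XB (n : ℕ) : LinearIndependent ℚ (XB (n := n)) := by
  rw [Fintype.linearIndependent_iff]
  intro g hg
  have key : ∀ I : Finset (Fin n), ∑ J, (if I ⊆ J then g J else 0) = 0 := by
    intro I
    have h := DFunLike.congr_fun hg ⟨n, barAt I⟩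
    simpa [Finsupp.finsetSum_apply, XB_apply, Des_barAt] using h
  suffices ∀ k : ℕ, ∀ I : Finset (Fin n), Iᶜ.card = k → g I = 0 from fun I => this _ I rfl
  intro k
  induction k using Nat.strong_induction_on with
  | _ k ih =>
    intro I hI
    rw [← key I, Finset.sum_eq_single I]
    · simp
    · intro J _ hJ
      split_ifs with h
      · refine ih _ ?_ J rfl
        rw [← hI]
        exact Finset.card_lt_card
          (Finset.compl_ssubset_compl.mpr (lt_of_le_of_ne h (Ne.symm hJ)))
      · rfl
    · simp

theorem span_XB (n : ℕ) : Submodule.span ℚ (Set.range (XB (n := n))) = solB n := by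
  have : FiniteDimensional ℚ (solB n) := FiniteDimensional.span_of_finite ℚ (Set.finite_range _)
  refine Submodule.eq_of_le_of_finrank_le ?_ ?_
  · rw [Submodule.span_le]
    rintro _ ⟨J, rfl⟩
    exact XB_mem_solB J
  · rw [finrank_span_eq_card (linearIndependent_XB n)]
    exact finrank_range_le_card _

/-- The basis `X_J` of `solB n`. -/
def basisXB (n : ℕ) : Module.Basis (Finset (Fin n)) ℚ (solB n) :=
  (Module.Basis.span (linearIndependent_XB n)).map (LinearEquiv.ofEq _ _ (span_XB n))

theorem basisXB_apply {n : ℕ} (J : Finset (Fin n)) : (basisXB n J : QB) = XB J := by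
  simp [basisXB, Module.Basis.span_apply]

/-- The map `β` with `β(X_J) = X_{J-1}` if `0 ∉ J` and `β(X_J) = 0` if `0 ∈ J`; the shifted set
`J - 1` is `{k | k + 1 ∈ J}`. -/
def betaMap (n : ℕ) : solB (n + 1) →ₗ[ℚ] solB n :=
  (basisXB (n + 1)).constr ℚ fun J =>
    if (0 : Fin (n + 1)) ∈ J then 0 else basisXB n (Finset.univ.filter fun k => k.succ ∈ J)

/-- The canonical ideal `ker β` of the descent algebra of `B_n`, for `n ≥ 1`; in degree `0` it
stands for the summand `ℚ` of the direct sum, the span of the unit element. -/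
def canonicalIdeal : ℕ → Submodule ℚ QB
  | 0 => Submodule.span ℚ {QB.of (1 : SignedPerm 0)}
  | n + 1 => (LinearMap.ker (betaMap n)).map (solB (n + 1)).subtype

/-- `I⁰`, the direct sum of all canonical ideals. -/
def CanonicalI : Submodule ℚ QB := ⨆ n, canonicalIdeal n

end

/-! Stable sorting attaches to each signed word (letters are pairs of a natural number and a sign)
the inverse of its standardization, a signed permutation, and every signed permutation arises in
this way. In these terms the coproduct is deconcatenation (`QB.comul_ofWord`). If every letter of
the first word is smaller than every letter of the second, the product is the sum over shuffles
(`QB.mul_ofWord`). The bialgebra axioms of `QB` thus become identities about shuffles and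
deconcatenations, the main one being `shuffleSum_splitSum`. Forgetting signs is a surjection
compatible with all structure maps, so `QS` inherits the axioms.

Degree `0` is the line of the unit, so the identity has a convolution inverse, the geometric series
in `augProj`, which is finite in each degree. This antipode preserves every graded subspace that
contains the unit and is closed under product and coproduct. Only such closure remains to be proved.

All four subspaces come from one construction. Let `QB.incr A n` be the sum of the increasing signed
permutations of `[n]` with signs in `A`. Its coproduct is the sum of `QB.incr A p ⊗ QB.incr A q`
over `p + q = n` (`QB.comul_incr`), so any family of such elements generates a graded subbialgebra.
A product of generators is the sum over all `w` that increase inside given blocks, with given sign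
sets and no condition across the cuts; inclusion-exclusion at the cuts also prescribes descents.

The sets `{1}` and `{-1}` generate `Ω(B)`: the class `T_α` fixes the signs, and an ascent or a
descent between any two neighbours of equal sign. The set of both signs generates `I⁰`, because `ker
β` is spanned by the `X_J` with `0 ∈ J`, which prescribe nothing but ascents. Such sums are unions
of `T`-classes, whence `I⁰ ⊆ Ω(B)`.

Forgetting signs maps `Ω(B)` onto `Σ(A)`. It maps `I⁰` onto the peak ideals: an increasing signed
permutation loses its signs to a permutation without interior peaks, two signings giving the same
one in positive degree. Products give permutations without peaks inside blocks, and these sums are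
unitriangular over the interior peak sums. The inclusion in type A is the image of the one in type
B. -/

noncomputable section

/-! ### The antipode of a connected graded bialgebra -/

/-- The axioms of a graded bialgebra whose component of degree `0` is spanned by the unit. -/
structure IsConnectedGradedBialgebra {V : Type} [AddCommGroup V] [Module ℚ V]
    (H : GradedHopfOps V) : Prop where
  isInternal : DirectSum.IsInternal H.grade
  mul_assoc : ∀ x y z, H.mul (H.mul x y) z = H.mul x (H.mul y z)
  one_mul : ∀ x, H.mul H.one x = x
  mul_one : ∀ x, H.mul x H.one = x
  coassoc : (TensorProduct.assoc ℚ V V V).toLinearMap ∘ₗ H.comul.rTensor V ∘ₗ H.comul =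
    H.comul.lTensor V ∘ₗ H.comul
  rTensor_counit : H.counit.rTensor V ∘ₗ H.comul = TensorProduct.mk ℚ ℚ V 1
  lTensor_counit : H.counit.lTensor V ∘ₗ H.comul = (TensorProduct.mk ℚ V ℚ).flip 1
  comul_one : H.comul H.one = H.one ⊗ₜ[ℚ] H.one
  comul_mul : ∀ x y,
    H.comul (H.mul x y) = TensorProduct.map₂ H.mul H.mul (H.comul x) (H.comul y)
  counit_one : H.counit H.one = 1
  counit_mul : ∀ x y, H.counit (H.mul x y) = H.counit x * H.counit y
  one_mem : H.one ∈ H.grade 0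
  mul_mem : ∀ p q, ∀ x ∈ H.grade p, ∀ y ∈ H.grade q, H.mul x y ∈ H.grade (p + q)
  comul_mem : ∀ n, ∀ x ∈ H.grade n,
    H.comul x ∈ ⨆ pq ∈ Finset.HasAntidiagonal.antidiagonal n, tensorSub (H.grade pq.1) (H.grade pq.2)
  counit_eq_zero : ∀ n, n ≠ 0 → ∀ x ∈ H.grade n, H.counit x = 0
  grade_zero_le : H.grade 0 ≤ Submodule.span ℚ {H.one}

/-- `K` is a graded subspace containing the unit and closed under product and coproduct. -/
structure IsGradedSubbialgebra {V : Type} [AddCommGroup V] [Module ℚ V]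
    (H : GradedHopfOps V) (K : Submodule ℚ V) : Prop where
  graded : K = ⨆ n, K ⊓ H.grade n
  one_mem : H.one ∈ K
  mul_mem : ∀ x ∈ K, ∀ y ∈ K, H.mul x y ∈ K
  comul_mem : ∀ x ∈ K, H.comul x ∈ tensorSub K K

/-! ### Subspaces of a tensor square -/

section Tensor

variable {V : Type} [AddCommGroup V] [Module ℚ V]

theorem tmul_mem_tensorSub {K L : Submodule ℚ V} {x y : V} (hx : x ∈ K) (hy : y ∈ L) :
    x ⊗ₜ[ℚ] y ∈ tensorSub K L :=
  ⟨(⟨x, hx⟩ : K) ⊗ₜ[ℚ] (⟨y, hy⟩ : L), by simp⟩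

theorem tensorSub_le_iff {K L : Submodule ℚ V} {M : Submodule ℚ (V ⊗[ℚ] V)} :
    tensorSub K L ≤ M ↔ ∀ x ∈ K, ∀ y ∈ L, x ⊗ₜ[ℚ] y ∈ M := by
  constructor
  · intro h x hx y hy
    exact h (tmul_mem_tensorSub hx hy)
  · rintro h _ ⟨t, rfl⟩
    induction t with
    | zero => simp
    | tmul x y => simpa using h x x.2 y y.2
    | add a b ha hb => rw [map_add]; exact M.add_mem ha hb

theorem map₂_mem_tensorSub {m : V →ₗ[ℚ] V →ₗ[ℚ] V} {K : Submodule ℚ V}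
    (hm : ∀ x ∈ K, ∀ y ∈ K, m x y ∈ K) {s t : V ⊗[ℚ] V}
    (hs : s ∈ tensorSub K K) (ht : t ∈ tensorSub K K) :
    TensorProduct.map₂ m m s t ∈ tensorSub K K := by
  have h1 : tensorSub K K ≤ (tensorSub K K).comap ((TensorProduct.map₂ m m).flip t) := by
    rw [tensorSub_le_iff]
    intro a ha b hb
    have h2 : tensorSub K K ≤ (tensorSub K K).comap (TensorProduct.map₂ m m (a ⊗ₜ b)) := by
      rw [tensorSub_le_iff]
      intro c hc d hd
      simpa using tmul_mem_tensorSub (hm a ha c hc) (hm b hb d hd)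
    exact h2 ht
  exact h1 hs

end Tensor

/-! ### The convolution algebra of endomorphisms -/

namespace GradedHopfOps

variable {V : Type} [AddCommGroup V] [Module ℚ V] (H : GradedHopfOps V)

/-- The convolution product of two endomorphisms. -/
def conv (f g : V →ₗ[ℚ] V) : V →ₗ[ℚ] V :=
  TensorProduct.lift H.mul ∘ₗ TensorProduct.map f g ∘ₗ H.comul

/-- The convolution unit. -/
def convOne : V →ₗ[ℚ] V := H.counit.smulRight H.one

/-- The projection onto the kernel of the counit. -/
def augProj : V →ₗ[ℚ] V := LinearMap.id - H.convOne

/-- The convolution powers of `augProj`. -/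
def augPow : ℕ → V →ₗ[ℚ] V
  | 0 => H.convOne
  | k + 1 => H.conv H.augProj (augPow k)

/-- The truncated alternating sum of the convolution powers of `augProj`. -/
def antipodeSum (n : ℕ) : V →ₗ[ℚ] V := ∑ k ∈ Finset.range (n + 1), (-1 : ℚ) ^ k • H.augPow k

variable {H}

theorem conv_add_left (f f' g : V →ₗ[ℚ] V) :
    H.conv (f + f') g = H.conv f g + H.conv f' g := by
  simp [conv, TensorProduct.map_add_left, LinearMap.add_comp, LinearMap.comp_add]

theorem conv_add_right (f g g' : V →ₗ[ℚ] V) :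
    H.conv f (g + g') = H.conv f g + H.conv f g' := by
  simp [conv, TensorProduct.map_add_right, LinearMap.add_comp, LinearMap.comp_add]

theorem conv_sum_smul_left (s : Finset ℕ) (a : ℕ → ℚ) (f : ℕ → V →ₗ[ℚ] V) (g : V →ₗ[ℚ] V) :
    H.conv (∑ k ∈ s, a k • f k) g = ∑ k ∈ s, a k • H.conv (f k) g := by
  induction s using Finset.cons_induction with
  | empty => simp [conv, TensorProduct.map_zero_left]
  | cons k s hk ih =>
    rw [Finset.sum_cons, Finset.sum_cons, conv_add_left, ih]
    simp [conv, TensorProduct.map_smul_left, LinearMap.smul_comp, LinearMap.comp_smul]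

theorem conv_sum_smul_right (s : Finset ℕ) (a : ℕ → ℚ) (f : V →ₗ[ℚ] V) (g : ℕ → V →ₗ[ℚ] V) :
    H.conv f (∑ k ∈ s, a k • g k) = ∑ k ∈ s, a k • H.conv f (g k) := by
  induction s using Finset.cons_induction with
  | empty => simp [conv, TensorProduct.map_zero_right]
  | cons k s hk ih =>
    rw [Finset.sum_cons, Finset.sum_cons, conv_add_right, ih]
    simp [conv, TensorProduct.map_smul_right, LinearMap.smul_comp, LinearMap.comp_smul]

theorem conv_mem_of_mem_tensorSub {K L M : Submodule ℚ V} {f g : V →ₗ[ℚ] V}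
    (hm : ∀ x ∈ K, ∀ y ∈ L, H.mul (f x) (g y) ∈ M) {t : V ⊗[ℚ] V} (ht : t ∈ tensorSub K L) :
    TensorProduct.lift H.mul (TensorProduct.map f g t) ∈ M := by
  have : tensorSub K L ≤ M.comap (TensorProduct.lift H.mul ∘ₗ TensorProduct.map f g) := by
    rw [tensorSub_le_iff]
    intro x hx y hy
    simpa using hm x hx y hy
  exact this ht

end GradedHopfOps

namespace IsConnectedGradedBialgebra

open GradedHopfOps

variable {V : Type} [AddCommGroup V] [Module ℚ V] {H : GradedHopfOps V}
  (h : IsConnectedGradedBialgebra H)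
include h

theorem convOne_conv (f : V →ₗ[ℚ] V) : H.conv H.convOne f = f := by
  have e : TensorProduct.lift H.mul ∘ₗ TensorProduct.map H.convOne f =
      f ∘ₗ (TensorProduct.lid ℚ V).toLinearMap ∘ₗ H.counit.rTensor V := by
    ext x y
    simp [convOne, h.one_mul]
  rw [conv, ← LinearMap.comp_assoc, e, LinearMap.comp_assoc, LinearMap.comp_assoc,
    h.rTensor_counit]
  ext x
  simp

theorem conv_convOne (f : V →ₗ[ℚ] V) : H.conv f H.convOne = f := by
  have e : TensorProduct.lift H.mul ∘ₗ TensorProduct.map f H.convOne =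
      f ∘ₗ (TensorProduct.rid ℚ V).toLinearMap ∘ₗ H.counit.lTensor V := by
    ext x y
    simp [convOne, h.mul_one]
  rw [conv, ← LinearMap.comp_assoc, e, LinearMap.comp_assoc, LinearMap.comp_assoc,
    h.lTensor_counit]
  ext x
  simp

theorem conv_assoc (f g k : V →ₗ[ℚ] V) :
    H.conv (H.conv f g) k = H.conv f (H.conv g k) := by
  have e1 : TensorProduct.map (H.conv f g) k =
      TensorProduct.map (TensorProduct.lift H.mul ∘ₗ TensorProduct.map f g) k ∘ₗ
        H.comul.rTensor V := by
    ext x y; simp [conv]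
  have e2 : TensorProduct.map f (H.conv g k) =
      TensorProduct.map f (TensorProduct.lift H.mul ∘ₗ TensorProduct.map g k) ∘ₗ
        H.comul.lTensor V := by
    ext x y; simp [conv]
  have e3 : TensorProduct.lift H.mul ∘ₗ
      TensorProduct.map (TensorProduct.lift H.mul ∘ₗ TensorProduct.map f g) k =
      TensorProduct.lift H.mul ∘ₗ
      TensorProduct.map f (TensorProduct.lift H.mul ∘ₗ TensorProduct.map g k) ∘ₗ
      (TensorProduct.assoc ℚ V V V).toLinearMap := by
    ext x y z; simp [h.mul_assoc]
  have e4 := h.coassoc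
  calc H.conv (H.conv f g) k = (TensorProduct.lift H.mul ∘ₗ
      TensorProduct.map (TensorProduct.lift H.mul ∘ₗ TensorProduct.map f g) k) ∘ₗ
        (H.comul.rTensor V ∘ₗ H.comul) := by
        rw [conv, e1]; simp only [LinearMap.comp_assoc]
    _ = TensorProduct.lift H.mul ∘ₗ
      TensorProduct.map f (TensorProduct.lift H.mul ∘ₗ TensorProduct.map g k) ∘ₗ
      ((TensorProduct.assoc ℚ V V V).toLinearMap ∘ₗ H.comul.rTensor V ∘ₗ H.comul) := by
        rw [e3]; simp only [LinearMap.comp_assoc]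
    _ = _ := by rw [e4, conv, e2]; simp only [LinearMap.comp_assoc]

/-- The powers are built by multiplying on the left; this form is needed for the series to be an
inverse on the other side too. -/
theorem augPow_succ' (k : ℕ) : H.augPow (k + 1) = H.conv (H.augPow k) H.augProj := by
  induction k with
  | zero => simp only [augPow, h.conv_convOne, h.convOne_conv]
  | succ k ih =>
    conv_lhs => rw [augPow, ih, ← h.conv_assoc]
    rw [← augPow]

/-- Connectedness enters the construction of the antipode here. -/
theorem augProj_eq_zero {x : V} (hx : x ∈ H.grade 0) : H.augProj x = 0 := by
  obtain ⟨c, rfl⟩ := Submodule.mem_span_singleton.1 (h.grade_zero_le hx)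
  simp [augProj, convOne, h.counit_one]

theorem conv_mem {f g : V →ₗ[ℚ] V} {n : ℕ} {M : Submodule ℚ V} {x : V} (hx : x ∈ H.grade n)
    (hm : ∀ p q, p + q = n → ∀ y ∈ H.grade p, ∀ z ∈ H.grade q, H.mul (f y) (g z) ∈ M) :
    H.conv f g x ∈ M := by
  have : (⨆ pq ∈ Finset.HasAntidiagonal.antidiagonal n,
      tensorSub (H.grade pq.1) (H.grade pq.2)) ≤
      M.comap (TensorProduct.lift H.mul ∘ₗ TensorProduct.map f g) := by
    refine iSup₂_le fun pq hpq t ht => ?_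
    exact conv_mem_of_mem_tensorSub (hm _ _ (Finset.HasAntidiagonal.mem_antidiagonal.1 hpq)) ht
  exact this (h.comul_mem n x hx)

/-- Each factor `augProj` kills degree `0`, hence uses up at least one degree; more than `n` factors
leave nothing in degree `n`. -/
theorem augPow_eq_zero {k n : ℕ} (hn : n < k) {x : V} (hx : x ∈ H.grade n) :
    H.augPow k x = 0 := by
  induction k generalizing n x with
  | zero => omega
  | succ k ih =>
    rw [augPow, ← Submodule.mem_bot ℚ]
    refine h.conv_mem hx fun p q hpq y hy z hz => ?_
    rcases Nat.eq_zero_or_pos p with rfl | hp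
    · rw [h.augProj_eq_zero hy]; simp
    · rw [ih (by omega) hz]; simp

theorem convOne_mem {n : ℕ} {x : V} (hx : x ∈ H.grade n) : H.convOne x ∈ H.grade n := by
  rcases eq_or_ne n 0 with rfl | hn
  · exact Submodule.smul_mem _ _ h.one_mem
  · simp [convOne, h.counit_eq_zero n hn x hx]

theorem augPow_mem (k : ℕ) {n : ℕ} {x : V} (hx : x ∈ H.grade n) : H.augPow k x ∈ H.grade n := by
  induction k generalizing n x with
  | zero => exact h.convOne_mem hx
  | succ k ih =>
    rw [augPow]
    refine h.conv_mem hx fun p q hpq y hy z hz => ?_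
    subst hpq
    exact h.mul_mem p q _ (Submodule.sub_mem _ hy (h.convOne_mem hy)) _ (ih hz)

theorem antipodeSum_eq {m n : ℕ} (hmn : m ≤ n) {x : V} (hx : x ∈ H.grade m) :
    H.antipodeSum n x = H.antipodeSum m x := by
  simp only [antipodeSum, LinearMap.sum_apply, LinearMap.smul_apply]
  symm
  refine Finset.sum_subset (Finset.range_subset_range.2 (by omega)) fun k _ hk => ?_
  rw [h.augPow_eq_zero (by simpa using hk) hx, smul_zero]

omit h in
theorem id_eq : (LinearMap.id : V →ₗ[ℚ] V) = H.augProj + H.convOne := by simp [augProj]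

-- Telescoping sum, obtained by writing the identity as `augProj + convOne` in a convolution with
-- the truncated series.
omit h in
theorem sum_alternating (n : ℕ) :
    ∑ k ∈ Finset.range (n + 1), (-1 : ℚ) ^ k • (H.augPow (k + 1) + H.augPow k) =
      H.convOne + (-1 : ℚ) ^ n • H.augPow (n + 1) := by
  induction n with
  | zero => simp [augPow, add_comm]
  | succ n ih =>
    rw [Finset.sum_range_succ, ih, pow_succ, mul_neg_one, neg_smul, neg_smul, smul_add]
    abel

/-- Truncated geometric series; the error term vanishes in degrees up to `n`. -/
theorem antipodeSum_conv (n : ℕ) :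
    H.conv (H.antipodeSum n) LinearMap.id = H.convOne + (-1 : ℚ) ^ n • H.augPow (n + 1) := by
  rw [antipodeSum, conv_sum_smul_left, ← sum_alternating]
  refine Finset.sum_congr rfl fun k _ => ?_
  rw [id_eq, conv_add_right, h.conv_convOne, h.augPow_succ']

theorem conv_antipodeSum (n : ℕ) :
    H.conv LinearMap.id (H.antipodeSum n) = H.convOne + (-1 : ℚ) ^ n • H.augPow (n + 1) := by
  rw [antipodeSum, conv_sum_smul_right, ← sum_alternating]
  refine Finset.sum_congr rfl fun k _ => ?_
  rw [id_eq, conv_add_left, h.convOne_conv, augPow]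

theorem mem_induction {M : Submodule ℚ V} (hM : ∀ n, H.grade n ≤ M) (x : V) : x ∈ M := by
  have : (⨆ n, H.grade n) ≤ M := iSup_le hM
  rw [h.isInternal.submodule_iSup_eq_top] at this
  exact this trivial

/-- There is a linear map that is given by `antipodeSum n` on the component of degree `n`. -/
theorem exists_antipode : ∃ S : V →ₗ[ℚ] V, ∀ n, ∀ x ∈ H.grade n, S x = H.antipodeSum n x := by
  let e := LinearEquiv.ofBijective (DirectSum.coeLinearMap H.grade) h.isInternal
  refine ⟨DirectSum.toModule ℚ ℕ V (fun n => (H.antipodeSum n).domRestrict (H.grade n)) ∘ₗ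
    e.symm.toLinearMap, fun n x hx => ?_⟩
  have : e.symm x = DirectSum.lof ℚ ℕ (fun n => H.grade n) n ⟨x, hx⟩ := by
    rw [LinearEquiv.symm_apply_eq]
    exact (DirectSum.coeLinearMap_lof H.grade n ⟨x, hx⟩).symm
  simp [this]

theorem isGradedHopfAlgebra {S : V →ₗ[ℚ] V}
    (hS : ∀ n, ∀ x ∈ H.grade n, S x = H.antipodeSum n x) : IsGradedHopfAlgebra H S := by
  have hS' : ∀ {m n}, m ≤ n → ∀ x ∈ H.grade m, (S - H.antipodeSum n) x = 0 := by
    intro m n hmn x hx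
    rw [LinearMap.sub_apply, hS m x hx, h.antipodeSum_eq hmn hx, sub_self]
  have left : H.conv S LinearMap.id = H.convOne := by
    ext x
    refine h.mem_induction (M := LinearMap.eqLocus _ _) (fun n x hx => ?_) x
    -- The coproduct of `x` only involves degrees at most `n`, where `S` agrees with the truncation
    -- at `n`.
    have e1 : H.conv (S - H.antipodeSum n) LinearMap.id x = 0 := by
      rw [← Submodule.mem_bot ℚ]
      refine h.conv_mem hx fun p q hpq y hy z _ => ?_
      rw [hS' (by omega) y hy]; simp
    have e2 : S = (S - H.antipodeSum n) + H.antipodeSum n := by simp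
    rw [LinearMap.mem_eqLocus, e2, conv_add_left, LinearMap.add_apply, e1, h.antipodeSum_conv]
    simp [h.augPow_eq_zero (Nat.lt_succ_self n) hx]
  have right : H.conv LinearMap.id S = H.convOne := by
    ext x
    refine h.mem_induction (M := LinearMap.eqLocus _ _) (fun n x hx => ?_) x
    have e1 : H.conv LinearMap.id (S - H.antipodeSum n) x = 0 := by
      rw [← Submodule.mem_bot ℚ]
      refine h.conv_mem hx fun p q hpq y _ z hz => ?_
      rw [hS' (by omega) z hz]; simp
    have e2 : S = (S - H.antipodeSum n) + H.antipodeSum n := by simp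
    rw [LinearMap.mem_eqLocus, e2, conv_add_right, LinearMap.add_apply, e1, h.conv_antipodeSum]
    simp [h.augPow_eq_zero (Nat.lt_succ_self n) hx]
  exact
  { isInternal := h.isInternal
    mul_assoc := h.mul_assoc
    one_mul := h.one_mul
    mul_one := h.mul_one
    coassoc := h.coassoc
    rTensor_counit := h.rTensor_counit
    lTensor_counit := h.lTensor_counit
    comul_one := h.comul_one
    comul_mul := h.comul_mul
    counit_one := h.counit_one
    counit_mul := h.counit_mul
    antipode_left := fun x => LinearMap.congr_fun left x
    antipode_right := fun x => LinearMap.congr_fun right x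
    one_mem := h.one_mem
    mul_mem := h.mul_mem
    comul_mem := h.comul_mem
    counit_eq_zero := h.counit_eq_zero
    antipode_mem := fun n x hx => by
      rw [hS n x hx, antipodeSum, LinearMap.sum_apply]
      exact Submodule.sum_mem _ fun k _ => Submodule.smul_mem _ _ (h.augPow_mem k hx) }

-- On degree `n` the antipode is a linear combination of convolution powers of `augProj`, and each
-- of these preserves `K`. Gradedness of `K` allows the argument to proceed one degree at a time.
omit h in
theorem _root_.IsGradedSubbialgebra.isGradedHopfSubalgebra {S : V →ₗ[ℚ] V} {K : Submodule ℚ V}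
    (hK : IsGradedSubbialgebra H K)
    (hS : ∀ n, ∀ x ∈ H.grade n, S x = H.antipodeSum n x) : IsGradedHopfSubalgebra H S K := by
  have one : ∀ x ∈ K, H.convOne x ∈ K := fun x _ => Submodule.smul_mem _ _ hK.one_mem
  have pow : ∀ k, ∀ x ∈ K, H.augPow k x ∈ K := by
    intro k
    induction k with
    | zero => exact one
    | succ k ih =>
      intro x hx
      refine conv_mem_of_mem_tensorSub (fun y hy z hz => ?_) (hK.comul_mem x hx)
      exact hK.mul_mem _ (Submodule.sub_mem _ hy (one y hy)) _ (ih z hz)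
  refine ⟨hK.graded, hK.one_mem, hK.mul_mem, hK.comul_mem, fun x hx => ?_⟩
  have : K ≤ K.comap S := by
    conv_lhs => rw [hK.graded]
    refine iSup_le fun n y hy => ?_
    rw [Submodule.mem_comap, hS n y hy.2, antipodeSum, LinearMap.sum_apply]
    exact Submodule.sum_mem _ fun k _ => Submodule.smul_mem _ _ (pow k y hy.1)
  exact this hx

end IsConnectedGradedBialgebra

/-! ### Subbialgebras generated by homogeneous elements -/

section Generated

variable {V : Type} [AddCommGroup V] [Module ℚ V]

/-- The product of a list of elements. -/
def listMul (H : GradedHopfOps V) (L : List V) : V := L.foldr (fun x y => H.mul x y) H.one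

/-- The subalgebra generated by a family of elements. -/
def genSub (H : GradedHopfOps V) {ι : Type} (g : ι → V) : Submodule ℚ V :=
  Submodule.span ℚ (Set.range fun L : List ι => listMul H (L.map g))

variable {H : GradedHopfOps V} {ι : Type} {g : ι → V}

theorem one_mem_genSub : H.one ∈ genSub H g := Submodule.subset_span ⟨[], rfl⟩

theorem mul_gen_mem_genSub (i : ι) {x : V} (hx : x ∈ genSub H g) :
    H.mul (g i) x ∈ genSub H g := by
  have : genSub H g ≤ (genSub H g).comap (H.mul (g i)) := by
    refine Submodule.span_le.2 ?_
    rintro _ ⟨L, rfl⟩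
    exact Submodule.subset_span ⟨i :: L, rfl⟩
  exact this hx

theorem mul_mem_genSub (h : IsConnectedGradedBialgebra H) {x y : V} (hx : x ∈ genSub H g)
    (hy : y ∈ genSub H g) : H.mul x y ∈ genSub H g := by
  have : genSub H g ≤ (genSub H g).comap (H.mul.flip y) := by
    refine Submodule.span_le.2 ?_
    rintro _ ⟨L, rfl⟩
    change H.mul (listMul H (L.map g)) y ∈ genSub H g
    induction L with
    | nil => simpa [listMul, h.one_mul] using hy
    | cons i L ih =>
      rw [List.map_cons, listMul, List.foldr_cons, h.mul_assoc]
      exact mul_gen_mem_genSub i ih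
  exact this hx

theorem gen_mem_genSub (h : IsConnectedGradedBialgebra H) (i : ι) : g i ∈ genSub H g := by
  simpa [h.mul_one] using mul_gen_mem_genSub (H := H) i one_mem_genSub

/-- Since the coproduct is multiplicative, its closure condition need only be checked on generators.
-/
theorem isGradedSubbialgebra_genSub (h : IsConnectedGradedBialgebra H)
    (hg : ∀ i, ∃ n, g i ∈ H.grade n)
    (hc : ∀ i, H.comul (g i) ∈ tensorSub (genSub H g) (genSub H g)) :
    IsGradedSubbialgebra H (genSub H g) := by
  refine ⟨le_antisymm (Submodule.span_le.2 ?_) (iSup_le fun n => inf_le_left), one_mem_genSub,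
    fun x hx y hy => mul_mem_genSub h hx hy, fun x hx => ?_⟩
  · rintro _ ⟨L, rfl⟩
    have : ∃ n, listMul H (L.map g) ∈ H.grade n := by
      induction L with
      | nil => exact ⟨0, h.one_mem⟩
      | cons i L ih =>
        obtain ⟨n, hn⟩ := ih
        obtain ⟨m, hm⟩ := hg i
        exact ⟨m + n, h.mul_mem m n _ hm _ hn⟩
    obtain ⟨n, hn⟩ := this
    exact Submodule.mem_iSup_of_mem n ⟨Submodule.subset_span ⟨L, rfl⟩, hn⟩
  · have : genSub H g ≤ (tensorSub (genSub H g) (genSub H g)).comap H.comul := by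
      refine Submodule.span_le.2 ?_
      rintro _ ⟨L, rfl⟩
      change H.comul (listMul H (L.map g)) ∈ tensorSub _ _
      induction L with
      | nil => exact h.comul_one ▸ tmul_mem_tensorSub one_mem_genSub one_mem_genSub
      | cons i L ih =>
        rw [List.map_cons, listMul, List.foldr_cons, h.comul_mul]
        exact map₂_mem_tensorSub (fun x hx y hy => mul_mem_genSub h hx hy) (hc i) ih
    exact this hx

end Generated

/-! ### Factorization of (signed) permutations through shuffles -/

section Factorization

variable {p q : ℕ}

@[simp] theorem permTimes_castAdd (u : Equiv.Perm (Fin p)) (v : Equiv.Perm (Fin q)) (i : Fin p) :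
    permTimes u v (Fin.castAdd q i) = Fin.castAdd q (u i) := by
  simp [permTimes, Equiv.permCongr_apply]

@[simp] theorem permTimes_natAdd (u : Equiv.Perm (Fin p)) (v : Equiv.Perm (Fin q)) (i : Fin q) :
    permTimes u v (Fin.natAdd p i) = Fin.natAdd p (v i) := by
  simp [permTimes, Equiv.permCongr_apply]

theorem permTimes_mul (u u' : Equiv.Perm (Fin p)) (v v' : Equiv.Perm (Fin q)) :
    permTimes u v * permTimes u' v' = permTimes (u * u') (v * v') := by
  ext i
  refine Fin.addCases (fun i => ?_) (fun i => ?_) i <;> simp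

@[simp] theorem permTimes_one : permTimes (1 : Equiv.Perm (Fin p)) (1 : Equiv.Perm (Fin q)) = 1 := by
  ext i
  refine Fin.addCases (fun i => ?_) (fun i => ?_) i <;> simp

theorem permTimes_inv (u : Equiv.Perm (Fin p)) (v : Equiv.Perm (Fin q)) :
    (permTimes u v)⁻¹ = permTimes u⁻¹ v⁻¹ := by
  rw [inv_eq_iff_mul_eq_one, permTimes_mul]
  simp

theorem mem_shuffles {ξ : Equiv.Perm (Fin (p + q))} : ξ ∈ shuffles p q ↔
    StrictMono (ξ ∘ Fin.castAdd q) ∧ StrictMono (ξ ∘ Fin.natAdd p) := by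
  simp [shuffles, StrictMono]

theorem Equiv.Perm.eq_sort_of_strictMono {n : ℕ} {α : Type} [LinearOrder α] {f : Fin n → α}
    {σ : Equiv.Perm (Fin n)} (h : StrictMono (f ∘ σ)) : σ = Tuple.sort f :=
  Tuple.eq_sort_iff.2 ⟨h.monotone, fun _ _ hij hf => absurd hf (h hij).ne⟩

theorem strictMono_comp_sort {n : ℕ} {α : Type} [LinearOrder α] {f : Fin n → α}
    (hf : Function.Injective f) : StrictMono (f ∘ Tuple.sort f) :=
  (Tuple.monotone_sort f).strictMono_of_injective (hf.comp (Tuple.sort f).injective)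

/-- Shuffles are coset representatives: sorting the first `p` and the last `q` letters of `w`
separately leaves a shuffle, and the two sorting permutations are the inverses of `u` and `v`. -/
theorem shuffle_mul_permTimes_bijective : Function.Bijective
    fun x : shuffles p q × Equiv.Perm (Fin p) × Equiv.Perm (Fin q) =>
      x.1.1 * permTimes x.2.1 x.2.2 := by
  constructor
  · rintro ⟨⟨ξ, hξ⟩, u, v⟩ ⟨⟨ξ', hξ'⟩, u', v'⟩ h
    simp only at h
    have key : ∀ {ξ : Equiv.Perm (Fin (p + q))} {u : Equiv.Perm (Fin p)}
        {v : Equiv.Perm (Fin q)}, ξ ∈ shuffles p q →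
        u⁻¹ = Tuple.sort ((ξ * permTimes u v) ∘ Fin.castAdd q) ∧
        v⁻¹ = Tuple.sort ((ξ * permTimes u v) ∘ Fin.natAdd p) := by
      intro ξ u v hξ
      rw [mem_shuffles] at hξ
      constructor <;> apply Equiv.Perm.eq_sort_of_strictMono
      · convert hξ.1 using 1; ext i; simp
      · convert hξ.2 using 1; ext i; simp
    have hu : u = u' := inv_injective ((key hξ).1.trans (h ▸ (key hξ').1.symm))
    have hv : v = v' := inv_injective ((key hξ).2.trans (h ▸ (key hξ').2.symm))
    subst hu hv
    simpa using h
  · intro w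
    let σ := Tuple.sort (w ∘ Fin.castAdd q)
    let τ := Tuple.sort (w ∘ Fin.natAdd p)
    refine ⟨⟨⟨w * permTimes σ τ, mem_shuffles.2 ⟨?_, ?_⟩⟩, σ⁻¹, τ⁻¹⟩, ?_⟩
    · convert strictMono_comp_sort (w.injective.comp (Fin.castAdd_injective p q)) using 1
      ext i; simp [σ]
    · convert strictMono_comp_sort (w.injective.comp (Fin.natAdd_injective q p)) using 1
      ext i; simp [τ]
    · simp [mul_assoc, ← permTimes_inv]

theorem shuffle_mul_permTimes_inj {u u' : Equiv.Perm (Fin p)} {v v' : Equiv.Perm (Fin q)}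
    {ξ ξ' : Equiv.Perm (Fin (p + q))} (hξ : ξ ∈ shuffles p q) (hξ' : ξ' ∈ shuffles p q)
    (h : ξ * permTimes u v = ξ' * permTimes u' v') : ξ = ξ' ∧ u = u' ∧ v = v' := by
  have := shuffle_mul_permTimes_bijective.1 (a₁ := (⟨ξ, hξ⟩, u, v)) (a₂ := (⟨ξ', hξ'⟩, u', v')) h
  simpa using this

theorem card_shuffles : (shuffles p q).card = (p + q).choose p := by
  have h := Fintype.card_of_bijective (shuffle_mul_permTimes_bijective (p := p) (q := q))
  simp only [Fintype.card_prod, Fintype.card_perm, Fintype.card_fin, Fintype.card_coe] at h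
  have := Nat.add_choose_mul_factorial_mul_factorial p q
  have hpos : 0 < p.factorial * q.factorial := by positivity
  apply Nat.eq_of_mul_eq_mul_right hpos
  rw [h, ← this, mul_assoc, Nat.choose_symm_add]

theorem sum_shuffle_mul_permTimes {M : Type} [AddCommMonoid M]
    (f : Equiv.Perm (Fin (p + q)) → M) :
    ∑ u, ∑ v, ∑ ξ ∈ shuffles p q, f (ξ * permTimes u v) = ∑ w, f w := by
  rw [← (Equiv.ofBijective _ shuffle_mul_permTimes_bijective).sum_comp, Fintype.sum_prod_type_right,
    Fintype.sum_prod_type]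
  simp only [Equiv.ofBijective_apply]
  refine Finset.sum_congr rfl fun u _ => Finset.sum_congr rfl fun v _ => ?_
  rw [← Finset.sum_coe_sort]

namespace SignedPerm

@[simp] theorem mul_perm {n : ℕ} (w w' : SignedPerm n) : (w * w').perm = w.perm * w'.perm := rfl
@[simp] theorem mul_sign {n : ℕ} (w w' : SignedPerm n) (i : Fin n) :
    (w * w').sign i = w.sign (w'.perm i) * w'.sign i := rfl
@[simp] theorem inv_perm {n : ℕ} (w : SignedPerm n) : w⁻¹.perm = w.perm⁻¹ := rfl
@[simp] theorem inv_sign {n : ℕ} (w : SignedPerm n) (i : Fin n) :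
    w⁻¹.sign i = (w.sign (w.perm⁻¹ i))⁻¹ := rfl
@[simp] theorem one_perm {n : ℕ} : (1 : SignedPerm n).perm = 1 := rfl
@[simp] theorem one_sign {n : ℕ} (i : Fin n) : (1 : SignedPerm n).sign i = 1 := rfl
@[simp] theorem ofPerm_perm {n : ℕ} (ξ : Equiv.Perm (Fin n)) : (ofPerm ξ).perm = ξ := rfl
@[simp] theorem ofPerm_sign {n : ℕ} (ξ : Equiv.Perm (Fin n)) (i : Fin n) :
    (ofPerm ξ).sign i = 1 := rfl
@[simp] theorem times_perm (u : SignedPerm p) (v : SignedPerm q) :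
    (times u v).perm = permTimes u.perm v.perm := rfl
@[simp] theorem times_sign_castAdd (u : SignedPerm p) (v : SignedPerm q) (i : Fin p) :
    (times u v).sign (Fin.castAdd q i) = u.sign i := by simp [times]
@[simp] theorem times_sign_natAdd (u : SignedPerm p) (v : SignedPerm q) (i : Fin q) :
    (times u v).sign (Fin.natAdd p i) = v.sign i := by simp [times]

theorem ext_addCases {w w' : SignedPerm (p + q)} (hp : w.perm = w'.perm)
    (h1 : ∀ i, w.sign (Fin.castAdd q i) = w'.sign (Fin.castAdd q i))
    (h2 : ∀ i, w.sign (Fin.natAdd p i) = w'.sign (Fin.natAdd p i)) : w = w' :=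
  SignedPerm.ext hp (funext fun i => Fin.addCases h1 h2 i)

theorem times_mul (u u' : SignedPerm p) (v v' : SignedPerm q) :
    times u v * times u' v' = times (u * u') (v * v') :=
  ext_addCases (permTimes_mul _ _ _ _) (fun i => by simp) (fun i => by simp)

@[simp] theorem times_one : times (1 : SignedPerm p) (1 : SignedPerm q) = 1 :=
  ext_addCases permTimes_one (fun i => by simp) (fun i => by simp)

theorem times_inv (u : SignedPerm p) (v : SignedPerm q) : (times u v)⁻¹ = times u⁻¹ v⁻¹ := by
  rw [inv_eq_iff_mul_eq_one, times_mul]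
  simp

/-- The shuffle carries no signs, so the signs of `u` and `v` are read off position by position from
`w`. -/
theorem shuffle_mul_times_bijective : Function.Bijective
    fun x : shuffles p q × SignedPerm p × SignedPerm q => ofPerm x.1.1 * times x.2.1 x.2.2 := by
  constructor
  · rintro ⟨ξ, u, v⟩ ⟨ξ', u', v'⟩ h
    simp only at h
    have hp := shuffle_mul_permTimes_inj ξ.2 ξ'.2 (congrArg SignedPerm.perm h)
    have hs := fun i => congrFun (congrArg SignedPerm.sign h) i
    refine Prod.ext (Subtype.ext hp.1) (Prod.ext (SignedPerm.ext hp.2.1 (funext fun i => ?_))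
      (SignedPerm.ext hp.2.2 (funext fun i => ?_)))
    · simpa using hs (Fin.castAdd q i)
    · simpa using hs (Fin.natAdd p i)
  · intro w
    obtain ⟨⟨ξ, u, v⟩, h⟩ := shuffle_mul_permTimes_bijective.2 w.perm
    exact ⟨⟨ξ, ⟨u, fun i => w.sign (Fin.castAdd q i)⟩, ⟨v, fun i => w.sign (Fin.natAdd p i)⟩⟩,
      ext_addCases h (fun i => by simp) (fun i => by simp)⟩

theorem sum_shuffle_mul_times {M : Type} [AddCommMonoid M] (f : SignedPerm (p + q) → M) :
    ∑ u, ∑ v, ∑ ξ ∈ shuffles p q, f (ofPerm ξ * times u v) = ∑ w, f w := by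
  rw [← (Equiv.ofBijective _ shuffle_mul_times_bijective).sum_comp, Fintype.sum_prod_type_right,
    Fintype.sum_prod_type]
  simp only [Equiv.ofBijective_apply]
  refine Finset.sum_congr rfl fun u _ => Finset.sum_congr rfl fun v _ => ?_
  rw [← Finset.sum_coe_sort]

theorem exists_eq_times_mul_inv (w : SignedPerm (p + q)) :
    ∃ u v, ∃ ξ ∈ shuffles p q, w = times u v * (ofPerm ξ)⁻¹ := by
  obtain ⟨⟨ξ, u, v⟩, h⟩ := shuffle_mul_times_bijective.2 w⁻¹
  refine ⟨u⁻¹, v⁻¹, ξ.1, ξ.2, ?_⟩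
  rw [← inv_inj, ← h, mul_inv_rev, inv_inv, times_inv, inv_inv, inv_inv]

theorem times_mul_inv_inj {u u' : SignedPerm p} {v v' : SignedPerm q}
    {ξ ξ' : Equiv.Perm (Fin (p + q))} (hξ : ξ ∈ shuffles p q) (hξ' : ξ' ∈ shuffles p q)
    (h : times u v * (ofPerm ξ)⁻¹ = times u' v' * (ofPerm ξ')⁻¹) : u = u' ∧ v = v' ∧ ξ = ξ' := by
  rw [← inv_inj] at h
  simp only [mul_inv_rev, inv_inv, times_inv] at h
  have := shuffle_mul_times_bijective.1 (a₁ := (⟨ξ, hξ⟩, u⁻¹, v⁻¹))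
    (a₂ := (⟨ξ', hξ'⟩, u'⁻¹, v'⁻¹)) h
  simp only [Prod.mk.injEq, Subtype.mk.injEq, inv_inj] at this
  exact ⟨this.2.1, this.2.2, this.1⟩

end SignedPerm

theorem permTimes_mul_inv_inj {u u' : Equiv.Perm (Fin p)} {v v' : Equiv.Perm (Fin q)}
    {ξ ξ' : Equiv.Perm (Fin (p + q))} (hξ : ξ ∈ shuffles p q) (hξ' : ξ' ∈ shuffles p q)
    (h : permTimes u v * ξ⁻¹ = permTimes u' v' * ξ'⁻¹) : u = u' ∧ v = v' ∧ ξ = ξ' := by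
  rw [← inv_inj] at h
  simp only [mul_inv_rev, inv_inv, permTimes_inv] at h
  have := shuffle_mul_permTimes_inj hξ hξ' h
  simp only [inv_inj] at this
  exact ⟨this.2.1, this.2.2, this.1⟩

/-- Evaluates the inner triple sum in the definition of the coproduct, which has a single nonzero
term by unique factorization. -/
theorem sum_ite_unique {A B C M : Type} [Fintype A] [Fintype B] [DecidableEq A] [DecidableEq B]
    [DecidableEq C] [AddCommMonoid M] (s : Finset C) (P : A → B → C → Prop)
    [∀ a b c, Decidable (P a b c)] (f : A → B → M) {a : A} {b : B} {c : C} (hc : c ∈ s)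
    (h : P a b c) (hu : ∀ a' b', ∀ c' ∈ s, P a' b' c' → a' = a ∧ b' = b ∧ c' = c) :
    (∑ a', ∑ b', ∑ c' ∈ s, if P a' b' c' then f a' b' else 0) = f a b := by
  rw [Finset.sum_eq_single a, Finset.sum_eq_single b, Finset.sum_eq_single c, if_pos h]
  · intro c' hc' hne
    exact if_neg fun h' => hne (hu _ _ _ hc' h').2.2
  · exact fun h => absurd hc h
  · intro b' _ hne
    exact Finset.sum_eq_zero fun c' hc' => if_neg fun h' => hne (hu _ _ _ hc' h').2.1
  · simp
  · intro a' _ hne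
    exact Finset.sum_eq_zero fun b' _ => Finset.sum_eq_zero fun c' hc' =>
      if_neg fun h' => hne (hu _ _ _ hc' h').1
  · simp

open SignedPerm in
theorem sum_ite_eq_times_mul_inv {M : Type} [AddCommMonoid M]
    (f : SignedPerm p → SignedPerm q → M) (u : SignedPerm p) (v : SignedPerm q)
    {ξ : Equiv.Perm (Fin (p + q))} (hξ : ξ ∈ shuffles p q) :
    (∑ u', ∑ v', ∑ ξ' ∈ shuffles p q,
      if (⟨p + q, times u v * (ofPerm ξ)⁻¹⟩ : Σ n, SignedPerm n) =
        ⟨p + q, times u' v' * (ofPerm ξ')⁻¹⟩ then f u' v' else 0) = f u v := by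
  refine sum_ite_unique (c := ξ) _ _ f hξ rfl fun a b c hc h => ?_
  exact times_mul_inv_inj hc hξ (eq_of_heq (Sigma.mk.inj h).2).symm

theorem sum_ite_eq_permTimes_mul_inv {M : Type} [AddCommMonoid M]
    (f : Equiv.Perm (Fin p) → Equiv.Perm (Fin q) → M) (u : Equiv.Perm (Fin p))
    (v : Equiv.Perm (Fin q)) {ξ : Equiv.Perm (Fin (p + q))} (hξ : ξ ∈ shuffles p q) :
    (∑ u', ∑ v', ∑ ξ' ∈ shuffles p q,
      if (⟨p + q, permTimes u v * ξ⁻¹⟩ : Σ n, Equiv.Perm (Fin n)) =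
        ⟨p + q, permTimes u' v' * ξ'⁻¹⟩ then f u' v' else 0) = f u v := by
  refine sum_ite_unique (c := ξ) _ _ f hξ rfl fun a b c hc h => ?_
  exact permTimes_mul_inv_inj hc hξ (eq_of_heq (Sigma.mk.inj h).2).symm

end Factorization

/-! ### Shuffles and deconcatenations of words -/

section Words

variable {α β M N : Type} [AddCommMonoid M] [AddCommMonoid N]

/-- The sum of the values of `f` at the shuffles of two words. -/
def shuffleSum (f : List α → M) : List α → List α → M
  | [], m => f m
  | a :: l, [] => f (a :: l)
  | a :: l, b :: m =>
    shuffleSum (fun t => f (a :: t)) l (b :: m) + shuffleSum (fun t => f (b :: t)) (a :: l) m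
termination_by l m => l.length + m.length

/-- The sum of the values of `g` at the deconcatenations of a word. -/
def splitSum (g : List α → List α → M) : List α → M
  | [] => g [] []
  | a :: l => g [] (a :: l) + splitSum (fun x y => g (a :: x) y) l

@[simp] theorem shuffleSum_nil_left (f : List α → M) (m : List α) : shuffleSum f [] m = f m := by
  simp [shuffleSum]

@[simp] theorem shuffleSum_nil_right (f : List α → M) (l : List α) : shuffleSum f l [] = f l := by
  cases l <;> simp [shuffleSum]

theorem shuffleSum_cons_cons (f : List α → M) (a b : α) (l m : List α) :
    shuffleSum f (a :: l) (b :: m) =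
      shuffleSum (fun t => f (a :: t)) l (b :: m) + shuffleSum (fun t => f (b :: t)) (a :: l) m := by
  rw [shuffleSum]

/-- Induction on a pair of words following the recursion of `shuffleSum`. -/
theorem shuffle_induction {P : List α → List α → Prop} (left : ∀ m, P [] m) (right : ∀ l, P l [])
    (cons : ∀ a l b m, P l (b :: m) → P (a :: l) m → P (a :: l) (b :: m)) (l m : List α) :
    P l m := by
  induction l generalizing m with
  | nil => exact left m
  | cons a l ihl =>
    induction m with
    | nil => exact right _
    | cons b m ihm => exact cons a l b m (ihl _) ihm

theorem map_shuffleSum (φ : M →+ N) (f : List α → M) (l m : List α) :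
    φ (shuffleSum f l m) = shuffleSum (fun t => φ (f t)) l m := by
  induction l, m using shuffle_induction generalizing f with
  | left m => simp
  | right l => simp
  | cons a l b m h1 h2 => simp [shuffleSum_cons_cons, h1, h2]

theorem shuffleSum_add (f g : List α → M) (l m : List α) :
    shuffleSum (fun t => f t + g t) l m = shuffleSum f l m + shuffleSum g l m := by
  induction l, m using shuffle_induction generalizing f g with
  | left m => simp
  | right l => simp
  | cons a l b m h1 h2 =>
    simp only [shuffleSum_cons_cons, h1, h2]
    abel

theorem shuffleSum_congr {f g : List α → M} {l m : List α}
    (h : ∀ t, t.Perm (l ++ m) → f t = g t) : shuffleSum f l m = shuffleSum g l m := by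
  induction l, m using shuffle_induction generalizing f g with
  | left m => simpa using h m (List.Perm.refl _)
  | right l => simpa using h l (by simp)
  | cons a l b m h1 h2 =>
    rw [shuffleSum_cons_cons, shuffleSum_cons_cons, h1, h2]
    · exact fun t ht => h _ ((ht.cons b).trans (List.perm_middle (l₁ := a :: l)).symm)
    · exact fun t ht => h _ (ht.cons a)

theorem shuffleSum_map (h : α → β) (f : List β → M) (l m : List α) :
    shuffleSum f (l.map h) (m.map h) = shuffleSum (fun t => f (t.map h)) l m := by
  induction l, m using shuffle_induction generalizing f with
  | left m => simp
  | right l => simp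
  | cons a l b m h1 h2 =>
    simp only [List.map_cons, shuffleSum_cons_cons] at h1 h2 ⊢
    rw [h1, h2]

/-- Both sides split according to which of the three words supplies the first letter, and the three
parts match by the three nested inductions. -/
theorem shuffleSum_assoc (f : List α → M) (l m k : List α) :
    shuffleSum (fun t => shuffleSum f t k) l m = shuffleSum (fun t => shuffleSum f l t) m k := by
  induction l generalizing f m k with
  | nil => simp
  | cons a l ihl =>
    induction m generalizing f k with
    | nil => simp
    | cons b m ihm =>
      induction k generalizing f with
      | nil => simp
      | cons c k ihk =>
        have e1 := ihk (fun t => f (c :: t))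
        simp only [shuffleSum_cons_cons, shuffleSum_add] at e1 ihl ihm ⊢
        rw [ihl (fun t => f (a :: t)), ihm (fun t => f (b :: t)), shuffleSum_cons_cons, ← e1]
        abel

theorem map_splitSum (φ : M →+ N) (g : List α → List α → M) (l : List α) :
    φ (splitSum g l) = splitSum (fun x y => φ (g x y)) l := by
  induction l generalizing g with
  | nil => rfl
  | cons a l ih => simp [splitSum, ih]

theorem splitSum_add (g g' : List α → List α → M) (l : List α) :
    splitSum (fun x y => g x y + g' x y) l = splitSum g l + splitSum g' l := by
  induction l generalizing g g' with
  | nil => rfl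
  | cons a l ih =>
    simp only [splitSum, ih]
    abel

theorem splitSum_congr {g g' : List α → List α → M} {l : List α}
    (h : ∀ x y, x ++ y = l → g x y = g' x y) : splitSum g l = splitSum g' l := by
  induction l generalizing g g' with
  | nil => exact h _ _ rfl
  | cons a l ih =>
    rw [splitSum, splitSum, h [] _ rfl, ih]
    exact fun x y hxy => h _ _ (by simp [hxy])

theorem splitSum_assoc (g : List α → List α → List α → M) (l : List α) :
    splitSum (fun x y => splitSum (fun x1 x2 => g x1 x2 y) x) l =
      splitSum (fun x y => splitSum (fun y1 y2 => g x y1 y2) y) l := by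
  induction l generalizing g with
  | nil => rfl
  | cons a l ih =>
    simp only [splitSum, splitSum_add, ih]
    rw [add_assoc]

/-- Cutting a shuffle of `l` and `m` in two cuts each of the words, and leaves a shuffle of the
prefixes followed by a shuffle of the suffixes. This is the compatibility of product and coproduct.
-/
theorem shuffleSum_splitSum (g : List α → List α → M) (l m : List α) :
    shuffleSum (splitSum g) l m = splitSum (fun x y => splitSum (fun x' y' =>
      shuffleSum (fun s => shuffleSum (fun t => g s t) y y') x x') m) l := by
  induction l, m using shuffle_induction generalizing g with
  | left m => simp [splitSum]
  | right l => simp [splitSum]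
  | cons a l b m h1 h2 =>
    have e1 := h1 (fun x y => g (a :: x) y)
    have e2 := h2 (fun x y => g (b :: x) y)
    simp only [shuffleSum_cons_cons, splitSum, splitSum_add, shuffleSum_add, shuffleSum_nil_left,
      shuffleSum_nil_right] at e1 e2 ⊢
    rw [e1, e2]
    abel

theorem splitSum_eq_sum_antidiagonal (g : List α → List α → M) (l : List α) :
    splitSum g l = ∑ pq ∈ Finset.HasAntidiagonal.antidiagonal l.length,
      g (l.take pq.1) (l.drop pq.1) := by
  induction l generalizing g with
  | nil => simp [splitSum]
  | cons a l ih => simp [splitSum, ih, Finset.Nat.antidiagonal_succ]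

/-- The multiset of all shuffles of two words. -/
def shuffleMultiset (l m : List α) : Multiset (List α) := shuffleSum (fun t => {t}) l m

theorem shuffleSum_eq_sum_map (f : List α → M) (l m : List α) :
    shuffleSum f l m = ((shuffleMultiset l m).map f).sum := by
  have := map_shuffleSum (Multiset.sumAddMonoidHom.comp (Multiset.mapAddMonoidHom f))
    (fun t => {t}) l m
  simpa [shuffleMultiset] using this.symm

theorem card_shuffleMultiset (l m : List α) :
    Multiset.card (shuffleMultiset l m) = (l.length + m.length).choose l.length := by
  have := map_shuffleSum Multiset.cardHom (fun t => {t}) l m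
  change Multiset.cardHom (shuffleMultiset l m) = _
  rw [shuffleMultiset, this]
  simp only [Multiset.cardHom_apply, Multiset.card_singleton]
  induction l, m using shuffle_induction with
  | left m => simp
  | right l => simp
  | cons a l b m h1 h2 =>
    rw [shuffleSum_cons_cons, h1 (map_shuffleSum _ _ _ _), h2 (map_shuffleSum _ _ _ _)]
    simp only [List.length_cons]
    rw [show l.length + 1 + (m.length + 1) = (l.length + (m.length + 1)) + 1 by omega,
      Nat.choose_succ_succ]
    congr 2
    omega

theorem cons_mem_shuffleMultiset_left {t l m : List α} (a : α) (h : t ∈ shuffleMultiset l m) :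
    a :: t ∈ shuffleMultiset (a :: l) m := by
  have e := map_shuffleSum (Multiset.mapAddMonoidHom (a :: ·)) (fun t : List α => {t}) l m
  cases m with
  | nil => simpa [shuffleMultiset] using h
  | cons b m =>
    rw [shuffleMultiset, shuffleSum_cons_cons, Multiset.mem_add]
    left
    simp only [Multiset.mapAddMonoidHom_apply, Multiset.map_singleton] at e
    rw [← e]
    exact Multiset.mem_map_of_mem _ h

theorem cons_mem_shuffleMultiset_right {t l m : List α} (b : α) (h : t ∈ shuffleMultiset l m) :
    b :: t ∈ shuffleMultiset l (b :: m) := by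
  have e := map_shuffleSum (Multiset.mapAddMonoidHom (b :: ·)) (fun t : List α => {t}) l m
  cases l with
  | nil => simpa [shuffleMultiset] using h
  | cons a l =>
    rw [shuffleMultiset, shuffleSum_cons_cons, Multiset.mem_add]
    right
    simp only [Multiset.mapAddMonoidHom_apply, Multiset.map_singleton] at e
    rw [← e]
    exact Multiset.mem_map_of_mem _ h

theorem mem_shuffleMultiset_filter (P : α → Bool) (t : List α) :
    t ∈ shuffleMultiset (t.filter P) (t.filter fun a => !P a) := by
  induction t with
  | nil => simp [shuffleMultiset]
  | cons a t ih =>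
    by_cases h : P a
    · simpa [h] using cons_mem_shuffleMultiset_left a ih
    · simpa [h] using cons_mem_shuffleMultiset_right a ih

variable {p q : ℕ}

theorem filter_eq_of_pairwise {r : α → α → Prop} [Std.Antisymm r] {P : α → Bool} {l m : List α}
    (hl : l.Pairwise r) (hm : m.Pairwise r) (hl' : l.Nodup) (hm' : m.Nodup)
    (h : ∀ a, a ∈ m ↔ a ∈ l ∧ P a) : l.filter P = m := by
  refine List.Perm.eq_of_pairwise' (hl.filter _) hm ?_
  rw [List.perm_ext_iff_of_nodup (hl'.filter _) hm']
  intro a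
  rw [List.mem_filter, h]

/-- In the word of `ξ⁻¹` the letters below `p` occur in their natural order, because `ξ` increases
on them, and so do the others. A word is a shuffle of two complementary subwords. -/
theorem ofFn_inv_mem_shuffleMultiset {ξ : Equiv.Perm (Fin (p + q))} (hξ : ξ ∈ shuffles p q) :
    List.ofFn (ξ⁻¹ : Equiv.Perm (Fin (p + q))) ∈
      shuffleMultiset (List.ofFn (Fin.castAdd q)) (List.ofFn (Fin.natAdd p)) := by
  rw [mem_shuffles] at hξ
  have h := mem_shuffleMultiset_filter (fun a : Fin (p + q) => decide ((a : ℕ) < p))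
    (List.ofFn (ξ⁻¹ : Equiv.Perm (Fin (p + q))))
  -- Letters are compared by their places in the word: `ξ a` is the place of the letter `a`.
  let r : Fin (p + q) → Fin (p + q) → Prop := fun a b => ξ a ≤ ξ b
  have : Std.Antisymm r := ⟨fun a b h1 h2 => ξ.injective (le_antisymm h1 h2)⟩
  have hs : (List.ofFn (ξ⁻¹ : Equiv.Perm (Fin (p + q)))).Pairwise r := by
    rw [List.pairwise_ofFn]
    intro i j hij
    simpa [r] using hij.le
  have hn : (List.ofFn (ξ⁻¹ : Equiv.Perm (Fin (p + q)))).Nodup :=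
    List.nodup_ofFn.2 (Equiv.injective _)
  rw [filter_eq_of_pairwise (r := r) (m := List.ofFn (Fin.castAdd q)) hs ?_ hn
    (List.nodup_ofFn.2 (Fin.castAdd_injective _ _)),
    filter_eq_of_pairwise (r := r) (m := List.ofFn (Fin.natAdd p)) hs ?_ hn
    (List.nodup_ofFn.2 (Fin.natAdd_injective _ _))] at h
  · exact h
  · intro a
    have : a ∈ List.ofFn (ξ⁻¹ : Equiv.Perm (Fin (p + q))) := by
      rw [List.mem_ofFn]; exact ⟨ξ a, by simp⟩
    simp only [this, true_and, List.mem_ofFn]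
    refine Fin.addCases (fun i => ?_) (fun i => ?_) a
    · simp [Fin.ext_iff]; omega
    · simp
  · rw [List.pairwise_ofFn]
    exact fun i j hij => (hξ.2 hij).le
  · intro a
    have : a ∈ List.ofFn (ξ⁻¹ : Equiv.Perm (Fin (p + q))) := by
      rw [List.mem_ofFn]; exact ⟨ξ a, by simp⟩
    simp only [this, true_and, List.mem_ofFn]
    refine Fin.addCases (fun i => ?_) (fun i => ?_) a
    · simp
    · simp [Fin.ext_iff]; omega
  · rw [List.pairwise_ofFn]
    exact fun i j hij => (hξ.1 hij).le

/-- The words of the `ξ⁻¹` are distinct shuffles of the two halves of `0 1 ⋯ (p+q-1)`, and their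
number `(p + q).choose p` is the total number of shuffles, so the multisets agree. Arbitrary words
follow by relabelling the letters. -/
theorem sum_shuffles_eq_shuffleSum (φ : List α → M) (f : Fin p → α) (g : Fin q → α) :
    ∑ ξ ∈ shuffles p q, φ (List.ofFn (Fin.append f g ∘ (ξ⁻¹ : Equiv.Perm (Fin (p + q))))) =
      shuffleSum φ (List.ofFn f) (List.ofFn g) := by
  have hms : (shuffles p q).val.map
      (fun ξ => List.ofFn (ξ⁻¹ : Equiv.Perm (Fin (p + q)))) =
      shuffleMultiset (List.ofFn (Fin.castAdd q)) (List.ofFn (Fin.natAdd p)) := by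
    refine Multiset.eq_of_le_of_card_le ((Multiset.le_iff_subset ?_).2 ?_) ?_
    · refine (Multiset.nodup_map_iff_of_injective fun ξ ξ' h => ?_).2 (shuffles p q).nodup
      exact inv_injective (DFunLike.coe_injective (List.ofFn_injective h))
    · intro t ht
      obtain ⟨ξ, hξ, rfl⟩ := Multiset.mem_map.1 ht
      exact ofFn_inv_mem_shuffleMultiset hξ
    · rw [card_shuffleMultiset, Multiset.card_map]
      simp [← card_shuffles]
  have hf : List.ofFn f = (List.ofFn (Fin.castAdd q)).map (Fin.append f g) := by
    rw [List.map_ofFn]; congr 1; ext i; simp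
  have hg : List.ofFn g = (List.ofFn (Fin.natAdd p)).map (Fin.append f g) := by
    rw [List.map_ofFn]; congr 1; ext i; simp
  rw [hf, hg, shuffleSum_map, shuffleSum_eq_sum_map, ← hms, Multiset.map_map]
  rw [Finset.sum_eq_multiset_sum]
  simp only [Function.comp_def, List.map_ofFn]

end Words

/-! ### Standardization of signed words -/

/-- The inverse of the standardization of a signed word. -/
def invStd {n : ℕ} (f : Fin n → ℕ × ℤˣ) : SignedPerm n :=
  ⟨Tuple.sort (Prod.fst ∘ f), fun i => (f (Tuple.sort (Prod.fst ∘ f) i)).2⟩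

/-- Replaces sorting by order conditions that can be checked in products and factors: letters weakly
increase and ties are broken by position. -/
theorem eq_invStd_iff {n : ℕ} {f : Fin n → ℕ × ℤˣ} {w : SignedPerm n} :
    w = invStd f ↔ (Monotone (Prod.fst ∘ f ∘ w.perm) ∧
      ∀ i j, i < j → (f (w.perm i)).1 = (f (w.perm j)).1 → w.perm i < w.perm j) ∧
      ∀ i, w.sign i = (f (w.perm i)).2 := by
  constructor
  · intro h
    have hp : w.perm = Tuple.sort (Prod.fst ∘ f) := by rw [h]; rfl
    refine ⟨Tuple.eq_sort_iff.1 hp, fun i => ?_⟩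
    rw [hp, h]; rfl
  · rintro ⟨h1, h2⟩
    have hp : w.perm = Tuple.sort (Prod.fst ∘ f) := Tuple.eq_sort_iff.2 h1
    refine SignedPerm.ext hp (funext fun i => ?_)
    rw [h2 i, hp]; rfl

/-- The basis element of `QB` given by a signed word. -/
def QB.ofWord (l : List (ℕ × ℤˣ)) : QB := QB.of (invStd l.get)

theorem QB.ofWord_ofFn {n : ℕ} (f : Fin n → ℕ × ℤˣ) : QB.ofWord (List.ofFn f) = QB.of (invStd f) := by
  have h : (⟨_, (List.ofFn f).get⟩ : Σ n, Fin n → ℕ × ℤˣ) = ⟨n, f⟩ :=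
    List.equivSigmaTuple.right_inv ⟨n, f⟩
  generalize hg : (List.ofFn f).get = g at h
  rw [QB.ofWord, hg]
  clear hg
  generalize (List.ofFn f).length = m at g h
  obtain ⟨rfl, h⟩ := Sigma.mk.inj h
  rw [eq_of_heq h]

/-- The offset `N` allows several signed permutations to be written with letters in successive
disjoint ranges, as `QB.mul_ofWord` requires. -/
theorem exists_ofWord_eq (N : ℕ) {n : ℕ} (w : SignedPerm n) : ∃ l : List (ℕ × ℤˣ),
    QB.ofWord l = QB.of w ∧ ∀ a ∈ l, N ≤ a.1 ∧ a.1 < N + n := by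
  refine ⟨List.ofFn fun j => (N + (w.perm⁻¹ j : Fin n), w.sign (w.perm⁻¹ j)), ?_, ?_⟩
  · rw [QB.ofWord_ofFn]
    congr 1
    symm
    rw [eq_invStd_iff]
    refine ⟨⟨fun i j hij => by simpa using hij, fun i j hij h => ?_⟩, by simp⟩
    simp at h
    omega
  · intro a ha
    obtain ⟨j, rfl⟩ := List.mem_ofFn.1 ha
    simp

/-! ### Product and coproduct of words -/

section Products

open SignedPerm

theorem QB.mul_of {p q : ℕ} (u : SignedPerm p) (v : SignedPerm q) :
    QB.ops.mul (QB.of u) (QB.of v) = ∑ ξ ∈ shuffles p q, QB.of (ofPerm ξ * times u v) := by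
  simp [QB.ops, QB.of]

theorem QB.comul_of {n : ℕ} (w : SignedPerm n) : QB.ops.comul (QB.of w) =
    ∑ pq ∈ Finset.HasAntidiagonal.antidiagonal n,
      ∑ u : SignedPerm pq.1, ∑ v : SignedPerm pq.2, ∑ ξ ∈ shuffles pq.1 pq.2,
        if (⟨n, w⟩ : Σ n, SignedPerm n) = ⟨pq.1 + pq.2, times u v * (ofPerm ξ)⁻¹⟩
          then QB.of u ⊗ₜ[ℚ] QB.of v else 0 := by
  simp [QB.ops, QB.of]

variable {p q : ℕ}

/-- Sorting the shuffled word lists all letters of `f` before those of `g`; ties within `f` or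
within `g` keep their order since `ξ` increases on each block. -/
theorem shuffle_mul_times_invStd {f : Fin p → ℕ × ℤˣ} {g : Fin q → ℕ × ℤˣ}
    (h : ∀ i j, (f i).1 < (g j).1) {ξ : Equiv.Perm (Fin (p + q))} (hξ : ξ ∈ shuffles p q) :
    ofPerm ξ * times (invStd f) (invStd g) =
      invStd (Fin.append f g ∘ (ξ⁻¹ : Equiv.Perm (Fin (p + q)))) := by
  obtain ⟨⟨f1, f2⟩, f3⟩ := eq_invStd_iff.1 (rfl : invStd f = invStd f)
  obtain ⟨⟨g1, g2⟩, g3⟩ := eq_invStd_iff.1 (rfl : invStd g = invStd g)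
  rw [mem_shuffles] at hξ
  rw [eq_invStd_iff]
  refine ⟨⟨fun i j hij => ?_, fun i j => ?_⟩, fun i => ?_⟩
  · induction i using Fin.addCases with
    | left i =>
      induction j using Fin.addCases with
      | left j => simpa using f1 (show i ≤ j by exact hij)
      | right j => simpa using (h _ _).le
    | right i =>
      induction j using Fin.addCases with
      | left j => simp [Fin.le_def] at hij; omega
      | right j => simpa using g1 (show i ≤ j by simpa using hij)
  · induction i using Fin.addCases with
    | left i =>
      induction j using Fin.addCases with
      | left j =>
        intro hij he
        simp at he
        simpa using hξ.1 (f2 i j (by exact hij) he)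
      | right j => intro _ he; simp at he; exact absurd he (h _ _).ne
    | right i =>
      induction j using Fin.addCases with
      | left j => intro hij; simp [Fin.lt_def] at hij; omega
      | right j =>
        intro hij he
        simp at he
        simpa using hξ.2 (g2 i j (by simpa using hij) he)
  · induction i using Fin.addCases with
    | left i => simpa using f3 i
    | right i => simpa using g3 i

theorem QB.mul_ofWord {l m : List (ℕ × ℤˣ)} (h : ∀ a ∈ l, ∀ b ∈ m, a.1 < b.1) :
    QB.ops.mul (QB.ofWord l) (QB.ofWord m) = shuffleSum QB.ofWord l m := by
  obtain ⟨p, f, rfl⟩ : ∃ (p : ℕ) (f : Fin p → _), l = List.ofFn f := ⟨_, l.get, (List.ofFn_get l).symm⟩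
  obtain ⟨q, g, rfl⟩ : ∃ (p : ℕ) (f : Fin p → _), m = List.ofFn f := ⟨_, m.get, (List.ofFn_get m).symm⟩
  simp only [List.mem_ofFn, forall_exists_index, forall_apply_eq_imp_iff] at h
  rw [QB.ofWord_ofFn, QB.ofWord_ofFn, QB.mul_of, ← sum_shuffles_eq_shuffleSum]
  refine Finset.sum_congr rfl fun ξ hξ => ?_
  rw [shuffle_mul_times_invStd h hξ, QB.ofWord_ofFn]

/-- On the first block `ξ` lists, in increasing order, the indices that the sorting permutation of
`f` sends to the first `p` places. So `u` is the stable sorting of the prefix; the suffix is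
similar. -/
theorem eq_invStd_of_eq_times_mul_inv {f : Fin (p + q) → ℕ × ℤˣ} {u : SignedPerm p}
    {v : SignedPerm q} {ξ : Equiv.Perm (Fin (p + q))} (hξ : ξ ∈ shuffles p q)
    (h : invStd f = times u v * (ofPerm ξ)⁻¹) :
    u = invStd (f ∘ Fin.castAdd q) ∧ v = invStd (f ∘ Fin.natAdd p) := by
  obtain ⟨⟨f1, f2⟩, f3⟩ := eq_invStd_iff.1 (rfl : invStd f = invStd f)
  rw [mem_shuffles] at hξ
  have hw : invStd f * ofPerm ξ = times u v := by rw [h]; simp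
  have hp : ∀ i, (invStd f).perm (ξ i) = permTimes u.perm v.perm i := fun i =>
    congrArg (fun w : SignedPerm (p + q) => w.perm i) hw
  have hs : ∀ i, (times u v).sign i = (invStd f).sign (ξ i) := fun i => by rw [← hw]; simp
  have hu : ∀ i, Fin.castAdd q (u.perm i) = (invStd f).perm (ξ (Fin.castAdd q i)) :=
    fun i => by simp [hp]
  have hv : ∀ i, Fin.natAdd p (v.perm i) = (invStd f).perm (ξ (Fin.natAdd p i)) :=
    fun i => by simp [hp]
  rw [eq_invStd_iff, eq_invStd_iff]
  refine ⟨⟨⟨fun i j hij => ?_, fun i j hij he => ?_⟩, fun i => ?_⟩,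
    ⟨fun i j hij => ?_, fun i j hij he => ?_⟩, fun i => ?_⟩
  · simpa [hu] using f1 (hξ.1.monotone hij)
  · simp only [Function.comp_apply, hu] at he
    have := f2 _ _ (hξ.1 hij) he
    rw [Function.comp_apply, Function.comp_apply, ← hu, ← hu] at this
    exact this
  · rw [Function.comp_apply, hu, ← f3, ← hs]; simp
  · simpa [hv] using f1 (hξ.2.monotone hij)
  · simp only [Function.comp_apply, hv] at he
    have := f2 _ _ (hξ.2 hij) he
    rw [Function.comp_apply, Function.comp_apply, ← hv, ← hv] at this
    simpa using this
  · rw [Function.comp_apply, hv, ← f3, ← hs]; simp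

theorem QB.comul_ofWord (l : List (ℕ × ℤˣ)) :
    QB.ops.comul (QB.ofWord l) = splitSum (fun x y => QB.ofWord x ⊗ₜ[ℚ] QB.ofWord y) l := by
  obtain ⟨n, f, rfl⟩ : ∃ (p : ℕ) (f : Fin p → _), l = List.ofFn f := ⟨_, l.get, (List.ofFn_get l).symm⟩
  rw [splitSum_eq_sum_antidiagonal, QB.ofWord_ofFn, QB.comul_of, List.length_ofFn]
  refine Finset.sum_congr rfl fun pq hpq => ?_
  obtain ⟨p, q⟩ := pq
  obtain rfl : p + q = n := Finset.HasAntidiagonal.mem_antidiagonal.1 hpq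
  obtain ⟨u, v, ξ, hξ, h⟩ := exists_eq_times_mul_inv (invStd f)
  obtain ⟨hu, hv⟩ := eq_invStd_of_eq_times_mul_inv hξ h
  have hf : List.ofFn f = List.ofFn (f ∘ Fin.castAdd q) ++ List.ofFn (f ∘ Fin.natAdd p) := by
    rw [← List.ofFn_fin_append]
    congr 1
    ext i : 1
    refine Fin.addCases (fun i => ?_) (fun i => ?_) i <;> simp
  simp only
  rw [h, sum_ite_eq_times_mul_inv _ u v hξ, hf, List.take_left' (by simp), List.drop_left' (by simp),
    QB.ofWord_ofFn, QB.ofWord_ofFn, ← hu, ← hv]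

end Products

/-! ### Homomorphic images of connected graded bialgebras -/

/-- A surjective morphism of graded bialgebras. -/
structure IsGradedSurjection {V W : Type} [AddCommGroup V] [Module ℚ V] [AddCommGroup W]
    [Module ℚ W] (H : GradedHopfOps V) (H' : GradedHopfOps W) (f : V →ₗ[ℚ] W) : Prop where
  map_grade : ∀ n, (H.grade n).map f = H'.grade n
  surjective : Function.Surjective f
  map_one : f H.one = H'.one
  map_mul : ∀ x y, f (H.mul x y) = H'.mul (f x) (f y)
  map_comul : ∀ x, H'.comul (f x) = TensorProduct.map f f (H.comul x)
  map_counit : ∀ x, H'.counit (f x) = H.counit x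

section Surjection

variable {V W : Type} [AddCommGroup V] [Module ℚ V] [AddCommGroup W] [Module ℚ W]
  {H : GradedHopfOps V} {H' : GradedHopfOps W} {f : V →ₗ[ℚ] W}

theorem map_mem_tensorSub_map (f : V →ₗ[ℚ] W) {K L : Submodule ℚ V} {t : V ⊗[ℚ] V}
    (ht : t ∈ tensorSub K L) :
    TensorProduct.map f f t ∈ tensorSub (K.map f) (L.map f) := by
  have : tensorSub K L ≤ (tensorSub (K.map f) (L.map f)).comap (TensorProduct.map f f) := by
    rw [tensorSub_le_iff]
    intro x hx y hy
    exact tmul_mem_tensorSub (Submodule.mem_map_of_mem hx) (Submodule.mem_map_of_mem hy)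
  exact this ht

theorem IsGradedSurjection.map_genSub (hf : IsGradedSurjection H H' f) {ι : Type} (g : ι → V) :
    (genSub H g).map f = genSub H' (fun i => f (g i)) := by
  rw [genSub, Submodule.map_span, genSub, ← Set.range_comp]
  congr 2
  ext L
  simp only [Function.comp_apply]
  induction L with
  | nil => exact hf.map_one
  | cons i L ih =>
    rw [List.map_cons, List.map_cons, listMul, List.foldr_cons, hf.map_mul]
    exact congrArg (H'.mul (f (g i))) ih

theorem IsGradedSurjection.isGradedSubbialgebra_map (hf : IsGradedSurjection H H' f)
    {K : Submodule ℚ V} (hK : IsGradedSubbialgebra H K) :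
    IsGradedSubbialgebra H' (K.map f) := by
  refine ⟨le_antisymm ?_ (iSup_le fun n => inf_le_left), ?_, ?_, ?_⟩
  · conv_lhs => rw [hK.graded]
    rw [Submodule.map_iSup]
    refine iSup_mono fun n => le_inf (Submodule.map_mono inf_le_left) ?_
    rw [← hf.map_grade]
    exact Submodule.map_mono inf_le_right
  · rw [← hf.map_one]
    exact Submodule.mem_map_of_mem hK.one_mem
  · rintro _ ⟨x, hx, rfl⟩ _ ⟨y, hy, rfl⟩
    rw [← hf.map_mul]
    exact Submodule.mem_map_of_mem (hK.mul_mem x hx y hy)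
  · rintro _ ⟨x, hx, rfl⟩
    rw [hf.map_comul]
    exact map_mem_tensorSub_map f (hK.comul_mem x hx)

/-- The identities can be checked after composition with the surjection `f`, and memberships pass to
images. Directness of the sum of the components need not descend, hence it is assumed. -/
theorem IsGradedSurjection.isConnectedGradedBialgebra (hf : IsGradedSurjection H H' f)
    (h : IsConnectedGradedBialgebra H) (hint : DirectSum.IsInternal H'.grade) :
    IsConnectedGradedBialgebra H' := by
  have comul : H'.comul ∘ₗ f = TensorProduct.map f f ∘ₗ H.comul := LinearMap.ext hf.map_comul
  have counit : H'.counit ∘ₗ f = H.counit := LinearMap.ext hf.map_counit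
  have hsurj : ∀ {U : Type} [AddCommGroup U] [Module ℚ U] {a b : W →ₗ[ℚ] U},
      a ∘ₗ f = b ∘ₗ f → a = b := fun {_ _ _ _ _} hab =>
    (LinearMap.cancel_right hf.surjective).1 hab
  have e1 : H'.comul.rTensor W ∘ₗ TensorProduct.map f f =
      TensorProduct.map (TensorProduct.map f f) f ∘ₗ H.comul.rTensor V := by
    ext x y; simp [hf.map_comul]
  have e2 : H'.comul.lTensor W ∘ₗ TensorProduct.map f f =
      TensorProduct.map f (TensorProduct.map f f) ∘ₗ H.comul.lTensor V := by
    ext x y; simp [hf.map_comul]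
  have e3 : (TensorProduct.assoc ℚ W W W).toLinearMap ∘ₗ
      TensorProduct.map (TensorProduct.map f f) f =
      TensorProduct.map f (TensorProduct.map f f) ∘ₗ
        (TensorProduct.assoc ℚ V V V).toLinearMap := by
    ext x y z; simp
  have e4 : H'.counit.rTensor W ∘ₗ TensorProduct.map f f =
      TensorProduct.map LinearMap.id f ∘ₗ H.counit.rTensor V := by
    ext x y; simp [hf.map_counit]
  have e5 : H'.counit.lTensor W ∘ₗ TensorProduct.map f f =
      TensorProduct.map f LinearMap.id ∘ₗ H.counit.lTensor V := by
    ext x y; simp [hf.map_counit]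
  have e6 : ∀ s t, TensorProduct.map f f (TensorProduct.map₂ H.mul H.mul s t) =
      TensorProduct.map₂ H'.mul H'.mul (TensorProduct.map f f s) (TensorProduct.map f f t) := by
    intro s t
    induction s with
    | zero => simp
    | add a b ha hb => simp only [map_add, LinearMap.add_apply, ha, hb]
    | tmul a b =>
      induction t with
      | zero => simp
      | add c d hc hd => simp only [map_add, hc, hd]
      | tmul c d => simp [hf.map_mul]
  exact
  { isInternal := hint
    mul_assoc := hf.surjective.forall₃.2 fun x y z => by
      simp only [← hf.map_mul, h.mul_assoc]
    one_mul := hf.surjective.forall.2 fun x => by rw [← hf.map_one, ← hf.map_mul, h.one_mul]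
    mul_one := hf.surjective.forall.2 fun x => by rw [← hf.map_one, ← hf.map_mul, h.mul_one]
    coassoc := hsurj <| LinearMap.ext fun x => by
      have h1 := LinearMap.congr_fun e1 (H.comul x)
      have h2 := LinearMap.congr_fun e2 (H.comul x)
      have h3 := LinearMap.congr_fun e3 (H.comul.rTensor V (H.comul x))
      have h4 := LinearMap.congr_fun h.coassoc x
      simp only [LinearMap.comp_apply] at h1 h2 h3 h4 ⊢
      rw [hf.map_comul, h1, h3, h4, h2]
    rTensor_counit := hsurj <| by
      rw [LinearMap.comp_assoc, comul, ← LinearMap.comp_assoc, e4, LinearMap.comp_assoc,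
        h.rTensor_counit]
      ext x; simp
    lTensor_counit := hsurj <| by
      rw [LinearMap.comp_assoc, comul, ← LinearMap.comp_assoc, e5, LinearMap.comp_assoc,
        h.lTensor_counit]
      ext x; simp
    comul_one := by rw [← hf.map_one, hf.map_comul, h.comul_one, TensorProduct.map_tmul]
    comul_mul := hf.surjective.forall₂.2 fun x y => by
      rw [← hf.map_mul, hf.map_comul, h.comul_mul, e6, hf.map_comul, hf.map_comul]
    counit_one := by rw [← hf.map_one, hf.map_counit, h.counit_one]
    counit_mul := hf.surjective.forall₂.2 fun x y => by
      rw [← hf.map_mul, hf.map_counit, h.counit_mul, hf.map_counit, hf.map_counit]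
    one_mem := by
      rw [← hf.map_one, ← hf.map_grade]
      exact Submodule.mem_map_of_mem h.one_mem
    mul_mem := by
      simp only [← hf.map_grade]
      rintro p q _ ⟨x, hx, rfl⟩ _ ⟨y, hy, rfl⟩
      rw [← hf.map_mul]
      exact Submodule.mem_map_of_mem (h.mul_mem p q x hx y hy)
    comul_mem := by
      intro n
      simp only [← hf.map_grade]
      rintro _ ⟨x, hx, rfl⟩
      rw [hf.map_comul]
      have : (⨆ pq ∈ Finset.HasAntidiagonal.antidiagonal n,
          tensorSub (H.grade pq.1) (H.grade pq.2)) ≤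
          (⨆ pq ∈ Finset.HasAntidiagonal.antidiagonal n,
          tensorSub ((H.grade pq.1).map f) ((H.grade pq.2).map f)).comap (TensorProduct.map f f) := by
        refine iSup₂_le fun pq hpq t ht => ?_
        exact Submodule.mem_iSup_of_mem pq (Submodule.mem_iSup_of_mem hpq
          (map_mem_tensorSub_map f ht))
      exact this (h.comul_mem n x hx)
    counit_eq_zero := by
      intro n hn
      rw [← hf.map_grade]
      rintro _ ⟨x, hx, rfl⟩
      rw [hf.map_counit, h.counit_eq_zero n hn x hx]
    grade_zero_le := by
      rw [← hf.map_grade, ← hf.map_one, ← Set.image_singleton, ← Submodule.map_span]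
      exact Submodule.map_mono h.grade_zero_le }

end Surjection

/-! ### The bialgebra of signed permutations -/

theorem isInternal_span_single (A : ℕ → Type) : DirectSum.IsInternal
    fun n => Submodule.span ℚ (Set.range fun a : A n =>
      (Finsupp.single (⟨n, a⟩ : Σ n, A n) 1 : (Σ n, A n) →₀ ℚ)) := by
  have key : (fun n => Submodule.span ℚ (Set.range fun a : A n =>
      (Finsupp.single (⟨n, a⟩ : Σ n, A n) 1 : (Σ n, A n) →₀ ℚ))) =
      fun n => Finsupp.supported ℚ ℚ {x : Σ n, A n | x.1 = n} := by
    ext1 n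
    rw [Finsupp.supported_eq_span_single]
    congr 1
    ext x
    constructor
    · rintro ⟨a, rfl⟩
      exact ⟨⟨n, a⟩, rfl, rfl⟩
    · rintro ⟨⟨m, a⟩, rfl, rfl⟩
      exact ⟨a, rfl⟩
  rw [key]
  refine DirectSum.isInternal_submodule_of_iSupIndep_of_iSup_eq_top ?_ ?_
  · intro n
    refine Disjoint.mono_right (iSup₂_le fun j hj => Finsupp.supported_mono
      (t := {x : Σ n, A n | x.1 = n}ᶜ) fun x hx => ?_)
      (Finsupp.disjoint_supported_supported disjoint_compl_right)
    obtain rfl : x.1 = j := hx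
    exact hj
  · rw [← Finsupp.supported_iUnion, ← Finsupp.supported_univ]
    congr 1
    ext x
    simp

@[elab_as_elim]
theorem QB.induction {P : QB → Prop} (x : QB) (add : ∀ x y, P x → P y → P (x + y))
    (smul : ∀ (c : ℚ) x, P x → P (c • x)) (of : ∀ {n} (w : SignedPerm n), P (QB.of w)) : P x := by
  refine Finsupp.induction_linear x ?_ (fun f g hf hg => add f g hf hg) fun w c => ?_
  · simpa using smul 0 _ (of (1 : SignedPerm 0))
  · simpa [QB.of] using smul c _ (of w.2)

theorem QB.lhom_ext {M : Type} [AddCommGroup M] [Module ℚ M] {f g : QB →ₗ[ℚ] M}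
    (h : ∀ l, f (QB.ofWord l) = g (QB.ofWord l)) : f = g := by
  refine LinearMap.ext fun x => ?_
  induction x using QB.induction with
  | add x y hx hy => simp [hx, hy]
  | smul c x hx => simp [hx]
  | of w =>
    obtain ⟨l, hl, -⟩ := exists_ofWord_eq 0 w
    rw [← hl, h]

theorem QB.one_eq_ofWord : QB.ops.one = QB.ofWord [] := by
  change QB.of (1 : SignedPerm 0) = QB.of (invStd ([] : List (ℕ × ℤˣ)).get)
  congr 1
  exact SignedPerm.ext (Subsingleton.elim _ _) (funext fun i => i.elim0)

theorem QB.counit_of {n : ℕ} (w : SignedPerm n) :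
    QB.ops.counit (QB.of w) = if n = 0 then 1 else 0 := by
  simp [QB.ops, QB.of]

theorem QB.counit_ofWord (l : List (ℕ × ℤˣ)) :
    QB.ops.counit (QB.ofWord l) = if l = [] then 1 else 0 := by
  rw [QB.ofWord, QB.counit_of]
  simp

theorem QB.mul_shuffleSum (l m k : List (ℕ × ℤˣ)) :
    QB.ops.mul (shuffleSum QB.ofWord l m) (QB.ofWord k) =
      shuffleSum (fun t => QB.ops.mul (QB.ofWord t) (QB.ofWord k)) l m :=
  map_shuffleSum (QB.ops.mul.flip (QB.ofWord k)).toAddMonoidHom _ l m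

theorem QB.mul_shuffleSum' (l m k : List (ℕ × ℤˣ)) :
    QB.ops.mul (QB.ofWord k) (shuffleSum QB.ofWord l m) =
      shuffleSum (fun t => QB.ops.mul (QB.ofWord k) (QB.ofWord t)) l m :=
  map_shuffleSum (QB.ops.mul (QB.ofWord k)).toAddMonoidHom _ l m

/-- A shuffle has the same letters as its factors, so the order hypotheses persist and associativity
of shuffling applies. -/
theorem QB.mul_assoc_ofWord {l m k : List (ℕ × ℤˣ)} (hlm : ∀ a ∈ l, ∀ b ∈ m, a.1 < b.1)
    (hlk : ∀ a ∈ l, ∀ b ∈ k, a.1 < b.1) (hmk : ∀ a ∈ m, ∀ b ∈ k, a.1 < b.1) :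
    QB.ops.mul (QB.ops.mul (QB.ofWord l) (QB.ofWord m)) (QB.ofWord k) =
      QB.ops.mul (QB.ofWord l) (QB.ops.mul (QB.ofWord m) (QB.ofWord k)) := by
  rw [QB.mul_ofWord hlm, QB.mul_ofWord hmk, QB.mul_shuffleSum, QB.mul_shuffleSum']
  rw [shuffleSum_congr (g := fun t => shuffleSum QB.ofWord t k), shuffleSum_assoc]
  · refine shuffleSum_congr fun t ht => (QB.mul_ofWord fun a ha b hb => ?_).symm
    rw [ht.mem_iff, List.mem_append] at hb
    exact hb.elim (hlm a ha b) (hlk a ha b)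
  · refine fun t ht => QB.mul_ofWord fun a ha b hb => ?_
    rw [ht.mem_iff, List.mem_append] at ha
    exact ha.elim (fun ha => hlk a ha b hb) (fun ha => hmk a ha b hb)

theorem QB.mul_assoc' (x y z : QB) :
    QB.ops.mul (QB.ops.mul x y) z = QB.ops.mul x (QB.ops.mul y z) := by
  induction x using QB.induction with
  | add a b ha hb => simp only [map_add, LinearMap.add_apply, ha, hb]
  | smul c a ha => simp only [map_smul, LinearMap.smul_apply, ha]
  | @of p u =>
    induction y using QB.induction with
    | add a b ha hb => simp only [map_add, LinearMap.add_apply, ha, hb]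
    | smul c a ha => simp only [map_smul, LinearMap.smul_apply, ha]
    | @of q v =>
      induction z using QB.induction with
      | add a b ha hb => simp only [map_add, ha, hb]
      | smul c a ha => simp only [map_smul, ha]
      | of w =>
        obtain ⟨l, hl, hl'⟩ := exists_ofWord_eq 0 u
        obtain ⟨m, hm, hm'⟩ := exists_ofWord_eq p v
        obtain ⟨k, hk, hk'⟩ := exists_ofWord_eq (p + q) w
        rw [← hl, ← hm, ← hk]
        refine QB.mul_assoc_ofWord ?_ ?_ ?_ <;> intro a ha b hb
        · have := hl' a ha; have := hm' b hb; omega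
        · have := hl' a ha; have := hk' b hb; omega
        · have := hm' a ha; have := hk' b hb; omega

theorem splitSum_eq_left {α M : Type} [AddCommMonoid M] {g : List α → List α → M}
    (h : ∀ a x y, g (a :: x) y = 0) (l : List α) : splitSum g l = g [] l := by
  cases l with
  | nil => rfl
  | cons a l =>
    rw [splitSum, splitSum_congr (g' := fun _ _ => 0) (fun x y _ => h a x y)]
    simp [splitSum_eq_sum_antidiagonal]

theorem splitSum_eq_right {α M : Type} [AddCommMonoid M] {g : List α → List α → M}
    (h : ∀ a x y, g x (a :: y) = 0) (l : List α) : splitSum g l = g l [] := by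
  induction l generalizing g with
  | nil => rfl
  | cons a l ih => rw [splitSum, h, zero_add, ih fun b x y => h b (a :: x) y]

/-- The content is `shuffleSum_splitSum`; the rest moves bilinear maps across the sums. -/
theorem QB.comul_mul_ofWord {l m : List (ℕ × ℤˣ)} (h : ∀ a ∈ l, ∀ b ∈ m, a.1 < b.1) :
    QB.ops.comul (QB.ops.mul (QB.ofWord l) (QB.ofWord m)) =
      TensorProduct.map₂ QB.ops.mul QB.ops.mul (QB.ops.comul (QB.ofWord l))
        (QB.ops.comul (QB.ofWord m)) := by
  rw [QB.mul_ofWord h, QB.comul_ofWord, QB.comul_ofWord]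
  have e1 := map_shuffleSum QB.ops.comul.toAddMonoidHom QB.ofWord l m
  simp only [LinearMap.toAddMonoidHom_coe, QB.comul_ofWord] at e1
  rw [e1]
  have e2 := map_splitSum ((TensorProduct.map₂ QB.ops.mul QB.ops.mul).flip
    (splitSum (fun x y => QB.ofWord x ⊗ₜ[ℚ] QB.ofWord y) m)).toAddMonoidHom
    (fun x y => QB.ofWord x ⊗ₜ[ℚ] QB.ofWord y) l
  simp only [LinearMap.toAddMonoidHom_coe, LinearMap.flip_apply] at e2
  rw [e2]
  refine (shuffleSum_splitSum _ l m).trans (splitSum_congr fun x y hxy => ?_)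
  have e3 := map_splitSum (TensorProduct.map₂ QB.ops.mul QB.ops.mul
    (QB.ofWord x ⊗ₜ[ℚ] QB.ofWord y)).toAddMonoidHom
    (fun x y => QB.ofWord x ⊗ₜ[ℚ] QB.ofWord y) m
  simp only [LinearMap.toAddMonoidHom_coe] at e3
  rw [e3]
  refine splitSum_congr fun x' y' hxy' => ?_
  subst hxy hxy'
  rw [TensorProduct.map₂_apply_tmul, TensorProduct.map_tmul, QB.mul_ofWord fun a ha b hb => h a (by simp [ha]) b (by simp [hb]),
    QB.mul_ofWord fun a ha b hb => h a (by simp [ha]) b (by simp [hb])]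
  have e4 := map_shuffleSum ((TensorProduct.mk ℚ QB QB).flip
    (shuffleSum QB.ofWord y y')).toAddMonoidHom QB.ofWord x x'
  simp only [LinearMap.toAddMonoidHom_coe, LinearMap.flip_apply, TensorProduct.mk_apply] at e4
  rw [e4]
  refine shuffleSum_congr fun t _ => ?_
  exact (map_shuffleSum (TensorProduct.mk ℚ QB QB (QB.ofWord t)).toAddMonoidHom _ y y').symm

theorem QB.isConnectedGradedBialgebra : IsConnectedGradedBialgebra QB.ops where
  isInternal := isInternal_span_single _
  mul_assoc := QB.mul_assoc'
  one_mul x := by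
    have : QB.ops.mul QB.ops.one = LinearMap.id := QB.lhom_ext fun l => by
      rw [QB.one_eq_ofWord, QB.mul_ofWord (by simp)]; simp
    rw [this]; rfl
  mul_one x := by
    have : QB.ops.mul.flip QB.ops.one = LinearMap.id := QB.lhom_ext fun l => by
      rw [LinearMap.flip_apply, QB.one_eq_ofWord, QB.mul_ofWord (by simp)]; simp
    exact LinearMap.congr_fun this x
  coassoc := QB.lhom_ext fun l => by
    have e1 := map_splitSum (((TensorProduct.assoc ℚ QB QB QB).toLinearMap ∘ₗ
      QB.ops.comul.rTensor QB).toAddMonoidHom) (fun x y => QB.ofWord x ⊗ₜ[ℚ] QB.ofWord y) l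
    have e2 := map_splitSum (QB.ops.comul.lTensor QB).toAddMonoidHom
      (fun x y => QB.ofWord x ⊗ₜ[ℚ] QB.ofWord y) l
    have e3 := splitSum_assoc
      (fun x y z => QB.ofWord x ⊗ₜ[ℚ] (QB.ofWord y ⊗ₜ[ℚ] QB.ofWord z)) l
    simp only [LinearMap.toAddMonoidHom_coe, LinearMap.comp_apply, LinearMap.rTensor_tmul,
      LinearMap.lTensor_tmul, QB.comul_ofWord] at e1 e2 ⊢
    rw [e1, e2]
    refine Eq.trans ?_ (e3.trans ?_) <;> refine splitSum_congr fun x y _ => ?_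
    · have := map_splitSum ((TensorProduct.assoc ℚ QB QB QB).toLinearMap ∘ₗ
        (TensorProduct.mk ℚ _ QB).flip (QB.ofWord y)).toAddMonoidHom
        (fun x y => QB.ofWord x ⊗ₜ[ℚ] QB.ofWord y) x
      simpa using this
    · have := map_splitSum (TensorProduct.mk ℚ QB (QB ⊗[ℚ] QB) (QB.ofWord x)).toAddMonoidHom
        (fun x y => QB.ofWord x ⊗ₜ[ℚ] QB.ofWord y) y
      simpa using this.symm
  rTensor_counit := QB.lhom_ext fun l => by
    have e1 := map_splitSum (QB.ops.counit.rTensor QB).toAddMonoidHom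
      (fun x y => QB.ofWord x ⊗ₜ[ℚ] QB.ofWord y) l
    rw [LinearMap.comp_apply, QB.comul_ofWord]
    refine e1.trans ((splitSum_eq_left ?_ l).trans ?_) <;> simp [QB.counit_ofWord]
  lTensor_counit := QB.lhom_ext fun l => by
    have e1 := map_splitSum (QB.ops.counit.lTensor QB).toAddMonoidHom
      (fun x y => QB.ofWord x ⊗ₜ[ℚ] QB.ofWord y) l
    rw [LinearMap.comp_apply, QB.comul_ofWord]
    refine e1.trans ((splitSum_eq_right ?_ l).trans ?_) <;> simp [QB.counit_ofWord]
  comul_one := by rw [QB.one_eq_ofWord, QB.comul_ofWord, splitSum]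
  comul_mul x y := by
    induction x using QB.induction with
    | add a b ha hb => simp only [map_add, LinearMap.add_apply, ha, hb]
    | smul c a ha => simp only [map_smul, LinearMap.smul_apply, ha]
    | @of p u =>
      induction y using QB.induction with
      | add a b ha hb => simp only [map_add, ha, hb]
      | smul c a ha => simp only [map_smul, ha]
      | of v =>
        obtain ⟨l, hl, hl'⟩ := exists_ofWord_eq 0 u
        obtain ⟨m, hm, hm'⟩ := exists_ofWord_eq p v
        rw [← hl, ← hm]
        refine QB.comul_mul_ofWord fun a ha b hb => ?_
        have := hl' a ha; have := hm' b hb; omega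
  counit_one := by rw [QB.one_eq_ofWord, QB.counit_ofWord]; simp
  counit_mul x y := by
    induction x using QB.induction with
    | add a b ha hb => simp only [map_add, LinearMap.add_apply, ha, hb, add_mul]
    | smul c a ha => simp only [map_smul, LinearMap.smul_apply, ha, smul_eq_mul, mul_assoc]
    | @of p u =>
      induction y using QB.induction with
      | add a b ha hb => simp only [map_add, ha, hb, mul_add]
      | smul c a ha => simp only [map_smul, ha, smul_eq_mul, mul_left_comm]
      | @of q v =>
        rw [QB.mul_of, map_sum]
        simp only [QB.counit_of, Finset.sum_const, card_shuffles]
        rcases Nat.eq_zero_or_pos p with rfl | hp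
        · by_cases hq : q = 0 <;> simp [hq]
        · simp [hp.ne']
  one_mem := Submodule.subset_span ⟨1, rfl⟩
  mul_mem p q x hx y hy := by
    have h1 : QB.ops.grade p ≤ (QB.ops.grade (p + q)).comap (QB.ops.mul.flip y) := by
      refine Submodule.span_le.2 ?_
      rintro _ ⟨u, rfl⟩
      have h2 : QB.ops.grade q ≤ (QB.ops.grade (p + q)).comap (QB.ops.mul (QB.of u)) := by
        refine Submodule.span_le.2 ?_
        rintro _ ⟨v, rfl⟩
        change QB.ops.mul (QB.of u) (QB.of v) ∈ QB.ops.grade (p + q)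
        rw [QB.mul_of]
        exact Submodule.sum_mem _ fun ξ _ => Submodule.subset_span ⟨_, rfl⟩
      exact h2 hy
    exact h1 hx
  comul_mem n x hx := by
    have h1 : QB.ops.grade n ≤ (⨆ pq ∈ Finset.HasAntidiagonal.antidiagonal n,
        tensorSub (QB.ops.grade pq.1) (QB.ops.grade pq.2)).comap QB.ops.comul := by
      refine Submodule.span_le.2 ?_
      rintro _ ⟨w, rfl⟩
      rw [SetLike.mem_coe, Submodule.mem_comap]
      rw [QB.comul_of]
      refine Submodule.sum_mem _ fun pq hpq => Submodule.mem_iSup_of_mem pq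
        (Submodule.mem_iSup_of_mem hpq ?_)
      refine Submodule.sum_mem _ fun u _ => Submodule.sum_mem _ fun v _ =>
        Submodule.sum_mem _ fun ξ _ => ?_
      split_ifs
      · exact tmul_mem_tensorSub (Submodule.subset_span ⟨u, rfl⟩) (Submodule.subset_span ⟨v, rfl⟩)
      · exact Submodule.zero_mem _
    exact h1 hx
  counit_eq_zero n hn x hx := by
    have h1 : QB.ops.grade n ≤ LinearMap.ker QB.ops.counit := by
      refine Submodule.span_le.2 ?_
      rintro _ ⟨w, rfl⟩
      change QB.ops.counit (QB.of w) = 0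
      rw [QB.counit_of, if_neg hn]
    exact h1 hx
  grade_zero_le := by
    refine Submodule.span_mono ?_
    rintro _ ⟨w, rfl⟩
    change QB.of w = QB.of 1
    congr 1
    exact SignedPerm.ext (Subsingleton.elim _ _) (funext fun i => i.elim0)

/-! ### Forgetting the signs -/

/-- The linear map from `QB` to `QS` that forgets the signs. -/
def forgetSigns : QB →ₗ[ℚ] QS := Finsupp.lmapDomain ℚ ℚ fun w => ⟨w.1, w.2.perm⟩

@[simp] theorem forgetSigns_of {n : ℕ} (w : SignedPerm n) :
    forgetSigns (QB.of w) = QS.of w.perm := by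
  simp [forgetSigns, QB.of, QS.of, Finsupp.mapDomain_single]

theorem QS.mul_of {p q : ℕ} (u : Equiv.Perm (Fin p)) (v : Equiv.Perm (Fin q)) :
    QS.ops.mul (QS.of u) (QS.of v) = ∑ ξ ∈ shuffles p q, QS.of (ξ * permTimes u v) := by
  simp [QS.ops, QS.of]

theorem QS.comul_of {n : ℕ} (w : Equiv.Perm (Fin n)) : QS.ops.comul (QS.of w) =
    ∑ pq ∈ Finset.HasAntidiagonal.antidiagonal n,
      ∑ u : Equiv.Perm (Fin pq.1), ∑ v : Equiv.Perm (Fin pq.2), ∑ ξ ∈ shuffles pq.1 pq.2,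
        if (⟨n, w⟩ : Σ n, Equiv.Perm (Fin n)) = ⟨pq.1 + pq.2, permTimes u v * ξ⁻¹⟩
          then QS.of u ⊗ₜ[ℚ] QS.of v else 0 := by
  simp [QS.ops, QS.of]

theorem forgetSigns_grade (n : ℕ) : (QB.ops.grade n).map forgetSigns = QS.ops.grade n := by
  change (Submodule.span ℚ (Set.range fun w : SignedPerm n => QB.of w)).map forgetSigns =
    Submodule.span ℚ (Set.range fun w : Equiv.Perm (Fin n) => QS.of w)
  rw [Submodule.map_span, ← Set.range_comp]
  congr 1
  ext x
  constructor
  · rintro ⟨w, rfl⟩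
    exact ⟨w.perm, by simp⟩
  · rintro ⟨w, rfl⟩
    exact ⟨SignedPerm.ofPerm w, by simp⟩

-- Shuffles carry no signs, so forgetting signs respects both the product and the factorization `w =
-- (u × v) · ξ⁻¹`.
open SignedPerm in
theorem isGradedSurjection_forgetSigns : IsGradedSurjection QB.ops QS.ops forgetSigns where
  map_grade := forgetSigns_grade
  surjective := by
    refine Finsupp.mapDomain_surjective fun w => ⟨⟨w.1, SignedPerm.ofPerm w.2⟩, rfl⟩
  map_one := forgetSigns_of _
  map_mul x y := by
    induction x using QB.induction with
    | add a b ha hb => simp only [map_add, LinearMap.add_apply, ha, hb]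
    | smul c a ha => simp only [map_smul, LinearMap.smul_apply, ha]
    | of u =>
      induction y using QB.induction with
      | add a b ha hb => simp only [map_add, ha, hb]
      | smul c a ha => simp only [map_smul, ha]
      | of v => simp [QB.mul_of, QS.mul_of]
  map_comul x := by
    induction x using QB.induction with
    | add a b ha hb => simp only [map_add, ha, hb]
    | smul c a ha => simp only [map_smul, ha]
    | of w =>
      rw [forgetSigns_of, QS.comul_of, QB.comul_of, map_sum]
      refine Finset.sum_congr rfl fun pq hpq => ?_
      obtain ⟨p, q⟩ := pq
      obtain rfl := Finset.HasAntidiagonal.mem_antidiagonal.1 hpq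
      obtain ⟨u, v, ξ, hξ, rfl⟩ := exists_eq_times_mul_inv w
      simp only
      rw [sum_ite_eq_times_mul_inv _ u v hξ]
      rw [TensorProduct.map_tmul, forgetSigns_of, forgetSigns_of]
      exact sum_ite_eq_permTimes_mul_inv (fun u v => QS.of u ⊗ₜ[ℚ] QS.of v) u.perm v.perm hξ
  map_counit x := by
    induction x using QB.induction with
    | add a b ha hb => simp only [map_add, ha, hb]
    | smul c a ha => simp only [map_smul, ha]
    | of w => rw [forgetSigns_of, QB.counit_of]; simp [QS.ops, QS.of]

theorem QS.isConnectedGradedBialgebra : IsConnectedGradedBialgebra QS.ops :=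
  isGradedSurjection_forgetSigns.isConnectedGradedBialgebra QB.isConnectedGradedBialgebra
    (isInternal_span_single _)

/-! ### Sums of signed permutations with prescribed local behaviour -/

/-- The `i`-th letter of a signed permutation, as a nonzero integer. -/
def SignedPerm.val {n : ℕ} (w : SignedPerm n) (i : Fin n) : ℤ :=
  (w.sign i : ℤ) * ((w.perm i : ℕ) + 1)

open Classical in
/-- The sum of the signed permutations with property `P`. -/
def QB.sumOf {n : ℕ} (P : SignedPerm n → Prop) : QB :=
  ∑ w ∈ Finset.univ.filter (fun w : SignedPerm n => P w), QB.of w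

namespace SignedPerm

/-- The comparison of two signed letters depends only on their signs and on the relative order of
their absolute values, which a shuffle preserves inside each block. -/
theorem unit_mul_lt_unit_mul_iff (s t : ℤˣ) {a b a' b' : ℕ} (h : a < b ↔ a' < b')
    (h' : b < a ↔ b' < a') :
    (s : ℤ) * (a + 1) < (t : ℤ) * (b + 1) ↔ (s : ℤ) * (a' + 1) < (t : ℤ) * (b' + 1) := by
  rcases Int.units_eq_one_or s with rfl | rfl <;> rcases Int.units_eq_one_or t with rfl | rfl <;>
    simp <;> omega

variable {n p q : ℕ}

theorem val_injective (w : SignedPerm n) : Function.Injective w.val := by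
  intro i j h
  apply w.perm.injective
  simp only [val] at h
  rcases Int.units_eq_one_or (w.sign i) with hi | hi <;>
    rcases Int.units_eq_one_or (w.sign j) with hj | hj <;> simp [hi, hj] at h <;> omega

theorem val_lt_val_iff_of_sign_eq (w : SignedPerm n) {i j : Fin n} (h : w.sign i = w.sign j) :
    w.val i < w.val j ↔ if w.sign j = 1 then w.perm i < w.perm j else w.perm j < w.perm i := by
  simp only [val, h]
  rcases Int.units_eq_one_or (w.sign j) with hj | hj <;> simp [hj]
  omega

theorem val_shuffle_castAdd_lt {ξ : Equiv.Perm (Fin (p + q))} (hξ : ξ ∈ shuffles p q)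
    (u : SignedPerm p) (v : SignedPerm q) (i j : Fin p) :
    (ofPerm ξ * times u v).val (Fin.castAdd q i) < (ofPerm ξ * times u v).val (Fin.castAdd q j) ↔
      u.val i < u.val j := by
  rw [mem_shuffles] at hξ
  simp only [val, mul_sign, ofPerm_sign, times_sign_castAdd, mul_perm, ofPerm_perm, times_perm,
    Equiv.Perm.mul_apply, permTimes_castAdd, one_mul]
  apply unit_mul_lt_unit_mul_iff
  · exact hξ.1.lt_iff_lt (a := u.perm i) (b := u.perm j)
  · exact hξ.1.lt_iff_lt (a := u.perm j) (b := u.perm i)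

theorem val_shuffle_natAdd_lt {ξ : Equiv.Perm (Fin (p + q))} (hξ : ξ ∈ shuffles p q)
    (u : SignedPerm p) (v : SignedPerm q) (i j : Fin q) :
    (ofPerm ξ * times u v).val (Fin.natAdd p i) < (ofPerm ξ * times u v).val (Fin.natAdd p j) ↔
      v.val i < v.val j := by
  rw [mem_shuffles] at hξ
  simp only [val, mul_sign, ofPerm_sign, times_sign_natAdd, mul_perm, ofPerm_perm, times_perm,
    Equiv.Perm.mul_apply, permTimes_natAdd, one_mul]
  apply unit_mul_lt_unit_mul_iff
  · exact hξ.2.lt_iff_lt (a := v.perm i) (b := v.perm j)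
  · exact hξ.2.lt_iff_lt (a := v.perm j) (b := v.perm i)

theorem val_mul_ofPerm (w : SignedPerm n) (σ : Equiv.Perm (Fin n)) (i : Fin n) :
    (w * ofPerm σ).val i = w.val (σ i) := by simp [val]

theorem val_times_castAdd (u : SignedPerm p) (v : SignedPerm q) (i : Fin p) :
    (times u v).val (Fin.castAdd q i) = u.val i := by simp [val]

theorem val_times_natAdd_lt (u : SignedPerm p) (v : SignedPerm q) (i j : Fin q) :
    (times u v).val (Fin.natAdd p i) < (times u v).val (Fin.natAdd p j) ↔ v.val i < v.val j := by
  simp only [val, times_sign_natAdd, times_perm, permTimes_natAdd]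
  apply unit_mul_lt_unit_mul_iff <;> simp

theorem sum_times_mul_inv {M : Type} [AddCommMonoid M] (f : SignedPerm (p + q) → M) :
    ∑ u, ∑ v, ∑ ξ ∈ shuffles p q, f (times u v * (ofPerm ξ)⁻¹) = ∑ w, f w := by
  rw [← Equiv.sum_comp (Equiv.inv (SignedPerm (p + q))), ← sum_shuffle_mul_times,
    ← Equiv.sum_comp (Equiv.inv (SignedPerm p))]
  refine Finset.sum_congr rfl fun u _ => ?_
  rw [← Equiv.sum_comp (Equiv.inv (SignedPerm q))]
  simp [times_inv]

theorem strictMono_val_iff (w : SignedPerm n) :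
    StrictMono w.val ↔ ∀ i j : Fin n, (j : ℕ) = i + 1 → w.val i < w.val j := by
  refine ⟨fun h i j hij => h (by rw [Fin.lt_def]; omega), fun h i j hij => ?_⟩
  obtain ⟨i, hi⟩ := i
  obtain ⟨j, hj⟩ := j
  rw [Fin.mk_lt_mk] at hij
  revert hj
  induction j, hij using Nat.le_induction with
  | base => exact fun hj => h _ _ rfl
  | succ m hm ih => exact fun hj => (ih (by omega)).trans (h ⟨m, by omega⟩ ⟨m + 1, hj⟩ rfl)

end SignedPerm

open SignedPerm

variable {n p q : ℕ}

theorem QB.sumOf_eq_sum_filter (P : SignedPerm n → Prop) [DecidablePred P] :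
    QB.sumOf P = ∑ w ∈ Finset.univ.filter fun w => P w, QB.of w := by
  rw [QB.sumOf]
  congr

theorem QB.sumOf_eq_sum_ite (P : SignedPerm n → Prop) [DecidablePred P] :
    QB.sumOf P = ∑ w, if P w then QB.of w else 0 := by
  rw [QB.sumOf, Finset.sum_filter]
  exact Finset.sum_congr rfl fun w _ => by congr

theorem QB.sumOf_congr {P Q : SignedPerm n → Prop} (h : ∀ w, P w ↔ Q w) :
    QB.sumOf P = QB.sumOf Q := by
  rw [show P = Q from funext fun w => propext (h w)]

theorem QB.sumOf_mem_grade (P : SignedPerm n → Prop) : QB.sumOf P ∈ QB.ops.grade n :=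
  Submodule.sum_mem _ fun w _ => Submodule.subset_span ⟨w, rfl⟩

/-- Every signed permutation is `ξ · (u × v)` exactly once, so a product of two sums is again a sum
without multiplicities. -/
theorem QB.mul_sumOf {P : SignedPerm p → Prop} {Q : SignedPerm q → Prop}
    {R : SignedPerm (p + q) → Prop}
    (h : ∀ ξ ∈ shuffles p q, ∀ u v, R (ofPerm ξ * times u v) ↔ P u ∧ Q v) :
    QB.ops.mul (QB.sumOf P) (QB.sumOf Q) = QB.sumOf R := by
  classical
  rw [QB.sumOf_eq_sum_ite, QB.sumOf_eq_sum_ite, QB.sumOf_eq_sum_ite,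
    ← sum_shuffle_mul_times, LinearMap.map_sum₂]
  refine Finset.sum_congr rfl fun u _ => ?_
  rw [map_sum]
  refine Finset.sum_congr rfl fun v _ => ?_
  by_cases hu : P u
  · by_cases hv : Q v
    · rw [if_pos hu, if_pos hv, QB.mul_of]
      exact Finset.sum_congr rfl fun ξ hξ => (if_pos ((h ξ hξ u v).2 ⟨hu, hv⟩)).symm
    · rw [if_neg hv, map_zero]
      exact (Finset.sum_eq_zero fun ξ hξ => if_neg fun hR => hv ((h ξ hξ u v).1 hR).2).symm
  · rw [if_neg hu, map_zero, LinearMap.zero_apply]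
    exact (Finset.sum_eq_zero fun ξ hξ => if_neg fun hR => hu ((h ξ hξ u v).1 hR).1).symm

/-- Prescribed signs, ascents and descents: the sign of the letter in position `i` is in `d i`,
and the letter in position `j` is larger than its predecessor if `c j`, and smaller if `c' j`. -/
def IsLocal (n : ℕ) (d : ℕ → Set ℤˣ) (c c' : ℕ → Prop) (w : SignedPerm n) : Prop :=
  (∀ i : Fin n, w.sign i ∈ d i) ∧
  ∀ i j : Fin n, (j : ℕ) = i + 1 → (c j → w.val i < w.val j) ∧ (c' j → w.val j < w.val i)

/-- Positions count from `0`, so the condition at `p` is the one comparing the two blocks, and it is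
void. All other conditions live inside one block, where shuffles preserve comparisons. -/
theorem QB.mul_sumOf_isLocal {d : ℕ → Set ℤˣ} {c c' : ℕ → Prop} (hc : ¬ c p) (hc' : ¬ c' p) :
    QB.ops.mul (QB.sumOf (IsLocal p d c c'))
      (QB.sumOf (IsLocal q (fun i => d (p + i)) (fun i => c (p + i)) fun i => c' (p + i))) =
      QB.sumOf (IsLocal (p + q) d c c') := by
  refine QB.mul_sumOf fun ξ hξ u v => ⟨fun h => ⟨⟨fun i => ?_, fun i j hij => ?_⟩,
    ⟨fun i => ?_, fun i j hij => ?_⟩⟩, fun h => ⟨fun i => ?_, fun i j hij => ?_⟩⟩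
  · simpa using h.1 (Fin.castAdd q i)
  · have := h.2 (Fin.castAdd q i) (Fin.castAdd q j) hij
    rwa [val_shuffle_castAdd_lt hξ, val_shuffle_castAdd_lt hξ] at this
  · simpa using h.1 (Fin.natAdd p i)
  · have := h.2 (Fin.natAdd p i) (Fin.natAdd p j) (by simp; omega)
    rwa [val_shuffle_natAdd_lt hξ, val_shuffle_natAdd_lt hξ] at this
  · induction i using Fin.addCases with
    | left i => simpa using h.1.1 i
    | right i => simpa using h.2.1 i
  · induction i using Fin.addCases with
    | left i =>
      induction j using Fin.addCases with
      | left j =>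
        rw [val_shuffle_castAdd_lt hξ, val_shuffle_castAdd_lt hξ]
        exact h.1.2 i j hij
      | right j =>
        have e : ((Fin.natAdd p j : Fin (p + q)) : ℕ) = p := by
          simp at hij ⊢; omega
        rw [e]
        exact ⟨fun h => absurd h hc, fun h => absurd h hc'⟩
    | right i =>
      induction j using Fin.addCases with
      | left j => simp at hij; omega
      | right j =>
        rw [val_shuffle_natAdd_lt hξ, val_shuffle_natAdd_lt hξ]
        exact h.2.2 i j (by simp at hij; omega)

theorem QB.sumOf_sub_sumOf {P Q : SignedPerm n → Prop} (h : ∀ w, Q w → P w) :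
    QB.sumOf P - QB.sumOf Q = QB.sumOf fun w => P w ∧ ¬ Q w := by
  classical
  rw [QB.sumOf_eq_sum_ite, QB.sumOf_eq_sum_ite, QB.sumOf_eq_sum_ite, ← Finset.sum_sub_distrib]
  refine Finset.sum_congr rfl fun w _ => ?_
  by_cases hQ : Q w
  · simp [hQ, h w hQ]
  · simp [hQ]

/-! ### Sums of increasing signed permutations -/

/-- The sum of the increasing signed permutations of `[n]` with signs in `A`. -/
def QB.incr (A : Set ℤˣ) (n : ℕ) : QB :=
  QB.sumOf fun w : SignedPerm n => (∀ i, w.sign i ∈ A) ∧ StrictMono w.val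

/-- The letters of `u × v` are rearranged increasingly by exactly one permutation, and its inverse
is a shuffle precisely when `u` and `v` are increasing. -/
theorem sum_shuffles_ite_strictMono {M : Type} [AddCommMonoid M] (A : Set ℤˣ) (u : SignedPerm p)
    (v : SignedPerm q) (t : M) [∀ n, DecidablePred fun w : SignedPerm n =>
      (∀ i, w.sign i ∈ A) ∧ StrictMono w.val] :
    (∑ ξ ∈ shuffles p q, if (∀ i, (times u v * (ofPerm ξ)⁻¹).sign i ∈ A) ∧
        StrictMono (times u v * (ofPerm ξ)⁻¹).val then t else 0) =
      if (∀ i, u.sign i ∈ A) ∧ StrictMono u.val then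
        if (∀ i, v.sign i ∈ A) ∧ StrictMono v.val then t else 0 else 0 := by
  have hval : ∀ ξ : Equiv.Perm (Fin (p + q)), (times u v * (ofPerm ξ)⁻¹).val =
      (times u v).val ∘ (ξ⁻¹ : Equiv.Perm (Fin (p + q))) := fun ξ =>
    funext fun i => val_mul_ofPerm _ ξ⁻¹ i
  have hcast : (times u v).val ∘ Fin.castAdd q = u.val :=
    funext fun i => val_times_castAdd u v i
  have hsign : ∀ ξ : Equiv.Perm (Fin (p + q)),
      (∀ i, (times u v * (ofPerm ξ)⁻¹).sign i ∈ A) ↔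
        (∀ i, u.sign i ∈ A) ∧ ∀ i, v.sign i ∈ A := by
    intro ξ
    simp only [mul_sign, inv_sign, ofPerm_sign, inv_one, mul_one, inv_perm, ofPerm_perm]
    refine ⟨fun h => ⟨fun i => ?_, fun i => ?_⟩, fun h i => ?_⟩
    · simpa using h (ξ (Fin.castAdd q i))
    · simpa using h (ξ (Fin.natAdd p i))
    · generalize ξ⁻¹ i = j
      induction j using Fin.addCases with
      | left j => simpa using h.1 j
      | right j => simpa using h.2 j
  -- For an increasing rearrangement, `ξ i` is the rank of the letter in position `i`.
  have hlt : ∀ {ξ : Equiv.Perm (Fin (p + q))},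
      StrictMono ((times u v).val ∘ (ξ⁻¹ : Equiv.Perm (Fin (p + q)))) →
      ∀ i j, ξ i < ξ j ↔ (times u v).val i < (times u v).val j := by
    intro ξ h i j
    rw [← h.lt_iff_lt]
    simp
  have key : ∀ ξ ∈ shuffles p q, StrictMono (times u v * (ofPerm ξ)⁻¹).val →
      StrictMono u.val ∧ StrictMono v.val := by
    intro ξ hξ h
    rw [hval] at h
    rw [mem_shuffles] at hξ
    refine ⟨fun i j hij => ?_, fun i j hij => ?_⟩
    · rw [← val_times_castAdd u v, ← val_times_castAdd u v, ← hlt h]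
      exact hξ.1 hij
    · rw [← val_times_natAdd_lt u v, ← hlt h]
      exact hξ.2 hij
  by_cases hu : (∀ i, u.sign i ∈ A) ∧ StrictMono u.val
  · by_cases hv : (∀ i, v.sign i ∈ A) ∧ StrictMono v.val
    · rw [if_pos hu, if_pos hv]
      have hs := strictMono_comp_sort (times u v).val_injective
      let ξ₀ : Equiv.Perm (Fin (p + q)) := (Tuple.sort (times u v).val)⁻¹
      have hs' : StrictMono ((times u v).val ∘ (ξ₀⁻¹ : Equiv.Perm (Fin (p + q)))) := by
        simpa [ξ₀] using hs
      rw [Finset.sum_eq_single ξ₀, if_pos]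
      · exact ⟨(hsign _).2 ⟨hu.1, hv.1⟩, by rw [hval]; exact hs'⟩
      · intro ξ hξ hne
        refine if_neg fun h => hne ?_
        rw [hval] at h
        rw [← inv_inj, Equiv.Perm.eq_sort_of_strictMono h.2]
        simp [ξ₀]
      · intro h
        refine absurd (mem_shuffles.2 ⟨fun i j hij => ?_, fun i j hij => ?_⟩) h
        · rw [Function.comp_apply, Function.comp_apply, hlt hs', val_times_castAdd,
            val_times_castAdd]
          exact hu.2 hij
        · rw [Function.comp_apply, Function.comp_apply, hlt hs', val_times_natAdd_lt]
          exact hv.2 hij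
    · rw [if_pos hu, if_neg hv]
      exact Finset.sum_eq_zero fun ξ hξ => if_neg fun h =>
        hv ⟨((hsign ξ).1 h.1).2, (key ξ hξ h.2).2⟩
  · rw [if_neg hu]
    exact Finset.sum_eq_zero fun ξ hξ => if_neg fun h =>
      hu ⟨((hsign ξ).1 h.1).1, (key ξ hξ h.2).1⟩

theorem QB.comul_incr (A : Set ℤˣ) (n : ℕ) : QB.ops.comul (QB.incr A n) =
    ∑ pq ∈ Finset.HasAntidiagonal.antidiagonal n, QB.incr A pq.1 ⊗ₜ[ℚ] QB.incr A pq.2 := by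
  classical
  rw [QB.incr, QB.sumOf, map_sum]
  simp only [QB.comul_of]
  rw [Finset.sum_comm]
  refine Finset.sum_congr rfl fun pq hpq => ?_
  obtain ⟨p, q⟩ := pq
  obtain rfl := Finset.HasAntidiagonal.mem_antidiagonal.1 hpq
  simp only
  rw [Finset.sum_filter, ← sum_times_mul_inv, QB.incr, QB.incr, QB.sumOf_eq_sum_ite,
    QB.sumOf_eq_sum_ite, TensorProduct.sum_tmul]
  refine Finset.sum_congr rfl fun u _ => ?_
  rw [TensorProduct.tmul_sum]
  refine Finset.sum_congr rfl fun v _ => ?_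
  have e := sum_shuffles_ite_strictMono A u v (QB.of u ⊗ₜ[ℚ] QB.of v)
  rw [Finset.sum_congr rfl fun ξ hξ => by
    rw [sum_ite_eq_times_mul_inv (fun u v => QB.of u ⊗ₜ[ℚ] QB.of v) u v hξ], e]
  split_ifs <;> simp

/-- The subalgebra generated by the sums of increasing signed permutations with signs in one
of the sets `g k`. -/
def incrSub {κ : Type} (g : κ → Set ℤˣ) : Submodule ℚ QB :=
  genSub QB.ops fun x : κ × ℕ => QB.incr (g x.1) x.2

theorem isGradedSubbialgebra_incrSub {κ : Type} (g : κ → Set ℤˣ) :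
    IsGradedSubbialgebra QB.ops (incrSub g) := by
  refine isGradedSubbialgebra_genSub QB.isConnectedGradedBialgebra
    (fun x => ⟨x.2, QB.sumOf_mem_grade _⟩) fun x => ?_
  rw [QB.comul_incr]
  refine Submodule.sum_mem _ fun pq _ => ?_
  exact tmul_mem_tensorSub
    (gen_mem_genSub (g := fun x : κ × ℕ => QB.incr (g x.1) x.2) QB.isConnectedGradedBialgebra
      (x.1, pq.1))
    (gen_mem_genSub (g := fun x : κ × ℕ => QB.incr (g x.1) x.2) QB.isConnectedGradedBialgebra
      (x.1, pq.2))

theorem QB.incr_eq_sumOf_isLocal (A : Set ℤˣ) (n : ℕ) {d : ℕ → Set ℤˣ} {c : ℕ → Prop}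
    (hd : ∀ i < n, d i = A) (hc : ∀ j, 1 ≤ j → j < n → c j) :
    QB.incr A n = QB.sumOf (IsLocal n d c fun _ => False) := by
  refine QB.sumOf_congr fun w => ?_
  rw [strictMono_val_iff]
  refine and_congr (forall_congr' fun i => by rw [hd i i.2]) (forall_congr' fun i =>
    forall_congr' fun j => forall_congr' fun hij => ?_)
  simp [hc j (by omega) j.2]

/-- Cut at the positions without a prescribed ascent. When none is left, every two neighbours share
the same index `k`, and the sum is a generator. -/
theorem QB.sumOf_isLocal_mem_incrSub {κ : Type} (g : κ → Set ℤˣ) (n : ℕ) (k : ℕ → κ)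
    (c : ℕ → Prop) (h : ∀ j, 1 ≤ j → j < n → c j → k (j - 1) = k j) :
    QB.sumOf (IsLocal n (fun i => g (k i)) c fun _ => False) ∈ incrSub g := by
  induction n using Nat.strong_induction_on generalizing k c with
  | _ n ih =>
    by_cases hp : ∃ p, 1 ≤ p ∧ p < n ∧ ¬ c p
    · obtain ⟨p, h1, hpn, hcp⟩ := hp
      obtain ⟨q, rfl⟩ := Nat.exists_eq_add_of_le hpn.le
      rw [← QB.mul_sumOf_isLocal hcp not_false]
      refine mul_mem_genSub QB.isConnectedGradedBialgebra ?_ ?_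
      · exact ih p hpn k c fun j hj hjp => h j hj (by omega)
      · refine ih q (by omega) (fun i => k (p + i)) (fun i => c (p + i)) fun j hj hjq hc => ?_
        have := h (p + j) (by omega) (by omega) hc
        rwa [Nat.add_sub_assoc hj] at this
    · push Not at hp
      have hk : ∀ i < n, k i = k 0 := by
        intro i hi
        induction i with
        | zero => rfl
        | succ i ihi =>
          rw [← ihi (by omega)]
          exact (h (i + 1) (by omega) hi (hp _ (by omega) hi)).symm
      rw [← QB.incr_eq_sumOf_isLocal (g (k 0)) n (fun i hi => by rw [hk i hi]) hp]
      exact gen_mem_genSub (g := fun x : κ × ℕ => QB.incr (g x.1) x.2)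
        QB.isConnectedGradedBialgebra (k 0, n)

/-- Inclusion-exclusion: the sum with a descent at `m` is the sum with no further condition there
minus the sum with an ascent there. -/
theorem QB.sumOf_isLocal_mem_incrSub' {κ : Type} (g : κ → Set ℤˣ) (n : ℕ) (k : ℕ → κ)
    (D : Finset ℕ) (c : ℕ → Prop)
    (h : ∀ j, 1 ≤ j → j < n → c j ∨ j ∈ D → k (j - 1) = k j) :
    QB.sumOf (IsLocal n (fun i => g (k i)) c fun j => j ∈ D) ∈ incrSub g := by
  induction D using Finset.induction_on generalizing c with
  | empty =>
    simp only [Finset.notMem_empty, or_false] at h ⊢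
    exact QB.sumOf_isLocal_mem_incrSub g n k c h
  | insert m D hm ih =>
    have e : QB.sumOf (IsLocal n (fun i => g (k i)) c fun j => j ∈ D) -
        QB.sumOf (IsLocal n (fun i => g (k i)) (fun j => c j ∨ (j = m ∧ 1 ≤ m ∧ m < n))
          fun j => j ∈ D) ∈ incrSub g := by
      refine Submodule.sub_mem _ (ih c fun j h1 h2 h3 => h j h1 h2 ?_)
        (ih _ fun j h1 h2 h3 => h j h1 h2 ?_)
      · exact h3.imp_right Finset.mem_insert_of_mem
      · rcases h3 with (h3 | ⟨rfl, -⟩) | h3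
        · exact Or.inl h3
        · exact Or.inr (Finset.mem_insert_self _ _)
        · exact Or.inr (Finset.mem_insert_of_mem h3)
    by_cases hmn : 1 ≤ m ∧ m < n
    · rw [QB.sumOf_sub_sumOf fun w hw => ⟨hw.1, fun i j hij =>
        ⟨fun hc => (hw.2 i j hij).1 (Or.inl hc), (hw.2 i j hij).2⟩⟩] at e
      refine (QB.sumOf_congr fun w => ?_) ▸ e
      constructor
      · rintro ⟨⟨h1, h2⟩, h3⟩
        refine ⟨h1, fun i j hij => ⟨(h2 i j hij).1, fun hj => ?_⟩⟩
        rcases Finset.mem_insert.1 hj with hj | hj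
        · by_contra hlt
          refine h3 ⟨h1, fun i' j' hij' => ⟨?_, (h2 i' j' hij').2⟩⟩
          rintro (hc | ⟨hj', -⟩)
          · exact (h2 i' j' hij').1 hc
          · obtain rfl : j = j' := Fin.ext (by omega)
            obtain rfl : i = i' := Fin.ext (by omega)
            exact lt_of_le_of_ne (not_lt.1 hlt)
              (w.val_injective.ne (Fin.ne_of_val_ne (by omega)))
        · exact (h2 i j hij).2 hj
      · rintro ⟨h1, h2⟩
        refine ⟨⟨h1, fun i j hij => ⟨(h2 i j hij).1, fun hj =>
          (h2 i j hij).2 (Finset.mem_insert_of_mem hj)⟩⟩, fun h3 => ?_⟩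
        have hij : ((⟨m, hmn.2⟩ : Fin n) : ℕ) = (⟨m - 1, by omega⟩ : Fin n) + 1 := by
          simp only; omega
        have a := (h2 _ _ hij).2 (Finset.mem_insert_self _ _)
        have b := (h3.2 _ _ hij).1 (Or.inr ⟨rfl, hmn⟩)
        exact lt_asymm a b
    -- Outside `1, …, n - 1` a prescribed descent is no condition.
    · refine (QB.sumOf_congr fun w => ?_) ▸ ih c fun j h1 h2 h3 =>
        h j h1 h2 (h3.imp_right Finset.mem_insert_of_mem)
      refine and_congr Iff.rfl (forall_congr' fun i => forall_congr' fun j =>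
        forall_congr' fun hij => and_congr Iff.rfl ?_)
      simp only [Finset.mem_insert]
      rw [or_iff_right]
      rintro rfl
      exact hmn ⟨by omega, j.2⟩

/-- A product of generators of `incrSub g` is a sum of signed permutations with prescribed
signs and ascents. -/
theorem exists_listMul_eq_sumOf_isLocal {κ : Type} (g : κ → Set ℤˣ) (L : List (κ × ℕ)) :
    ∃ (n : ℕ) (d : ℕ → Set ℤˣ) (c : ℕ → Prop), (∀ i < n, ∃ k, d i = g k) ∧
      listMul QB.ops (L.map fun x => QB.incr (g x.1) x.2) =
        QB.sumOf (IsLocal n d c fun _ => False) := by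
  induction L with
  | nil =>
    refine ⟨0, fun _ => ∅, fun _ => True, fun i hi => by omega, ?_⟩
    have : Subsingleton (SignedPerm 0) := (SignedPerm.equivProd 0).subsingleton
    have hu : (Finset.univ : Finset (SignedPerm 0)) = {1} :=
      Finset.eq_singleton_iff_unique_mem.2 ⟨Finset.mem_univ _, fun _ _ => Subsingleton.elim _ _⟩
    classical
    rw [QB.sumOf_eq_sum_ite, hu, Finset.sum_singleton, if_pos]
    · rfl
    · exact ⟨fun i => i.elim0, fun i => i.elim0⟩
  | cons x L ih =>
    obtain ⟨k, p⟩ := x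
    obtain ⟨q, d, c, hd, e⟩ := ih
    -- The position `j = p` satisfies neither alternative, so the new cut is left free.
    refine ⟨p + q, fun i => if i < p then g k else d (i - p), fun j => j < p ∨ (p < j ∧ c (j - p)),
      fun i hi => ?_, ?_⟩
    · by_cases hip : i < p
      · exact ⟨k, if_pos hip⟩
      · obtain ⟨l, hl⟩ := hd (i - p) (by omega)
        exact ⟨l, by simp only [if_neg hip, hl]⟩
    · rw [← QB.mul_sumOf_isLocal (by omega) not_false, List.map_cons, listMul, List.foldr_cons,
        ← QB.incr_eq_sumOf_isLocal (g k) p (fun i hi => if_pos hi) (fun j _ hj => Or.inl hj)]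
      refine congrArg (QB.ops.mul (QB.incr (g k) p)) (e.trans (QB.sumOf_congr fun w => ?_))
      refine and_congr (by simp) (forall_congr' fun i => forall_congr' fun j =>
        forall_congr' fun hij => and_congr (imp_congr_left ?_) Iff.rfl)
      have : 0 < (j : ℕ) := by omega
      simp [this]

/-! ### Compositions with prescribed cuts -/

section Compositions

variable {n : ℕ} (c : Composition n)

theorem Composition.index_eq_of_mem {j : Fin n} {i : Fin c.length} (h1 : c.sizeUpTo i ≤ j)
    (h2 : (j : ℕ) < c.sizeUpTo (i + 1)) : c.index j = i :=
  (c.mem_range_embedding_iff'.1 (c.mem_range_embedding_iff.2 ⟨h1, h2⟩)).symm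

theorem Composition.index_monotone : Monotone c.index := by
  intro j k hjk
  by_contra! h
  have h1 := c.monotone_sizeUpTo (Nat.succ_le_of_lt h)
  have h2 := c.lt_sizeUpTo_index_succ k
  have h3 := c.sizeUpTo_index_le j
  rw [Fin.le_def] at hjk
  simp only [Fin.val_succ, Nat.succ_eq_add_one] at h1 h2
  omega

theorem Composition.index_ne_iff {j k : Fin n} (hjk : (k : ℕ) = j + 1) :
    c.index j ≠ c.index k ↔ k.castSucc ∈ c.boundaries := by
  have hj1 := c.sizeUpTo_index_le j
  have hj2 := c.lt_sizeUpTo_index_succ j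
  have hk1 := c.sizeUpTo_index_le k
  have hk2 := c.lt_sizeUpTo_index_succ k
  simp only [Fin.val_succ] at hj2 hk2
  constructor
  · intro h
    have : c.sizeUpTo (c.index k) = k := by
      by_contra hne
      exact h (c.index_eq_of_mem (by omega) (by omega))
    simp only [Composition.boundaries, Finset.mem_map, Finset.mem_univ, true_and]
    exact ⟨(c.index k).castSucc, Fin.ext this⟩
  · intro h heq
    simp only [Composition.boundaries, Finset.mem_map, Finset.mem_univ, true_and] at h
    obtain ⟨m, hm⟩ := h
    have hm : c.sizeUpTo m = k := congrArg Fin.val hm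
    have : (c.index j : ℕ) < m := by
      by_contra! hle
      have := c.monotone_sizeUpTo hle
      omega
    have := c.monotone_sizeUpTo (Nat.succ_le_of_lt this)
    simp only [Nat.succ_eq_add_one] at this
    rw [heq] at this
    omega

theorem exists_composition_index_ne_iff (n : ℕ) (C : Fin n → Prop) :
    ∃ c : Composition n, ∀ j k : Fin n, (k : ℕ) = j + 1 → (c.index j ≠ c.index k ↔ C k) := by
  classical
  let s : CompositionAsSet n :=
    { boundaries := Finset.univ.filter fun b =>
        (b : ℕ) = 0 ∨ (b : ℕ) = n ∨ ∃ h : (b : ℕ) < n, C ⟨b, h⟩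
      zero_mem := by simp
      getLast_mem := by simp }
  refine ⟨s.toComposition, fun j k hjk => ?_⟩
  rw [Composition.index_ne_iff _ hjk, CompositionAsSet.toComposition_boundaries]
  have h1 : k.castSucc ≠ 0 := fun e => by
    have : (k : ℕ) = 0 := congrArg Fin.val e
    omega
  have h2 : (k : ℕ) ≠ n := by omega
  simp [s, h1, h2]

theorem Fin.forall_lt_of_forall_succ {n : ℕ} {r : Fin n → Fin n → Prop}
    (trans : ∀ i j k, i < j → j < k → (r i k → r i j) ∧ (r i k → r j k))
    {s : Fin n → Fin n → Prop} (strans : ∀ i j k, s i j → s j k → s i k)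
    (h : ∀ i j : Fin n, (j : ℕ) = i + 1 → r i j → s i j) {i j : Fin n} (hij : i < j)
    (hr : r i j) : s i j := by
  obtain ⟨i, hi⟩ := i
  obtain ⟨j, hj⟩ := j
  rw [Fin.mk_lt_mk] at hij
  revert hj
  induction j, hij using Nat.le_induction with
  | base => exact fun hj hr => h _ _ rfl hr
  | succ m hm ih =>
    intro hj hr
    have ht := trans ⟨i, hi⟩ ⟨m, by omega⟩ ⟨m + 1, hj⟩ hm (Nat.lt_succ_self m)
    exact strans _ ⟨m, by omega⟩ _ (ih (by omega) (ht.1 hr)) (h _ _ rfl (ht.2 hr))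

theorem Composition.forall_lt_of_forall_succ {s : Fin n → Fin n → Prop}
    (strans : ∀ i j k, s i j → s j k → s i k)
    (h : ∀ i j : Fin n, (j : ℕ) = i + 1 → c.index i = c.index j → s i j) {i j : Fin n}
    (hij : i < j) (hr : c.index i = c.index j) : s i j := by
  refine Fin.forall_lt_of_forall_succ (r := fun i j => c.index i = c.index j) ?_ strans h hij hr
  intro i j k hij hjk
  have h1 := c.index_monotone hij.le
  have h2 := c.index_monotone hjk.le
  exact ⟨fun h => le_antisymm h1 (h ▸ h2), fun h => le_antisymm h2 (h ▸ h1)⟩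

end Compositions

-- A sum over a property that depends only on `D` splits into sums over fibers of `D`. It is applied
-- to block data, descent sets and interior peak sets.
open Classical in
theorem sum_filter_mem_of_fibers {X Y M : Type} [Fintype X] [AddCommGroup M] [Module ℚ M]
    (D : X → Y) (b : X → M) (R : X → Prop) (K : Submodule ℚ M)
    (hR : ∀ x x', D x' = D x → R x → R x')
    (hK : ∀ x, R x → ∑ x' ∈ Finset.univ.filter (fun x' => D x' = D x), b x' ∈ K) :
    ∑ x ∈ Finset.univ.filter (fun x => R x), b x ∈ K := by
  rw [← Finset.sum_fiberwise_of_maps_to (g := D)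
    (t := (Finset.univ.filter fun x => R x).image D) fun x hx => Finset.mem_image_of_mem D hx]
  refine Submodule.sum_mem _ fun y hy => ?_
  obtain ⟨x, hx, rfl⟩ := Finset.mem_image.1 hy
  have hx' := (Finset.mem_filter.1 hx).2
  rw [Finset.filter_filter]
  convert hK x hx' using 2
  ext x'
  simp only [Finset.mem_filter, Finset.mem_univ, true_and, and_iff_right_iff_imp]
  exact fun h => hR x x' h hx'

/-! ### The algebra of Mantaci and Reutenauer -/

section MantaciReutenauer

open SignedPerm

variable {n : ℕ}

/-- The signs of a signed permutation, and the pairs of successive positions with equal signs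
at which the absolute values increase. -/
def SignedPerm.blockData (w : SignedPerm n) : (Fin n → ℤˣ) × (Fin n → Fin n → Prop) :=
  (w.sign, fun i j => (j : ℕ) = i + 1 ∧ w.sign i = w.sign j ∧ w.perm i < w.perm j)

theorem SignedPerm.blockData_eq_iff {w w' : SignedPerm n} : w.blockData = w'.blockData ↔
    w.sign = w'.sign ∧ ∀ i j : Fin n, (j : ℕ) = i + 1 → w.sign i = w.sign j →
      (w.perm i < w.perm j ↔ w'.perm i < w'.perm j) := by
  rw [blockData, blockData, Prod.ext_iff]
  refine and_congr_right fun hs => ?_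
  simp only at hs
  simp only [funext_iff, eq_iff_iff, hs]
  refine forall_congr' fun i => forall_congr' fun j => ?_
  constructor
  · intro h hij hsij
    simpa [hij, hsij] using h
  · intro h
    exact and_congr_right fun hij => and_congr_right fun hsij => h hij hsij

/-- Different signs decide the comparison alone; for equal signs it is the comparison of absolute
values, which the block data record. -/
theorem SignedPerm.val_lt_iff_of_blockData_eq {w w' : SignedPerm n}
    (h : w.blockData = w'.blockData) {i j : Fin n} (hij : (j : ℕ) = i + 1) :
    w.val i < w.val j ↔ w'.val i < w'.val j := by
  rw [blockData_eq_iff] at h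
  have hne : i ≠ j := fun e => by rw [e] at hij; omega
  by_cases hs : w.sign i = w.sign j
  · have hlt := h.2 i j hij hs
    have hgt : w.perm j < w.perm i ↔ w'.perm j < w'.perm i := by
      have e1 := w.perm.injective.ne hne
      have e2 := w'.perm.injective.ne hne
      rw [← not_iff_not, not_lt, not_lt, e1.le_iff_lt, e2.le_iff_lt, hlt]
    rw [val_lt_val_iff_of_sign_eq w hs, val_lt_val_iff_of_sign_eq w' (by rwa [← h.1]), h.1, hlt, hgt]
  · simp only [val, ← h.1]
    rcases Int.units_eq_one_or (w.sign i) with hi | hi <;>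
      rcases Int.units_eq_one_or (w.sign j) with hj | hj <;> simp_all <;> omega

theorem isLocal_of_blockData_eq {d : ℕ → Set ℤˣ} {c c' : ℕ → Prop} (w w' : SignedPerm n)
    (h : w'.blockData = w.blockData) (hw : IsLocal n d c c' w) : IsLocal n d c c' w' := by
  refine ⟨fun i => ?_, fun i j hij => ⟨fun hc => ?_, fun hc => ?_⟩⟩
  · rw [(blockData_eq_iff.1 h).1]
    exact hw.1 i
  · exact (val_lt_iff_of_blockData_eq h hij).2 ((hw.2 i j hij).1 hc)
  · have hne : i ≠ j := fun e => by rw [e] at hij; omega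
    have h1 := (hw.2 i j hij).2 hc
    refine lt_of_le_of_ne (not_lt.1 fun h2 => ?_) (w'.val_injective.ne hne.symm)
    exact lt_asymm h1 ((val_lt_iff_of_blockData_eq h hij).1 h2)

/-- Blocks are intervals, so increase inside them can be tested on neighbours, and maximality turns
the implication into an equivalence. -/
theorem inTClass_iff {c : Composition n} {ε : Fin c.length → ℤˣ} {w : SignedPerm n} :
    InTClass c ε w ↔ (∀ j, w.sign j = ε (c.index j)) ∧ ∀ j k : Fin n, (k : ℕ) = j + 1 →
      w.sign j = w.sign k → (w.perm j < w.perm k ↔ c.index j = c.index k) := by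
  constructor
  · rintro ⟨h1, h2, h3⟩
    refine ⟨h1, fun j k hjk hs => ⟨fun h => ?_, fun h => h2 j k h (by rw [Fin.lt_def]; omega)⟩⟩
    by_contra hne
    exact h3 j k hjk hne ⟨hs, h⟩
  · rintro ⟨h1, h2⟩
    refine ⟨h1, fun j k hi hjk => ?_, fun j k hjk hne h => hne ((h2 j k hjk h.1).1 h.2)⟩
    exact c.forall_lt_of_forall_succ (s := fun j k => w.perm j < w.perm k)
      (fun _ _ _ => lt_trans) (fun i j hij h => (h2 i j hij (by rw [h1, h1, h])).2 h) hjk hi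

/-- Cutting wherever the sign changes or the absolute value drops gives the blocks of `w`, so the
`T`-classes are the fibers of the block data. -/
theorem exists_inTClass_iff_blockData_eq (w : SignedPerm n) :
    ∃ (c : Composition n) (ε : Fin c.length → ℤˣ),
      ∀ w', InTClass c ε w' ↔ w'.blockData = w.blockData := by
  obtain ⟨c, hc⟩ := exists_composition_index_ne_iff n
    fun k => ∀ j : Fin n, (k : ℕ) = j + 1 → ¬ (w.sign j = w.sign k ∧ w.perm j < w.perm k)
  have hc' : ∀ j k : Fin n, (k : ℕ) = j + 1 →
      (c.index j = c.index k ↔ w.sign j = w.sign k ∧ w.perm j < w.perm k) := by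
    intro j k hjk
    rw [← not_iff_not, ← ne_eq, hc j k hjk]
    refine ⟨fun h => h j hjk, fun h i hi => ?_⟩
    obtain rfl : i = j := Fin.ext (by omega)
    exact h
  have hs : ∀ j k, c.index j = c.index k → w.sign j = w.sign k := by
    have key : ∀ j k, j < k → c.index j = c.index k → w.sign j = w.sign k := fun j k hjk h =>
      c.forall_lt_of_forall_succ (s := fun j k => w.sign j = w.sign k)
        (fun _ _ _ => Eq.trans) (fun i j hij h => ((hc' i j hij).1 h).1) hjk h
    intro j k h
    rcases lt_trichotomy j k with hjk | rfl | hjk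
    · exact key j k hjk h
    · rfl
    · exact (key k j hjk h.symm).symm
  -- The sign is read at the first position of each block.
  let ε : Fin c.length → ℤˣ := fun i => w.sign (c.embedding i ⟨0, c.one_le_blocksFun i⟩)
  have hε : ∀ j, w.sign j = ε (c.index j) := fun j => hs _ _ (c.index_embedding _ _).symm
  refine ⟨c, ε, fun w' => ?_⟩
  rw [inTClass_iff, blockData_eq_iff, funext_iff]
  rw [show (∀ j, w'.sign j = ε (c.index j)) ↔ ∀ j, w'.sign j = w.sign j from
    forall_congr' fun j => by rw [hε j]]
  refine and_congr_right fun hs' => forall_congr' fun j => forall_congr' fun k =>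
    forall_congr' fun hjk => imp_congr_right fun h => ?_
  rw [hc' j k hjk]
  rw [hs', hs'] at h
  simp [h]

theorem TB_eq_sumOf (c : Composition n) (ε : Fin c.length → ℤˣ) :
    TB c ε = QB.sumOf (InTClass c ε) := rfl

theorem sumOf_isLocal_mem_omegaB (d : ℕ → Set ℤˣ) (c c' : ℕ → Prop) :
    QB.sumOf (IsLocal n d c c') ∈ omegaB n := by
  refine sum_filter_mem_of_fibers SignedPerm.blockData QB.of _ _ isLocal_of_blockData_eq
    fun w _ => ?_
  obtain ⟨c, ε, h⟩ := exists_inTClass_iff_blockData_eq w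
  refine Submodule.subset_span ⟨c, ε, ?_⟩
  rw [TB]
  congr 1
  ext w'
  simp [h]

/-- At neighbours of equal sign an increase of the absolute value is an ascent for sign `1` and a
descent for sign `-1`. So `T_α` prescribes ascent or descent at all such neighbours and nothing at
the others. -/
theorem TB_mem_incrSub (c : Composition n) (ε : Fin c.length → ℤˣ) :
    TB c ε ∈ incrSub fun ε : ℤˣ => {ε} := by
  classical
  let k : ℕ → ℤˣ := fun i => if h : i < n then ε (c.index ⟨i, h⟩) else 1
  have hk : ∀ i : Fin n, k i = ε (c.index i) := fun i => by simp [k]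
  -- `C true` marks the ascents (same block and positive, or a cut and negative), `C false` the
  -- descents.
  let C : Bool → ℕ → Prop := fun b j => ∃ i l : Fin n, (l : ℕ) = i + 1 ∧ (l : ℕ) = j ∧ k i = k l ∧
    (b ↔ (c.index i = c.index l ↔ k l = 1))
  let D : Finset ℕ := (Finset.range n).filter (C false)
  have hD : ∀ j : Fin n, (j : ℕ) ∈ D ↔ C false j := fun j => by simp [D]
  have hC : ∀ (b : Bool) (i j : Fin n), (j : ℕ) = i + 1 → (C b j ↔ k i = k j ∧
    (b ↔ (c.index i = c.index j ↔ k j = 1))) := by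
    intro b i j hij
    refine ⟨fun ⟨i', l, h1, h2, h3⟩ => ?_, fun h => ⟨i, j, hij, rfl, h⟩⟩
    obtain rfl : l = j := Fin.ext h2
    obtain rfl : i = i' := Fin.ext (by omega)
    exact h3
  have hCk : ∀ b j, C b j → k (j - 1) = k j := by
    rintro b j ⟨i, l, h1, rfl, h2, -⟩
    rw [h1, Nat.add_sub_cancel, ← h1, h2]
  have hmem := QB.sumOf_isLocal_mem_incrSub' (fun ε : ℤˣ => {ε}) n k D (C true) fun j _ _ h =>
    h.elim (hCk true j) fun h => hCk false j (Finset.mem_filter.1 h).2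
  rw [TB_eq_sumOf]
  refine (QB.sumOf_congr (Q := InTClass c ε) fun w => ?_) ▸ hmem
  rw [inTClass_iff, IsLocal]
  simp only [Set.mem_singleton_iff, hk]
  refine and_congr_right fun hs => forall_congr' fun i => forall_congr' fun j =>
    forall_congr' fun hij => ?_
  have hne : i ≠ j := fun e => by rw [e] at hij; omega
  rw [hD, hC _ _ _ hij, hC _ _ _ hij, hk, hk, ← hs, ← hs]
  by_cases hsij : w.sign i = w.sign j
  · have e1 := val_lt_val_iff_of_sign_eq w hsij
    have e2 : w.val j < w.val i ↔ ¬ w.val i < w.val j := by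
      rw [not_lt, (w.val_injective.ne hne).symm.le_iff_lt]
    have e3 : w.perm j < w.perm i ↔ ¬ w.perm i < w.perm j := by
      rw [not_lt, (w.perm.injective.ne hne).symm.le_iff_lt]
    rw [e2, e1, e3]
    by_cases h1 : w.sign j = 1 <;> by_cases h2 : c.index i = c.index j <;>
      by_cases h3 : w.perm i < w.perm j <;> simp [h1, h2, h3, hsij]
  · simp [hsij]

theorem incrSub_le_OmegaB {κ : Type} (g : κ → Set ℤˣ) : incrSub g ≤ OmegaB := by
  refine Submodule.span_le.2 ?_
  rintro _ ⟨L, rfl⟩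
  obtain ⟨n, d, c, -, h⟩ := exists_listMul_eq_sumOf_isLocal g L
  rw [SetLike.mem_coe]
  simp only [h]
  exact Submodule.mem_iSup_of_mem n (sumOf_isLocal_mem_omegaB _ _ _)

theorem OmegaB_eq_incrSub : OmegaB = incrSub fun ε : ℤˣ => {ε} := by
  refine le_antisymm (iSup_le fun n => Submodule.span_le.2 ?_) (incrSub_le_OmegaB _)
  rintro _ ⟨c, ε, rfl⟩
  exact TB_mem_incrSub c ε

end MantaciReutenauer

/-! ### The canonical ideal -/

section CanonicalIdeal

open SignedPerm

variable {n : ℕ}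

/-- On sets avoiding `0` the shift `J ↦ J - 1` is injective, so `β` sends the corresponding basis
elements to distinct basis elements and no cancellation occurs. -/
theorem mem_ker_betaMap_iff (x : solB (n + 1)) : x ∈ LinearMap.ker (betaMap n) ↔
    ∀ J : Finset (Fin (n + 1)), (0 : Fin (n + 1)) ∉ J → (basisXB (n + 1)).repr x J = 0 := by
  have hcoord : ∀ J : Finset (Fin (n + 1)), (0 : Fin (n + 1)) ∉ J →
      (basisXB n).coord (Finset.univ.filter fun k => k.succ ∈ J) ∘ₗ betaMap n =
        (basisXB (n + 1)).coord J := by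
    intro J hJ
    refine (basisXB (n + 1)).ext fun K => ?_
    rw [LinearMap.comp_apply, betaMap, Module.Basis.constr_basis]
    by_cases hK : (0 : Fin (n + 1)) ∈ K
    · have : K ≠ J := fun h => hJ (h ▸ hK)
      simp [hK, this]
    · by_cases hKJ : K = J
      · subst hKJ; simp [hK]
      · have : (Finset.univ.filter fun k : Fin n => k.succ ∈ K) ≠
            Finset.univ.filter fun k : Fin n => k.succ ∈ J := by
          refine fun h => hKJ (Finset.ext fun i => ?_)
          refine Fin.cases (by simp [hK, hJ]) (fun i => ?_) i
          simpa using Finset.ext_iff.1 h i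
        simp [hK, hKJ, this]
  constructor
  · intro hx J hJ
    have := LinearMap.congr_fun (hcoord J hJ) x
    rw [LinearMap.comp_apply, LinearMap.mem_ker.1 hx, map_zero] at this
    exact this.symm
  · intro h
    rw [LinearMap.mem_ker, ← (basisXB (n + 1)).sum_repr x, map_sum]
    refine Finset.sum_eq_zero fun J _ => ?_
    rw [map_smul, betaMap, Module.Basis.constr_basis]
    by_cases hJ : (0 : Fin (n + 1)) ∈ J
    · simp [hJ]
    · simp [h J hJ]

theorem canonicalIdeal_succ (n : ℕ) : canonicalIdeal (n + 1) =
    Submodule.span ℚ {x | ∃ J : Finset (Fin (n + 1)), (0 : Fin (n + 1)) ∈ J ∧ x = XB J} := by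
  apply le_antisymm
  · rintro _ ⟨x, hx, rfl⟩
    rw [SetLike.mem_coe, mem_ker_betaMap_iff] at hx
    rw [← (basisXB (n + 1)).sum_repr x, map_sum]
    refine Submodule.sum_mem _ fun J _ => ?_
    by_cases hJ : (0 : Fin (n + 1)) ∈ J
    · rw [map_smul, Submodule.subtype_apply, basisXB_apply]
      exact Submodule.smul_mem _ _ (Submodule.subset_span ⟨J, hJ, rfl⟩)
    · simp [hx J hJ]
  · refine Submodule.span_le.2 ?_
    rintro _ ⟨J, hJ, rfl⟩
    refine ⟨basisXB (n + 1) J, ?_, basisXB_apply J⟩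
    rw [SetLike.mem_coe, LinearMap.mem_ker, betaMap, Module.Basis.constr_basis, if_pos hJ]

theorem SignedPerm.entry_succ (w : SignedPerm n) (i : Fin n) : w.entry (i + 1) = w.val i := by
  simp [entry, val]

theorem XB_eq_sumOf (J : Finset (Fin n)) : XB J = QB.sumOf fun w : SignedPerm n => w.Des ⊆ J := by
  classical
  rw [QB.sumOf_eq_sum_filter]
  refine Eq.trans (Finset.sum_congr rfl fun I hI => ?_)
    (Finset.sum_fiberwise_of_maps_to (g := SignedPerm.Des) (t := J.powerset) ?_ QB.of)
  swap
  · intro w hw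
    rw [Finset.mem_filter] at hw
    exact Finset.mem_powerset.2 hw.2
  rw [YB, Finset.filter_filter]
  congr 1
  ext w
  simp only [Finset.mem_filter, Finset.mem_univ, true_and, iff_and_self]
  rintro rfl
  exact Finset.mem_powerset.1 hI

/-- When `0 ∈ J` the sign of the first letter is free, and only ascents at the positions outside `J`
are imposed. -/
theorem XB_eq_sumOf_isLocal {J : Finset (Fin (n + 1))} (hJ : (0 : Fin (n + 1)) ∈ J)
    {d : ℕ → Set ℤˣ} (hd : ∀ i < n + 1, d i = Set.univ) {c : ℕ → Prop}
    (hc : ∀ j : Fin (n + 1), 1 ≤ (j : ℕ) → (c j ↔ j ∉ J)) :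
    XB J = QB.sumOf (IsLocal (n + 1) d c fun _ => False) := by
  rw [XB_eq_sumOf]
  refine QB.sumOf_congr fun w => ⟨fun h => ⟨fun i => by simp [hd i i.2], fun i j hij =>
    ⟨fun hcj => ?_, False.elim⟩⟩, fun h j hj => ?_⟩
  · have hjJ := (hc j (by omega)).1 hcj
    have hne : i ≠ j := fun e => by rw [e] at hij; omega
    have hj : ¬ w.entry (j + 1) < w.entry j := fun hlt => hjJ (h (by simpa [Des] using hlt))
    rw [entry_succ, hij, entry_succ, not_lt] at hj
    exact lt_of_le_of_ne hj (w.val_injective.ne hne)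
  · by_contra hjJ
    have hj0 : (j : ℕ) ≠ 0 := fun e => hjJ (by rwa [show j = 0 from Fin.ext e])
    have hij : (j : ℕ) = (⟨j - 1, by omega⟩ : Fin (n + 1)) + 1 := by simp only; omega
    have h1 := (h.2 _ j hij).1 ((hc j (by omega)).2 hjJ)
    have h2 : w.entry (j + 1) < w.entry j := by simpa [Des] using hj
    rw [entry_succ, hij, entry_succ] at h2
    exact lt_asymm h1 h2

theorem CanonicalI_eq_incrSub : CanonicalI = incrSub fun _ : Unit => Set.univ := by
  classical
  refine le_antisymm (iSup_le fun n => ?_) (Submodule.span_le.2 ?_)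
  · cases n with
    | zero =>
      refine (Submodule.span_singleton_le_iff_mem _ _).2 ?_
      exact one_mem_genSub (H := QB.ops)
    | succ n =>
      rw [canonicalIdeal_succ]
      refine Submodule.span_le.2 ?_
      rintro _ ⟨J, hJ, rfl⟩
      rw [XB_eq_sumOf_isLocal hJ (d := fun _ => Set.univ)
        (c := fun j => ∃ h : j < n + 1, (⟨j, h⟩ : Fin (n + 1)) ∉ J) (fun _ _ => rfl)
        fun j _ => ⟨fun ⟨_, h⟩ => h, fun h => ⟨j.2, h⟩⟩]
      exact QB.sumOf_isLocal_mem_incrSub (fun _ : Unit => Set.univ) (n + 1) (fun _ => ()) _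
        fun _ _ _ _ => rfl
  · rintro _ ⟨L, rfl⟩
    obtain ⟨n, d, c, hd, h⟩ := exists_listMul_eq_sumOf_isLocal (fun _ : Unit => Set.univ) L
    rw [SetLike.mem_coe]
    simp only [h]
    refine Submodule.mem_iSup_of_mem n ?_
    cases n with
    | zero =>
      have := QB.isConnectedGradedBialgebra.grade_zero_le (QB.sumOf_mem_grade (IsLocal 0 d c fun _ => False))
      exact this
    | succ n =>
      rw [canonicalIdeal_succ]
      -- `J` consists of the free cuts together with `0`.
      refine Submodule.subset_span ⟨Finset.univ.filter fun j => (j : ℕ) = 0 ∨ ¬ c j, by simp, ?_⟩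
      refine (XB_eq_sumOf_isLocal (by simp) (fun i hi => (hd i hi).elim fun _ h => h) ?_).symm
      intro j hj
      have : j ≠ 0 := fun e => by rw [e] at hj; simp at hj
      simp [this]

theorem CanonicalI_le_OmegaB : CanonicalI ≤ OmegaB := by
  rw [CanonicalI_eq_incrSub]
  exact incrSub_le_OmegaB _

end CanonicalIdeal

/-! ### Noncommutative symmetric functions as an image of the algebra of Mantaci and Reutenauer -/

section Forget

open SignedPerm

variable {n p q : ℕ}

open Classical in
/-- The sum of the permutations with property `P`. -/
def QS.sumOf {n : ℕ} (P : Equiv.Perm (Fin n) → Prop) : QS :=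
  ∑ w ∈ Finset.univ.filter (fun w : Equiv.Perm (Fin n) => P w), QS.of w

theorem QS.sumOf_eq_sum_filter (P : Equiv.Perm (Fin n) → Prop) [DecidablePred P] :
    QS.sumOf P = ∑ w ∈ Finset.univ.filter fun w => P w, QS.of w := by
  rw [QS.sumOf]
  congr

theorem QS.sumOf_eq_sum_ite (P : Equiv.Perm (Fin n) → Prop) [DecidablePred P] :
    QS.sumOf P = ∑ w, if P w then QS.of w else 0 := by
  rw [QS.sumOf_eq_sum_filter, Finset.sum_filter]

theorem QS.sumOf_congr {P Q : Equiv.Perm (Fin n) → Prop} (h : ∀ w, P w ↔ Q w) :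
    QS.sumOf P = QS.sumOf Q := by
  rw [show P = Q from funext fun w => propext (h w)]

theorem QS.mul_sumOf {P : Equiv.Perm (Fin p) → Prop} {Q : Equiv.Perm (Fin q) → Prop}
    {R : Equiv.Perm (Fin (p + q)) → Prop}
    (h : ∀ ξ ∈ shuffles p q, ∀ u v, R (ξ * permTimes u v) ↔ P u ∧ Q v) :
    QS.ops.mul (QS.sumOf P) (QS.sumOf Q) = QS.sumOf R := by
  classical
  rw [QS.sumOf_eq_sum_ite, QS.sumOf_eq_sum_ite, QS.sumOf_eq_sum_ite,
    ← sum_shuffle_mul_permTimes, LinearMap.map_sum₂]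
  refine Finset.sum_congr rfl fun u _ => ?_
  rw [map_sum]
  refine Finset.sum_congr rfl fun v _ => ?_
  by_cases hu : P u
  · by_cases hv : Q v
    · rw [if_pos hu, if_pos hv, QS.mul_of]
      exact Finset.sum_congr rfl fun ξ hξ => (if_pos ((h ξ hξ u v).2 ⟨hu, hv⟩)).symm
    · rw [if_neg hv, map_zero]
      exact (Finset.sum_eq_zero fun ξ hξ => if_neg fun hR => hv ((h ξ hξ u v).1 hR).2).symm
  · rw [if_neg hu, map_zero, LinearMap.zero_apply]
    exact (Finset.sum_eq_zero fun ξ hξ => if_neg fun hR => hu ((h ξ hξ u v).1 hR).1).symm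

theorem forgetSigns_sumOf (P : SignedPerm n → Prop)
    [∀ σ : Equiv.Perm (Fin n), DecidablePred fun s : Fin n → ℤˣ => P ⟨σ, s⟩] :
    forgetSigns (QB.sumOf P) = ∑ σ : Equiv.Perm (Fin n),
      (Finset.univ.filter fun s : Fin n → ℤˣ => P ⟨σ, s⟩).card • QS.of σ := by
  classical
  rw [QB.sumOf_eq_sum_ite, map_sum, ← (SignedPerm.equivProd n).symm.sum_comp,
    Fintype.sum_prod_type]
  refine Finset.sum_congr rfl fun σ _ => ?_
  rw [← Finset.sum_const, Finset.sum_filter]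
  refine Finset.sum_congr rfl fun s _ => ?_
  change forgetSigns (if P ⟨σ, s⟩ then QB.of ⟨σ, s⟩ else 0) = _
  split_ifs <;> simp

theorem forgetSigns_sumOf_of_sign_eq {P : SignedPerm n → Prop} (s : Fin n → ℤˣ)
    (h : ∀ w, P w → w.sign = s) :
    forgetSigns (QB.sumOf P) = QS.sumOf fun σ => P ⟨σ, s⟩ := by
  classical
  rw [forgetSigns_sumOf, QS.sumOf_eq_sum_ite]
  refine Finset.sum_congr rfl fun σ _ => ?_
  by_cases hP : P ⟨σ, s⟩
  · rw [if_pos hP, (Finset.card_eq_one (s := Finset.univ.filter fun s => P ⟨σ, s⟩)).2 ⟨s, ?_⟩,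
      one_smul]
    ext s'
    simp only [Finset.mem_filter, Finset.mem_univ, true_and, Finset.mem_singleton]
    exact ⟨fun hs => h _ hs, fun e => e ▸ hP⟩
  · rw [if_neg hP, Finset.filter_false_of_mem, Finset.card_empty, zero_smul]
    intro s' _ hs
    obtain rfl : s' = s := h _ hs
    exact hP hs

theorem permEntry_succ (w : Equiv.Perm (Fin n)) (i : Fin n) :
    permEntry w (i + 1) = (w i : ℕ) + 1 := by
  simp [permEntry]

theorem mem_desA_iff (w : Equiv.Perm (Fin n)) {i j : Fin n} (hij : (j : ℕ) = i + 1) :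
    j ∈ desA w ↔ w j < w i := by
  simp only [desA, Finset.mem_filter, Finset.mem_univ, true_and]
  rw [permEntry_succ, hij, permEntry_succ, Fin.lt_def]
  omega

theorem one_le_of_mem_desA {w : Equiv.Perm (Fin n)} {j : Fin n} (h : j ∈ desA w) :
    1 ≤ (j : ℕ) := (Finset.mem_filter.1 h).2.1

theorem notMem_desA_iff (w : Equiv.Perm (Fin n)) {i j : Fin n} (hij : (j : ℕ) = i + 1) :
    j ∉ desA w ↔ w i < w j := by
  have hne : i ≠ j := fun e => by rw [e] at hij; omega
  rw [mem_desA_iff w hij, not_lt, (w.injective.ne hne).le_iff_lt]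

/-- The signs being fixed, distinct members of the class have distinct images, and what remains of
the condition depends only on the descent set. -/
theorem forgetSigns_TB_mem_solA (c : Composition n) (ε : Fin c.length → ℤˣ) :
    forgetSigns (TB c ε) ∈ solA n := by
  rw [TB_eq_sumOf, forgetSigns_sumOf_of_sign_eq (fun j => ε (c.index j))
    fun w hw => funext hw.1]
  refine sum_filter_mem_of_fibers desA QS.of _ _ (fun w w' h hw => ?_) fun w _ => ?_
  · rw [inTClass_iff] at hw ⊢
    refine ⟨hw.1, fun j k hjk hs => ?_⟩
    rw [← hw.2 j k hjk hs]
    simp only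
    rw [← notMem_desA_iff w' hjk, ← notMem_desA_iff w hjk, h]
  · refine Submodule.subset_span ⟨desA w, fun i hi => one_le_of_mem_desA hi, ?_⟩
    rw [YA]
    congr

/-- Lifts `Y_J` to signed permutations with all signs positive, where it becomes a local sum and
hence lies in `Ω(B)`. -/
theorem YA_eq_forgetSigns {J : Finset (Fin n)} (hJ : ∀ i ∈ J, 1 ≤ (i : ℕ)) :
    YA J = forgetSigns (QB.sumOf (IsLocal n (fun _ => {1}) (fun j => ∃ h : j < n, ⟨j, h⟩ ∉ J)
      fun j => ∃ h : j < n, ⟨j, h⟩ ∈ J)) := by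
  classical
  rw [forgetSigns_sumOf_of_sign_eq (fun _ => 1) fun w hw => funext hw.1,
    YA, ← QS.sumOf_eq_sum_filter]
  refine QS.sumOf_congr fun w => ?_
  have hval : ∀ i j, SignedPerm.val ⟨w, fun _ => 1⟩ i < SignedPerm.val ⟨w, fun _ => 1⟩ j ↔
      w i < w j := fun i j => by simp [SignedPerm.val]
  constructor
  · rintro rfl
    refine ⟨fun _ => rfl, fun i j hij => ?_⟩
    rw [hval, hval]
    exact ⟨fun ⟨_, h⟩ => (notMem_desA_iff w hij).1 h, fun ⟨_, h⟩ => (mem_desA_iff w hij).1 h⟩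
  · rintro ⟨-, h⟩
    ext j
    rcases Nat.eq_zero_or_pos (j : ℕ) with hj | hj
    · refine iff_of_false (fun h => ?_) (fun h => ?_)
      · have := one_le_of_mem_desA h; omega
      · have := hJ j h; omega
    · have hij : (j : ℕ) = (⟨j - 1, by omega⟩ : Fin n) + 1 := by simp only; omega
      have := h _ j hij
      rw [hval, hval] at this
      by_cases hjJ : j ∈ J
      · exact iff_of_true ((mem_desA_iff w hij).2 (this.2 ⟨j.2, hjJ⟩)) hjJ
      · exact iff_of_false ((notMem_desA_iff w hij).2 (this.1 ⟨j.2, hjJ⟩)) hjJ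

theorem map_forgetSigns_OmegaB : OmegaB.map forgetSigns = SigmaA := by
  apply le_antisymm
  · rw [OmegaB, Submodule.map_iSup]
    refine iSup_mono fun n => ?_
    rw [omegaB, Submodule.map_span, Submodule.span_le]
    rintro _ ⟨_, ⟨c, ε, rfl⟩, rfl⟩
    exact forgetSigns_TB_mem_solA c ε
  · refine iSup_le fun n => Submodule.span_le.2 ?_
    rintro _ ⟨J, hJ, rfl⟩
    rw [YA_eq_forgetSigns hJ]
    exact Submodule.mem_map_of_mem (Submodule.mem_iSup_of_mem n (sumOf_isLocal_mem_omegaB _ _ _))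

end Forget

/-! ### The peak ideal -/

section Peaks

open SignedPerm

variable {n p q : ℕ}

/-- The permutations without interior peaks inside the blocks of `[n]` cut before the positions
with property `C`. -/
def NoPeakInBlocks (n : ℕ) (C : ℕ → Prop) (w : Equiv.Perm (Fin n)) : Prop :=
  ∀ i j k : Fin n, (j : ℕ) = i + 1 → (k : ℕ) = j + 1 → ¬ C j → ¬ C k → ¬ (w i < w j ∧ w k < w j)

theorem shuffle_castAdd_lt {ξ : Equiv.Perm (Fin (p + q))} (hξ : ξ ∈ shuffles p q)
    (u : Equiv.Perm (Fin p)) (v : Equiv.Perm (Fin q)) (i j : Fin p) :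
    (ξ * permTimes u v) (Fin.castAdd q i) < (ξ * permTimes u v) (Fin.castAdd q j) ↔ u i < u j := by
  simpa using (mem_shuffles.1 hξ).1.lt_iff_lt (a := u i) (b := u j)

theorem shuffle_natAdd_lt {ξ : Equiv.Perm (Fin (p + q))} (hξ : ξ ∈ shuffles p q)
    (u : Equiv.Perm (Fin p)) (v : Equiv.Perm (Fin q)) (i j : Fin q) :
    (ξ * permTimes u v) (Fin.natAdd p i) < (ξ * permTimes u v) (Fin.natAdd p j) ↔ v i < v j := by
  simpa using (mem_shuffles.1 hξ).2.lt_iff_lt (a := v i) (b := v j)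

/-- A triple of neighbours that does not straddle the cut lies in one block; a straddling triple has
its second or third position at `p`, where `C` holds, so it is exempt. -/
theorem QS.mul_sumOf_noPeakInBlocks {C : ℕ → Prop} (hC : C p) :
    QS.ops.mul (QS.sumOf (NoPeakInBlocks p C))
      (QS.sumOf (NoPeakInBlocks q fun i => C (p + i))) =
      QS.sumOf (NoPeakInBlocks (p + q) C) := by
  refine QS.mul_sumOf fun ξ hξ u v => ⟨fun h => ⟨fun i j k hij hjk hj hk => ?_,
    fun i j k hij hjk hj hk => ?_⟩, fun h i j k hij hjk hj hk => ?_⟩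
  · have := h (Fin.castAdd q i) (Fin.castAdd q j) (Fin.castAdd q k) hij hjk hj hk
    rwa [shuffle_castAdd_lt hξ, shuffle_castAdd_lt hξ] at this
  · have := h (Fin.natAdd p i) (Fin.natAdd p j) (Fin.natAdd p k) (by simp; omega)
      (by simp; omega) hj hk
    rwa [shuffle_natAdd_lt hξ, shuffle_natAdd_lt hξ] at this
  · have hj' : (j : ℕ) ≠ p := fun e => hj (by rw [e]; exact hC)
    have hk' : (k : ℕ) ≠ p := fun e => hk (by rw [e]; exact hC)
    by_cases hkp : (k : ℕ) < p
    · obtain ⟨i, rfl⟩ : ∃ i', Fin.castAdd q i' = i := ⟨⟨i, by omega⟩, rfl⟩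
      obtain ⟨j, rfl⟩ : ∃ j', Fin.castAdd q j' = j := ⟨⟨j, by omega⟩, rfl⟩
      obtain ⟨k, rfl⟩ : ∃ k', Fin.castAdd q k' = k := ⟨⟨k, by omega⟩, rfl⟩
      rw [shuffle_castAdd_lt hξ, shuffle_castAdd_lt hξ]
      exact h.1 i j k hij hjk hj hk
    · have key : ∀ i : Fin (p + q), p ≤ (i : ℕ) → ∃ i', Fin.natAdd p i' = i := fun i hi =>
        ⟨⟨i - p, by omega⟩, Fin.ext (by simp; omega)⟩
      obtain ⟨i, rfl⟩ := key i (by omega)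
      obtain ⟨j, rfl⟩ := key j (by omega)
      obtain ⟨k, rfl⟩ := key k (by omega)
      rw [shuffle_natAdd_lt hξ, shuffle_natAdd_lt hξ]
      exact h.2 i j k (by simp at hij; omega) (by simp at hjk; omega) hj hk

/-- Elements of `intPeak` count positions from `1`: the element `k` is a peak at the position `j = k
- 1` counted from `0`. -/
theorem mem_intPeak_iff (w : Equiv.Perm (Fin n)) {i j k : Fin n} (hij : (j : ℕ) = i + 1)
    (hjk : (k : ℕ) = j + 1) : k ∈ intPeak w ↔ w i < w j ∧ w k < w j := by
  simp only [intPeak, Finset.mem_filter, Finset.mem_univ, true_and]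
  rw [permEntry_succ, hjk, permEntry_succ, Nat.add_sub_cancel, hij, permEntry_succ, Fin.lt_def,
    Fin.lt_def]
  omega

theorem two_le_of_mem_intPeak {w : Equiv.Perm (Fin n)} {k : Fin n} (h : k ∈ intPeak w) :
    2 ≤ (k : ℕ) := (Finset.mem_filter.1 h).2.1

theorem noPeakInBlocks_iff (C : ℕ → Prop) (w : Equiv.Perm (Fin n)) :
    NoPeakInBlocks n C w ↔ ∀ k ∈ intPeak w, C (k - 1) ∨ C k := by
  constructor
  · intro h k hk
    have h2 := two_le_of_mem_intPeak hk
    by_contra! hC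
    have hij : ((⟨k - 1, by omega⟩ : Fin n) : ℕ) = (⟨k - 2, by omega⟩ : Fin n) + 1 := by
      simp only; omega
    have hjk : (k : ℕ) = (⟨k - 1, by omega⟩ : Fin n) + 1 := by simp only; omega
    exact h _ _ k hij hjk hC.1 hC.2 ((mem_intPeak_iff w hij hjk).1 hk)
  · intro h i j k hij hjk hj hk hw
    have := h k ((mem_intPeak_iff w hij hjk).2 hw)
    rw [show (k : ℕ) - 1 = j by omega] at this
    exact this.elim hj hk

theorem isIntPeakSet_intPeak (w : Equiv.Perm (Fin n)) : IsIntPeakSet (intPeak w) := by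
  refine ⟨fun i hi => two_le_of_mem_intPeak hi, fun k hk l hl hkl => ?_⟩
  have h2 := two_le_of_mem_intPeak hk
  have hij : ((⟨k - 1, by omega⟩ : Fin n) : ℕ) = (⟨k - 2, by omega⟩ : Fin n) + 1 := by
    simp only; omega
  have hjk : (k : ℕ) = (⟨k - 1, by omega⟩ : Fin n) + 1 := by simp only; omega
  exact lt_asymm ((mem_intPeak_iff w hij hjk).1 hk).2 ((mem_intPeak_iff w hjk hkl).1 hl).1

theorem intPeakSum_eq_sumOf (F : Finset (Fin n)) :
    intPeakSum F = QS.sumOf fun w => intPeak w = F :=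
  (QS.sumOf_eq_sum_filter _).symm

theorem sumOf_noPeakInBlocks_mem_peakIdeal (C : ℕ → Prop) :
    QS.sumOf (NoPeakInBlocks n C) ∈ peakIdeal n := by
  refine sum_filter_mem_of_fibers intPeak QS.of _ _ (fun w w' h hw => ?_) fun w _ => ?_
  · rw [noPeakInBlocks_iff] at hw ⊢
    rwa [h]
  · refine Submodule.subset_span ⟨intPeak w, isIntPeakSet_intPeak w, ?_⟩
    rw [intPeakSum]
    congr

/-- The weight that makes the change of basis triangular. Moving each `k ∈ G` outside `F` to `k - 1
∈ F` is injective, as `G` has no consecutive elements, and raises the weight; if nothing moves, `G`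
is a proper subset of `F`. -/
theorem sum_sub_lt_of_subset_union {F G : Finset (Fin n)} (hG : IsIntPeakSet G)
    (h : ∀ k ∈ G, (∃ l ∈ F, (l : ℕ) = k - 1) ∨ k ∈ F) (hne : G ≠ F) :
    ∑ k ∈ G, (n - (k : ℕ)) < ∑ k ∈ F, (n - (k : ℕ)) := by
  by_cases hGF : G ⊆ F
  · obtain ⟨k, hkF, hkG⟩ := Finset.exists_of_ssubset (hGF.ssubset_of_ne hne)
    exact Finset.sum_lt_sum_of_subset hGF hkF hkG (by omega) fun _ _ _ => Nat.zero_le _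
  · let φ : Fin n → Fin n := fun k => if k ∈ F then k else ⟨k - 1, by omega⟩
    have hφ : ∀ k, k ∉ F → ((φ k : Fin n) : ℕ) = k - 1 := fun k hk => by simp [φ, hk]
    have hφ' : ∀ k, k ∈ F → φ k = k := fun k hk => by simp [φ, hk]
    have hmap : ∀ k ∈ G, φ k ∈ F := by
      intro k hk
      by_cases hkF : k ∈ F
      · rwa [hφ' k hkF]
      · obtain ⟨l, hl, e⟩ := (h k hk).resolve_right hkF
        rwa [show φ k = l from Fin.ext (by rw [hφ k hkF, e])]
    have hinj : Set.InjOn φ G := by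
      intro k hk l hl e
      have e' := congrArg Fin.val e
      have h1 := hG.1 k hk
      have h2 := hG.1 l hl
      have h3 := hG.2 k hk l hl
      have h4 := hG.2 l hl k hk
      by_cases hkF : k ∈ F <;> by_cases hlF : l ∈ F
      · rwa [hφ' k hkF, hφ' l hlF] at e
      · rw [hφ' k hkF, hφ l hlF] at e'; omega
      · rw [hφ k hkF, hφ' l hlF] at e'; omega
      · rw [hφ k hkF, hφ l hlF] at e'; exact Fin.ext (by omega)
    obtain ⟨g, hgG, hgF⟩ := Finset.not_subset.1 hGF
    calc ∑ k ∈ G, (n - (k : ℕ)) < ∑ k ∈ G, (n - (φ k : ℕ)) := by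
          refine Finset.sum_lt_sum (fun k _ => ?_) ⟨g, hgG, ?_⟩
          · by_cases hkF : k ∈ F
            · rw [hφ' k hkF]
            · rw [hφ k hkF]; omega
          · have := hG.1 g hgG
            rw [hφ g hgF]; omega
      _ = ∑ k ∈ G.image φ, (n - (k : ℕ)) := (Finset.sum_image (f := fun k : Fin n => n - (k : ℕ)) hinj).symm
      _ ≤ ∑ k ∈ F, (n - (k : ℕ)) :=
          Finset.sum_le_sum_of_subset (Finset.image_subset_iff.2 hmap)

/-- With the cuts placed at `F`, the sum is `intPeakSum F` plus interior peak sums of strictly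
smaller weight. -/
theorem intPeakSum_mem_of_sumOf_noPeakInBlocks_mem {K : Submodule ℚ QS}
    (hK : ∀ C, QS.sumOf (NoPeakInBlocks n C) ∈ K) (F : Finset (Fin n)) : intPeakSum F ∈ K := by
  classical
  induction hm : ∑ k ∈ F, (n - (k : ℕ)) using Nat.strong_induction_on generalizing F with
  | _ m ih =>
    -- As peaks count from `1` and cuts from `0`, this cuts immediately after each prescribed peak.
    let C : ℕ → Prop := fun k => ∃ l ∈ F, (l : ℕ) = k
    have hCF : ∀ w : Equiv.Perm (Fin n), NoPeakInBlocks n C w ↔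
        ∀ k ∈ intPeak w, (∃ l ∈ F, (l : ℕ) = k - 1) ∨ k ∈ F := by
      intro w
      rw [noPeakInBlocks_iff]
      refine forall₂_congr fun k _ => or_congr Iff.rfl ⟨fun ⟨l, hl, e⟩ => ?_, fun hk => ⟨k, hk, rfl⟩⟩
      rwa [← Fin.ext e]
    have hrest : QS.sumOf (fun w => NoPeakInBlocks n C w ∧ intPeak w ≠ F) ∈ K := by
      refine sum_filter_mem_of_fibers intPeak QS.of _ _ (fun w w' h hw => ?_) fun w hw => ?_
      · rw [hCF] at hw ⊢
        rwa [h]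
      · have := ih _ (hm ▸ sum_sub_lt_of_subset_union (isIntPeakSet_intPeak w)
          ((hCF w).1 hw.1) hw.2) (intPeak w) rfl
        rw [intPeakSum] at this
        convert this
    have hsplit : QS.sumOf (NoPeakInBlocks n C) =
        intPeakSum F + QS.sumOf (fun w => NoPeakInBlocks n C w ∧ intPeak w ≠ F) := by
      rw [intPeakSum_eq_sumOf, QS.sumOf_eq_sum_ite, QS.sumOf_eq_sum_ite, QS.sumOf_eq_sum_ite,
        ← Finset.sum_add_distrib]
      refine Finset.sum_congr rfl fun w _ => ?_
      by_cases hw : intPeak w = F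
      · have : NoPeakInBlocks n C w := (hCF w).2 fun k hk => Or.inr (hw ▸ hk)
        simp [hw, this]
      · simp [hw]
    rw [← add_sub_cancel_right (intPeakSum F), ← hsplit]
    exact K.sub_mem (hK C) hrest

/-- The permutations that decrease until the position of `1` and increase from there on. -/
def IsValley {n : ℕ} (w : Equiv.Perm (Fin (n + 1))) : Prop :=
  (∀ i j, i < j → j ≤ w⁻¹ 0 → w j < w i) ∧ ∀ i j, w⁻¹ 0 ≤ i → i < j → w i < w j

/-- Without peaks an ascent is followed by ascents only. Hence none can occur before the minimum,
and the step leaving the minimum starts an unbroken run of them. -/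
theorem isValley_of_noPeak {w : Equiv.Perm (Fin (n + 1))}
    (h : NoPeakInBlocks (n + 1) (fun _ => False) w) : IsValley w := by
  have step : ∀ i : ℕ, ∀ (hi : i + 1 < n + 1), w ⟨i, by omega⟩ < w ⟨i + 1, hi⟩ →
      ∀ j, i + 1 ≤ j → ∀ hj : j < n + 1, w ⟨i, by omega⟩ < w ⟨j, hj⟩ ∧
        w ⟨j - 1, by omega⟩ < w ⟨j, hj⟩ := by
    intro i hi hlt j hij
    induction j, hij using Nat.le_induction with
    | base => exact fun hj => ⟨hlt, hlt⟩
    | succ m hm ih =>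
      intro hj
      have h1 := ih (by omega)
      have h2 := h ⟨m - 1, by omega⟩ ⟨m, by omega⟩ ⟨m + 1, hj⟩ (by simp only; omega) rfl not_false
        not_false
      have h3 : w ⟨m, by omega⟩ < w ⟨m + 1, hj⟩ := by
        refine lt_of_le_of_ne (not_lt.1 fun h4 => h2 ⟨h1.2, h4⟩) (w.injective.ne ?_)
        simp [Fin.ext_iff]
      exact ⟨h1.1.trans h3, h3⟩
  have hmin : ∀ i, i ≠ w⁻¹ 0 → 0 < w i := fun i hi =>
    Fin.pos_iff_ne_zero.2 fun e => hi (by rw [← e]; simp)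
  have hw0 : w (w⁻¹ 0) = 0 := by simp
  constructor
  · rintro ⟨i, hi⟩ ⟨j, hj⟩ hij hjm
    rw [Fin.mk_lt_mk] at hij
    rw [Fin.le_def] at hjm
    simp only at hjm
    have key : ∀ k, (hk : k + 1 < n + 1) → k + 1 ≤ ((w⁻¹ 0 : Fin (n + 1)) : ℕ) →
        w ⟨k + 1, hk⟩ < w ⟨k, by omega⟩ := by
      intro k hk hkm
      refine lt_of_le_of_ne (not_lt.1 fun hlt => ?_) (w.injective.ne ?_)
      · have := (step k hk hlt _ hkm (w⁻¹ 0).2).1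
        rw [Fin.eta, hw0] at this
        exact absurd this (Fin.not_lt_zero _)
      · simp [Fin.ext_iff]
    revert hj
    induction j, hij using Nat.le_induction with
    | base => exact fun hj => key i hj hjm
    | succ m hm ih => exact fun hj => (key m hj hjm).trans (ih (by omega) (by omega) (by omega))
  · rintro ⟨i, hi⟩ ⟨j, hj⟩ him hij
    rw [Fin.mk_lt_mk] at hij
    rw [Fin.le_def] at him
    simp only at him
    have hm1 : ((w⁻¹ 0 : Fin (n + 1)) : ℕ) + 1 < n + 1 := by omega
    have hlt : w ⟨(w⁻¹ 0 : Fin (n + 1)), (w⁻¹ 0).2⟩ < w ⟨(w⁻¹ 0 : Fin (n + 1)) + 1, hm1⟩ := by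
      rw [Fin.eta, hw0]
      exact hmin _ fun e => by have := congrArg Fin.val e; simp at this
    have key : ∀ k, (hk : k + 1 < n + 1) → ((w⁻¹ 0 : Fin (n + 1)) : ℕ) ≤ k →
        w ⟨k, by omega⟩ < w ⟨k + 1, hk⟩ := fun k hk hmk =>
      (step _ hm1 hlt (k + 1) (by omega) hk).2
    revert hj
    induction j, hij using Nat.le_induction with
    | base => exact fun hj => key i hj him
    | succ m hm ih => exact fun hj => (ih (by omega) (by omega)).trans (key m hj (by omega))

theorem noPeak_iff_isValley (w : Equiv.Perm (Fin (n + 1))) :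
    NoPeakInBlocks (n + 1) (fun _ => False) w ↔ IsValley w := by
  refine ⟨isValley_of_noPeak, fun h i j k hij hjk _ _ hw => ?_⟩
  by_cases hj : j ≤ w⁻¹ 0
  · exact lt_asymm hw.1 (h.1 i j (by rw [Fin.lt_def]; omega) hj)
  · exact lt_asymm hw.2 (h.2 j k (not_le.1 hj).le (by rw [Fin.lt_def]; omega))

/-- The signs that turn a permutation that decreases until the position `m` and increases from
there on into an increasing signed permutation, `t` being the sign in position `m`. -/
def valleySign (m : Fin (n + 1)) (t : ℤˣ) (i : Fin (n + 1)) : ℤˣ :=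
  if i < m then -1 else if i = m then t else 1

/-- An increasing signed word has its negative letters first, with decreasing absolute values, and
then its positive letters. The letter of absolute value `1` lies at the junction, with either sign.
-/
theorem strictMono_val_mk_iff (w : Equiv.Perm (Fin (n + 1))) (s : Fin (n + 1) → ℤˣ) :
    StrictMono (SignedPerm.val ⟨w, s⟩) ↔ IsValley w ∧ ∃ t, valleySign (w⁻¹ 0) t = s := by
  have hw0 : w (w⁻¹ 0) = 0 := by simp
  generalize hm : w⁻¹ 0 = m at hw0
  have hpos : ∀ i, i ≠ m → 0 < (w i : ℕ) := fun i hi => by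
    refine Nat.pos_of_ne_zero fun e => hi ?_
    rw [← hm, ← (Fin.ext e : w i = 0)]
    simp
  have hw0' : (w m : ℕ) = 0 := by rw [hw0]; rfl
  simp only [IsValley, hm]
  constructor
  · intro h
    have hneg : ∀ i, i < m → s i = -1 := by
      intro i hi
      have h1 := h hi
      have h2 := hpos i hi.ne
      refine (Int.units_eq_one_or (s i)).resolve_left fun e => ?_
      rcases Int.units_eq_one_or (s m) with e' | e' <;> simp [SignedPerm.val, e, e', hw0'] at h1 <;>
        omega
    have hplus : ∀ i, m < i → s i = 1 := by
      intro i hi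
      have h1 := h hi
      have h2 := hpos i hi.ne'
      refine (Int.units_eq_one_or (s i)).resolve_right fun e => ?_
      rcases Int.units_eq_one_or (s m) with e' | e' <;> simp [SignedPerm.val, e, e', hw0'] at h1 <;>
        omega
    refine ⟨⟨fun i j hij hjm => ?_, fun i j hmi hij => ?_⟩, s m, ?_⟩
    · rcases hjm.lt_or_eq with hj | rfl
      · have h1 := h hij
        simp [SignedPerm.val, hneg i (hij.trans hj), hneg j hj] at h1
        rw [Fin.lt_def]
        omega
      · rw [Fin.lt_def, hw0']
        exact hpos i hij.ne
    · rcases hmi.lt_or_eq with hi | rfl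
      · have h1 := h hij
        simp [SignedPerm.val, hplus j (hi.trans hij), hplus i hi] at h1
        exact h1
      · rw [Fin.lt_def, hw0']
        exact hpos j hij.ne'
    · ext1 i
      rcases lt_trichotomy i m with hi | rfl | hi
      · rw [valleySign, if_pos hi, hneg i hi]
      · simp [valleySign]
      · rw [valleySign, if_neg hi.not_gt, if_neg hi.ne', hplus i hi]
  · rintro ⟨⟨h1, h2⟩, t, rfl⟩ i j hij
    have hneg : ∀ i, i < m → valleySign m t i = -1 := fun i hi => by simp [valleySign, hi]
    have hplus : ∀ i, m < i → valleySign m t i = 1 := fun i hi => by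
      simp [valleySign, hi.not_gt, hi.ne']
    have hval : ∀ i, i < m → SignedPerm.val ⟨w, valleySign m t⟩ i = -(w i + 1) := fun i hi => by
      simp [SignedPerm.val, hneg i hi]
    have hval' : ∀ i, m < i → SignedPerm.val ⟨w, valleySign m t⟩ i = w i + 1 := fun i hi => by
      simp [SignedPerm.val, hplus i hi]
    have hvalm : SignedPerm.val ⟨w, valleySign m t⟩ m = 1 ∨
        SignedPerm.val ⟨w, valleySign m t⟩ m = -1 := by
      rcases Int.units_eq_one_or t with rfl | rfl <;> simp [SignedPerm.val, valleySign, hw0']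
    rcases lt_trichotomy i m with hi | rfl | hi
    · have hpi := hpos i hi.ne
      rcases lt_trichotomy j m with hj | rfl | hj
      · have := Fin.lt_def.1 (h1 i j hij hj.le)
        rw [hval i hi, hval j hj]; omega
      · rw [hval i hi]; omega
      · rw [hval i hi, hval' j hj]; omega
    · have hpj := hpos j hij.ne'
      rw [hval' j hij]; omega
    · have := Fin.lt_def.1 (h2 i j hi.le hij)
      rw [hval' i hi, hval' j (hi.trans hij)]; omega

/-- The factor `2` counts the signs of the letter of absolute value `1`. -/
theorem forgetSigns_incr_succ (n : ℕ) : forgetSigns (QB.incr Set.univ (n + 1)) =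
    (2 : ℚ) • QS.sumOf (NoPeakInBlocks (n + 1) fun _ => False) := by
  classical
  rw [QB.incr, forgetSigns_sumOf, QS.sumOf_eq_sum_ite, Finset.smul_sum]
  refine Finset.sum_congr rfl fun w _ => ?_
  simp only [Set.mem_univ, implies_true, true_and, strictMono_val_mk_iff, noPeak_iff_isValley]
  by_cases hw : IsValley w
  · have : (Finset.univ.filter fun s => ∃ t, valleySign (w⁻¹ 0) t = s) =
        Finset.univ.image (valleySign (w⁻¹ 0)) := by
      ext s; simp
    have hinj : Function.Injective (valleySign (w⁻¹ 0)) := fun t t' h => by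
      simpa [valleySign] using congrFun h (w⁻¹ 0)
    simp only [hw, true_and, if_true]
    rw [this, Finset.card_image_of_injective _ hinj, Finset.card_univ, Fintype.card_units_int,
      ← Nat.cast_smul_eq_nsmul ℚ]
    norm_num
  · simp [hw]

theorem exists_forgetSigns_incr_eq (n : ℕ) : ∃ a : ℚ, a ≠ 0 ∧
    forgetSigns (QB.incr Set.univ n) = a • QS.sumOf (NoPeakInBlocks n fun _ => False) := by
  cases n with
  | zero =>
    refine ⟨1, one_ne_zero, ?_⟩
    rw [one_smul, QB.incr, forgetSigns_sumOf_of_sign_eq Fin.elim0 fun w _ => funext fun i => i.elim0]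
    exact QS.sumOf_congr fun w => iff_of_true ⟨fun i => i.elim0, fun i => i.elim0⟩
      fun i => i.elim0
  | succ n => exact ⟨2, two_ne_zero, forgetSigns_incr_succ n⟩

/-- Both sides are the span of the sums over permutations without peaks inside blocks: these are, up
to nonzero scalars, the products of the images of the generators, and they span the peak ideals by
triangularity. -/
theorem map_forgetSigns_CanonicalI : CanonicalI.map forgetSigns = PeakInt := by
  rw [CanonicalI_eq_incrSub, incrSub, isGradedSurjection_forgetSigns.map_genSub]
  apply le_antisymm
  · refine Submodule.span_le.2 ?_
    rintro _ ⟨L, rfl⟩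
    have : ∃ (n : ℕ) (a : ℚ) (C : ℕ → Prop), listMul QS.ops
        (L.map fun x : Unit × ℕ => forgetSigns (QB.incr Set.univ x.2)) =
        a • QS.sumOf (NoPeakInBlocks n C) := by
      induction L with
      | nil =>
        refine ⟨0, 1, fun _ => False, ?_⟩
        classical
        have hu : (Finset.univ : Finset (Equiv.Perm (Fin 0))) = {1} :=
          Finset.eq_singleton_iff_unique_mem.2
            ⟨Finset.mem_univ _, fun _ _ => Subsingleton.elim _ _⟩
        rw [one_smul, QS.sumOf_eq_sum_ite, hu, Finset.sum_singleton, if_pos]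
        · rfl
        · exact fun i => i.elim0
      | cons x L ih =>
        obtain ⟨q, b, C, e⟩ := ih
        obtain ⟨a, -, e'⟩ := exists_forgetSigns_incr_eq x.2
        -- The cuts of the tail are shifted by `x.2`, and a cut is added at the junction.
        refine ⟨x.2 + q, a * b, fun j => j = x.2 ∨ (x.2 < j ∧ C (j - x.2)), ?_⟩
        rw [← QS.mul_sumOf_noPeakInBlocks (Or.inl rfl), List.map_cons, listMul, List.foldr_cons]
        refine (congrArg (QS.ops.mul (forgetSigns (QB.incr Set.univ x.2))) e).trans ?_
        rw [e', map_smul, map_smul, LinearMap.smul_apply, smul_smul, mul_comm b a]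
        have h1 : QS.sumOf (NoPeakInBlocks x.2 fun _ => False) = QS.sumOf
            (NoPeakInBlocks x.2 fun j => j = x.2 ∨ (x.2 < j ∧ C (j - x.2))) := by
          refine QS.sumOf_congr fun w => forall₃_congr fun i j k => ?_
          simp [j.2.ne, k.2.ne, j.2.not_gt, k.2.not_gt]
        have h2 : QS.sumOf (NoPeakInBlocks q C) = QS.sumOf (NoPeakInBlocks q
            fun i => x.2 + i = x.2 ∨ (x.2 < x.2 + i ∧ C (x.2 + i - x.2))) := by
          refine QS.sumOf_congr fun w => forall₃_congr fun i j k =>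
            forall₂_congr fun hij hjk => ?_
          have hj : (j : ℕ) ≠ 0 := by omega
          have hk : (k : ℕ) ≠ 0 := by omega
          simp [Nat.pos_of_ne_zero hj, Nat.pos_of_ne_zero hk, hj, hk]
        rw [h1, h2]
    obtain ⟨n, a, C, e⟩ := this
    rw [SetLike.mem_coe]
    simp only [e]
    exact Submodule.smul_mem _ _
      (Submodule.mem_iSup_of_mem n (sumOf_noPeakInBlocks_mem_peakIdeal C))
  · refine iSup_le fun n => Submodule.span_le.2 ?_
    rintro _ ⟨F, -, rfl⟩
    refine intPeakSum_mem_of_sumOf_noPeakInBlocks_mem (fun C => ?_) F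
    clear F
    induction n using Nat.strong_induction_on generalizing C with
    | _ n ih =>
      -- Factor at an inner cut; without one, the sum is a multiple of the image of a generator.
      by_cases hp : ∃ p, 1 ≤ p ∧ p < n ∧ C p
      · obtain ⟨p, h1, hpn, hC⟩ := hp
        obtain ⟨q, rfl⟩ := Nat.exists_eq_add_of_le hpn.le
        rw [← QS.mul_sumOf_noPeakInBlocks hC]
        exact mul_mem_genSub QS.isConnectedGradedBialgebra (ih p hpn C) (ih q (by omega) _)
      · push Not at hp
        obtain ⟨a, ha, e⟩ := exists_forgetSigns_incr_eq n
        have hcongr : QS.sumOf (NoPeakInBlocks n C) =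
            QS.sumOf (NoPeakInBlocks n fun _ => False) := by
          refine QS.sumOf_congr fun w => forall₃_congr fun i j k => forall₂_congr fun hij hjk => ?_
          simp [hp j (by omega) j.2, hp k (by omega) k.2]
        rw [hcongr, ← inv_smul_smul₀ ha (QS.sumOf _), ← e]
        exact Submodule.smul_mem _ _ (gen_mem_genSub
          (g := fun x : Unit × ℕ => forgetSigns (QB.incr Set.univ x.2))
          QS.isConnectedGradedBialgebra ((), n))

end Peaks

/-! ### The Hopf algebras and their subalgebras -/

theorem mainTheorem12 :
    (∃ S : QB →ₗ[ℚ] QB,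
      IsGradedHopfAlgebra QB.ops S ∧
      IsGradedHopfSubalgebra QB.ops S OmegaB ∧
      IsGradedHopfSubalgebra QB.ops S CanonicalI ∧
      CanonicalI ≤ OmegaB) ∧
    (∃ S : QS →ₗ[ℚ] QS,
      IsGradedHopfAlgebra QS.ops S ∧
      IsGradedHopfSubalgebra QS.ops S SigmaA ∧
      IsGradedHopfSubalgebra QS.ops S PeakInt ∧
      PeakInt ≤ SigmaA) := by
  have hΩ : IsGradedSubbialgebra QB.ops OmegaB :=
    OmegaB_eq_incrSub ▸ isGradedSubbialgebra_incrSub _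
  have hI : IsGradedSubbialgebra QB.ops CanonicalI :=
    CanonicalI_eq_incrSub ▸ isGradedSubbialgebra_incrSub _
  have hσ : IsGradedSubbialgebra QS.ops SigmaA :=
    map_forgetSigns_OmegaB ▸ isGradedSurjection_forgetSigns.isGradedSubbialgebra_map hΩ
  have hP : IsGradedSubbialgebra QS.ops PeakInt :=
    map_forgetSigns_CanonicalI ▸ isGradedSurjection_forgetSigns.isGradedSubbialgebra_map hI
  constructor
  · obtain ⟨S, hS⟩ := QB.isConnectedGradedBialgebra.exists_antipode
    exact ⟨S, QB.isConnectedGradedBialgebra.isGradedHopfAlgebra hS,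
      hΩ.isGradedHopfSubalgebra hS, hI.isGradedHopfSubalgebra hS, CanonicalI_le_OmegaB⟩
  · obtain ⟨S, hS⟩ := QS.isConnectedGradedBialgebra.exists_antipode
    refine ⟨S, QS.isConnectedGradedBialgebra.isGradedHopfAlgebra hS,
      hσ.isGradedHopfSubalgebra hS, hP.isGradedHopfSubalgebra hS, ?_⟩
    rw [← map_forgetSigns_OmegaB, ← map_forgetSigns_CanonicalI]
    exact Submodule.map_mono CanonicalI_le_OmegaB

end
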